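/- Conventions. All vector bundles are complex, locally trivial and of finite, possibly non-constant, rank. For a topological group $H$ and a compact Hausdorff $H$-space $X$, an $H$-vector bundle over $X$ is a vector bundle $E\to X$ with a continuous action of $H$ on $E$ that covers the action on $X$ and is linear on the fibres. $K_H^0(X)$ is the Grothendieck group of the monoid (under $\oplus$) of isomorphism classes of $H$-vector bundles over $X$. For $H$ finite and $n\ge 1$, $K_H^n(X):=\widetilde K{}_H^0(\Sigma^nX_+)$, the kernel of the restriction $K_H^0(\Sigma^nX_+)\to K_H^0(\mathrm{pt})$ to the base point, where $\Sigma^nX_+=S^n\wedge X_+$ (the one-point compactification of $\mathbb R^n\times X$, with $H$ acting through $X$). For a finite group $Q$ and a normalised 2-cocycle $\alpha:Q\times Q\to\mathbb S^1$ let $\widetilde Q_\alpha$ be the set $Q\times\mathbb S^1$ with the product $(q_1,z_1)(q_2,z_2)=(q_1q_2,\alpha(q_1,q_2)z_1z_2)$. For a compact Hausdorff $Q$-space $X$, ${}^{\alpha}K_Q^0(X)$ is the Grothendieck group of the monoid of isomorphism classes of those $\widetilde Q_\alpha$-vector bundles over $X$ on which the central $\mathbb S^1$ acts by multiplication by scalars,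 and ${}^{\alpha}K_Q^n(X):={}^{\alpha}\widetilde K{}_Q^0(\Sigma^nX_+)$ for $n\ge1$. Let $A$ be a normal subgroup of a finite group $G$, and let $Q=G/A$. Let $\mathrm{Irr}(A)$ be the set of isomorphism classes of complex irreducible representations of $A$, on which $G$ acts by $(g\cdot\tau)(a)=\tau(g^{-1}ag)$. For each orbit in $G\backslash\mathrm{Irr}(A)$ fix an irreducible unitary representation $\tau:A\to U(V_\tau)$ whose class $[\tau]$ lies in that orbit. Let $G_{[\tau]}$ be the isotropy group of $[\tau]$ and $Q_{[\tau]}=G_{[\tau]}/A\subset Q$. Choose a map $\sigma:Q_{[\tau]}\to G_{[\tau]}$ with $\sigma(q)A=q$ and $\sigma(1)=1$, and $M_q\in U(V_\tau)$ for $q\in Q_{[\tau]}$ with $M_1=1$ and $\tau(\sigma(q)^{-1}a\sigma(q))=M_q^{-1}\tau(a)M_q$ for all $a\in A$ (such choices exist). Let $\alpha_\tau:Q_{[\tau]}\times Q_{[\tau]}\to\mathbb S^1$ be the normalised 2-cocycle given by the scalars $$\alpha_\tau(q_1,q_2)=\tau\big(\sigma(q_1q_2)^{-1}\sigma(q_1)\sigma(q_2)\big)M_{q_2}^{-1}M_{q_1}^{-1}M_{q_1q_2}.$$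 Let $X$ be a compact Hausdorff $G$-space on which $A$ acts trivially. For a $G$-vector bundle $E$ over $X$ let $\mathrm{Hom}_A(\mathbb V_\tau,E)$ be the bundle over $X$ with fibres $\mathrm{Hom}_A(V_\tau,E_x)$, on which $(q,z)$ in the central extension of $Q_{[\tau]}$ given by $\alpha_\tau$ acts by $((q,z)f)(v)=z\,\sigma(q)f(M_q^{-1}v)$. Theorem. For every such $X$ and $E$, $\mathrm{Hom}_A(\mathbb V_\tau,E)$ is an $\alpha_\tau$-twisted $Q_{[\tau]}$-equivariant vector bundle over $X$, and there are isomorphisms of abelian groups $$\Psi_X:K_G^n(X)\longrightarrow\bigoplus_{[\tau]\in G\backslash\mathrm{Irr}(A)}{}^{\alpha_\tau}K^n_{Q_{[\tau]}}(X)\qquad(n\ge0)$$ which in degree $0$ satisfy $\Psi_X([E])=\bigoplus_{[\tau]}[\mathrm{Hom}_A(\mathbb V_\tau,E)]$ and in degree $n\ge1$ are the restrictions of the degree-$0$ isomorphisms $\Psi_{\Sigma^nX_+}$ to the reduced groups. They are functorial: for every continuous $G$-map $f:X\to Y$ of compact Hausdorff $G$-spaces on which $A$ acts trivially, $\Psi_X\circ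 f^*=f^*\circ\Psi_Y$ in every degree. -/

import Mathlib

open Topology DirectSum

universe u v

noncomputable section

namespace EqK

/-! ## Compact Hausdorff spaces with a group action -/

/-- A compact Hausdorff space with a continuous left action of the topological group `H`. -/
structure GSpace (H : Type v) [Group H] [TopologicalSpace H] where
  carrier : Type u
  [top : TopologicalSpace carrier]
  [compact : CompactSpace carrier]
  [t2 : T2Space carrier]
  [act : MulAction H carrier]
  [cont : ContinuousSMul H carrier]

attribute [instance] GSpace.top GSpace.compact GSpace.t2 GSpace.act GSpace.cont

instance {H : Type v} [Group H] [TopologicalSpace H] : CoeSort (GSpace.{u, v} H) (Type u) :=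
  ⟨GSpace.carrier⟩

section Spaces

variable {H : Type v} [Group H] [TopologicalSpace H]

/-- A continuous equivariant map. -/
structure GMap (X Y : GSpace.{u, v} H) where
  toFun : X → Y
  continuous : Continuous toFun
  map_smul : ∀ (h : H) (x : X), toFun (h • x) = h • toFun x

def GMap.comp {X Y Z : GSpace.{u, v} H} (f : GMap Y X) (g : GMap Z Y) : GMap Z X where
  toFun := f.toFun ∘ g.toFun
  continuous := f.continuous.comp g.continuous
  map_smul h z := by simp only [Function.comp_apply, g.map_smul, f.map_smul]

/-- Restriction of the action along a continuous homomorphism. -/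
def GSpace.comap {H' : Type*} [Group H'] [TopologicalSpace H'] (φ : H' →* H) (hφ : Continuous φ)
    (X : GSpace.{u, v} H) : GSpace.{u} H' :=
  letI : MulAction H' X := MulAction.compHom X φ
  { carrier := X
    cont := ⟨(hφ.comp continuous_fst).smul continuous_snd⟩ }

def GMap.comap {H' : Type*} [Group H'] [TopologicalSpace H'] (φ : H' →* H) (hφ : Continuous φ)
    {X Y : GSpace.{u, v} H} (f : GMap X Y) : GMap (X.comap φ hφ) (Y.comap φ hφ) where
  toFun := f.toFun
  continuous := f.continuous
  map_smul h x := f.map_smul (φ h) x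

/-- The one-point space. -/
def GSpace.point (H : Type v) [Group H] [TopologicalSpace H] : GSpace.{u, v} H :=
  letI : MulAction H PUnit.{u + 1} :=
    { smul := fun _ x => x, one_smul := fun _ => rfl, mul_smul := fun _ _ _ => rfl }
  { carrier := PUnit
    cont := ⟨continuous_snd⟩ }

theorem continuous_onePoint_map {X Y : Type*} [TopologicalSpace X] [TopologicalSpace Y]
    [CompactSpace X] [T2Space X] [CompactSpace Y] [T2Space Y] (n : ℕ) {f : X → Y}
    (hf : Continuous f) :
    Continuous (OnePoint.map (Prod.map id f :
      EuclideanSpace ℝ (Fin n) × X → EuclideanSpace ℝ (Fin n) × Y)) := by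
  have hp : IsProperMap (Prod.map id f :
      EuclideanSpace ℝ (Fin n) × X → EuclideanSpace ℝ (Fin n) × Y) :=
    isProperMap_id.prodMap hf.isProperMap
  refine OnePoint.continuous_map hp.continuous ?_
  rw [Filter.coclosedCompact_eq_cocompact, Filter.coclosedCompact_eq_cocompact]
  exact (isProperMap_iff_tendsto_cocompact.1 hp).2

/-- The iterated reduced suspension `Σⁿ(X₊) = Sⁿ ∧ X₊`, realised as the one-point compactification
of `ℝⁿ × X`, on which the group acts through `X`; the base point is `∞`. (Since `X` is compact,
collapsing `{∞} × X` in `(ℝⁿ)⁺ × X` gives this space. For `n = 0` it is `X₊`, as `X` is compact.) -/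
def GSpace.susp [DiscreteTopology H] (n : ℕ) (X : GSpace.{u, v} H) : GSpace.{u, v} H :=
  letI : MulAction H (OnePoint (EuclideanSpace ℝ (Fin n) × X)) :=
    { smul := fun h => OnePoint.map (Prod.map id (fun x => h • x))
      one_smul := fun t => by
        cases t using OnePoint.rec with
        | infty => rfl
        | coe p => exact congrArg (fun y => OnePoint.some (p.1, y)) (one_smul H p.2)
      mul_smul := fun g h t => by
        cases t using OnePoint.rec with
        | infty => rfl
        | coe p => exact congrArg (fun y => OnePoint.some (p.1, y)) (mul_smul g h p.2) }
  { carrier := OnePoint (EuclideanSpace ℝ (Fin n) × X)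
    cont := ⟨continuous_prod_of_discrete_left.2 fun h =>
      continuous_onePoint_map n (continuous_const_smul h)⟩ }

def GMap.susp [DiscreteTopology H] (n : ℕ) {X Y : GSpace.{u, v} H} (f : GMap X Y) :
    GMap (X.susp n) (Y.susp n) where
  toFun := OnePoint.map (Prod.map id f.toFun)
  continuous := continuous_onePoint_map n f.continuous
  map_smul h t := by
    cases t using OnePoint.rec with
    | infty => rfl
    | coe p => exact congrArg (fun y => OnePoint.some (p.1, y)) (f.map_smul h p.2)

/-- The inclusion of the base point of `Σⁿ(X₊)`. -/
def GSpace.base [DiscreteTopology H] (n : ℕ) (X : GSpace.{u, v} H) :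
    GMap (GSpace.point.{u, v} H) (X.susp n) where
  toFun _ := OnePoint.infty
  continuous := continuous_const
  map_smul _ _ := rfl

end Spaces

/-! ## Equivariant complex vector bundles -/

section Bundles

variable {H : Type v} [Group H] [TopologicalSpace H]

/-- A family of complex vector spaces over `X`, with a topology on the total space, and with a
fibrewise linear action of `H` on the total space covering the action on `X`. The action of `h` is
given by linear maps `E_x → E_y`, one for each `x, y` with `h • x = y`. -/
structure EqFamily (X : GSpace.{u, v} H) where
  Fib : X → Type u
  [acg : ∀ x, AddCommGroup (Fib x)]
  [mod : ∀ x, Module ℂ (Fib x)]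
  [top : TopologicalSpace (Bundle.TotalSpace Unit Fib)]
  act : ∀ (h : H) {x y : X}, h • x = y → (Fib x →ₗ[ℂ] Fib y)
  act_one : ∀ {x : X} (e : (1 : H) • x = x) (v : Fib x), act 1 e v = v
  act_mul : ∀ (g h : H) {x y z : X} (hxy : h • x = y) (hyz : g • y = z) (hxz : (g * h) • x = z)
    (v : Fib x), act (g * h) hxz v = act g hyz (act h hxy v)

attribute [instance] EqFamily.acg EqFamily.mod EqFamily.top

namespace EqFamily

variable {X Y Z : GSpace.{u, v} H}

/-- The total space. -/
abbrev Tot (E : EqFamily X) : Type u := Bundle.TotalSpace Unit E.Fib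

/-- An `H`-equivariant family is an `H`-equivariant complex vector bundle if the projection and the
action are continuous and each point has an open neighbourhood `U` over which the family is
isomorphic to `U × ℂⁿ`, for some `n`, by a fibrewise linear homeomorphism. -/
structure IsBundle (E : EqFamily X) : Prop where
  continuous_proj : Continuous fun t : E.Tot => t.proj
  continuous_act : Continuous fun p : H × E.Tot =>
    (⟨p.1 • p.2.proj, E.act p.1 rfl p.2.snd⟩ : E.Tot)
  locally_trivial : ∀ x₀ : X, ∃ (U : Set X) (n : ℕ) (φ : ∀ x : U, E.Fib x ≃ₗ[ℂ] (Fin n → ℂ)),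
    IsOpen U ∧ x₀ ∈ U ∧
      IsHomeomorph fun t : {t : E.Tot // t.proj ∈ U} =>
        ((⟨t.1.proj, t.2⟩ : U), φ ⟨t.1.proj, t.2⟩ t.1.snd)

/-- Isomorphisms of equivariant families over `X`: fibrewise linear equivariant homeomorphisms of
the total spaces over `X`. -/
structure Iso (E F : EqFamily X) where
  toEquiv : ∀ x, E.Fib x ≃ₗ[ℂ] F.Fib x
  comm : ∀ (h : H) {x y : X} (e : h • x = y) (v : E.Fib x),
    toEquiv y (E.act h e v) = F.act h e (toEquiv x v)
  continuous_toFun : Continuous fun t : E.Tot => (⟨t.proj, toEquiv t.proj t.snd⟩ : F.Tot)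
  continuous_invFun : Continuous fun t : F.Tot => (⟨t.proj, (toEquiv t.proj).symm t.snd⟩ : E.Tot)

def Iso.refl (E : EqFamily X) : Iso E E where
  toEquiv _ := LinearEquiv.refl ℂ _
  comm _ _ _ _ _ := rfl
  continuous_toFun := continuous_id
  continuous_invFun := continuous_id

def Iso.symm {E F : EqFamily X} (i : Iso E F) : Iso F E where
  toEquiv x := (i.toEquiv x).symm
  comm h x y e v := by
    rw [LinearEquiv.symm_apply_eq, i.comm, LinearEquiv.apply_symm_apply]
  continuous_toFun := i.continuous_invFun
  continuous_invFun := i.continuous_toFun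

def Iso.trans {E F D : EqFamily X} (i : Iso E F) (j : Iso F D) : Iso E D where
  toEquiv x := (i.toEquiv x).trans (j.toEquiv x)
  comm h x y e v := by simp [i.comm, j.comm]
  continuous_toFun := j.continuous_toFun.comp i.continuous_toFun
  continuous_invFun := i.continuous_invFun.comp j.continuous_invFun

/-- The direct sum; its total space is the fibre product of the total spaces. -/
def sum (E F : EqFamily X) : EqFamily X where
  Fib x := E.Fib x × F.Fib x
  top := TopologicalSpace.induced
    (fun t => ((⟨t.proj, t.snd.1⟩ : E.Tot), (⟨t.proj, t.snd.2⟩ : F.Tot))) inferInstance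
  act h _ _ e := (E.act h e).prodMap (F.act h e)
  act_one e v := Prod.ext (E.act_one e v.1) (F.act_one e v.2)
  act_mul g h _ _ _ e e' e'' v := Prod.ext (E.act_mul g h e e' e'' v.1) (F.act_mul g h e e' e'' v.2)

/-- The zero bundle `X × 0`. -/
def zero (X : GSpace.{u, v} H) : EqFamily X where
  Fib _ := PUnit
  top := TopologicalSpace.induced (fun t => t.proj) inferInstance
  act _ _ _ _ := 0
  act_one _ _ := rfl
  act_mul _ _ _ _ _ _ _ _ _ := rfl

/-- The pullback `f^*E`; its total space is the fibre product of `Y` and the total space of `E`. -/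
def pullback (f : GMap Y X) (E : EqFamily X) : EqFamily Y where
  Fib y := E.Fib (f.toFun y)
  top := TopologicalSpace.induced
    (fun t => (t.proj, (⟨f.toFun t.proj, t.snd⟩ : E.Tot))) inferInstance
  act h y y' e := E.act h (x := f.toFun y) (y := f.toFun y') (by rw [← f.map_smul, e])
  act_one _ v := E.act_one _ v
  act_mul g h _ _ _ _ _ _ v := E.act_mul g h _ _ _ v

theorem act_heq (E : EqFamily X) (h : H) {x y y' : X} (e : h • x = y) (e' : h • x = y')
    (v : E.Fib x) : (⟨y, E.act h e v⟩ : E.Tot) = ⟨y', E.act h e' v⟩ := by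
  subst e; subst e'; rfl

theorem act_congr (E : EqFamily X) {g g' : H} (hg : g = g') {x y : X} (e : g • x = y)
    (e' : g' • x = y) (v : E.Fib x) : E.act g e v = E.act g' e' v := by
  subst hg; rfl

theorem continuous_sum_fst (E F : EqFamily X) :
    Continuous fun t : (E.sum F).Tot => (⟨t.proj, t.snd.1⟩ : E.Tot) :=
  continuous_fst.comp (continuous_induced_dom (t := instTopologicalSpaceProd)
    (f := fun t : (E.sum F).Tot => ((⟨t.proj, t.snd.1⟩ : E.Tot), (⟨t.proj, t.snd.2⟩ : F.Tot))))

theorem continuous_sum_snd (E F : EqFamily X) :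
    Continuous fun t : (E.sum F).Tot => (⟨t.proj, t.snd.2⟩ : F.Tot) :=
  continuous_snd.comp (continuous_induced_dom (t := instTopologicalSpaceProd)
    (f := fun t : (E.sum F).Tot => ((⟨t.proj, t.snd.1⟩ : E.Tot), (⟨t.proj, t.snd.2⟩ : F.Tot))))

theorem continuous_sum_mk {Z : Type*} [TopologicalSpace Z] {E F : EqFamily X}
    {f : Z → (E.sum F).Tot}
    (h₁ : Continuous fun z => (⟨(f z).proj, (f z).snd.1⟩ : E.Tot))
    (h₂ : Continuous fun z => (⟨(f z).proj, (f z).snd.2⟩ : F.Tot)) : Continuous f :=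
  continuous_induced_rng.2 (h₁.prodMk h₂)

theorem continuous_pullback_proj (f : GMap Y X) (E : EqFamily X) :
    Continuous fun t : (E.pullback f).Tot => t.proj :=
  continuous_fst.comp (continuous_induced_dom (t := instTopologicalSpaceProd)
    (f := fun t : (E.pullback f).Tot => (t.proj, (⟨f.toFun t.proj, t.snd⟩ : E.Tot))))

theorem continuous_pullback_lift (f : GMap Y X) (E : EqFamily X) :
    Continuous fun t : (E.pullback f).Tot => (⟨f.toFun t.proj, t.snd⟩ : E.Tot) :=
  continuous_snd.comp (continuous_induced_dom (t := instTopologicalSpaceProd)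
    (f := fun t : (E.pullback f).Tot => (t.proj, (⟨f.toFun t.proj, t.snd⟩ : E.Tot))))

theorem continuous_pullback_mk {Z : Type*} [TopologicalSpace Z] {f : GMap Y X} {E : EqFamily X}
    {g : Z → (E.pullback f).Tot} (h₁ : Continuous fun z => (g z).proj)
    (h₂ : Continuous fun z => (⟨f.toFun (g z).proj, (g z).snd⟩ : E.Tot)) : Continuous g :=
  continuous_induced_rng.2 (h₁.prodMk h₂)

theorem isHomeomorph_of_isInducing (E : EqFamily X) {U : Set X} {n : ℕ}
    (φ : ∀ x : U, E.Fib x ≃ₗ[ℂ] (Fin n → ℂ))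
    (h : IsInducing fun t : {t : E.Tot // t.proj ∈ U} =>
      ((⟨t.1.proj, t.2⟩ : U), φ ⟨t.1.proj, t.2⟩ t.1.snd)) :
    IsHomeomorph fun t : {t : E.Tot // t.proj ∈ U} =>
      ((⟨t.1.proj, t.2⟩ : U), φ ⟨t.1.proj, t.2⟩ t.1.snd) := by
  refine isHomeomorph_iff_isEmbedding_surjective.2 ⟨⟨h, ?_⟩, ?_⟩
  · rintro ⟨⟨x, v⟩, hx⟩ ⟨⟨y, w⟩, hy⟩ hvw
    have hxy : x = y := congrArg (fun p => (p.1 : X)) hvw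
    subst hxy
    have h2 : φ ⟨x, hx⟩ v = φ ⟨x, hx⟩ w := congrArg Prod.snd hvw
    rw [(φ ⟨x, hx⟩).injective h2]
  · rintro ⟨x, w⟩
    exact ⟨⟨⟨x, (φ x).symm w⟩, x.2⟩, Prod.ext rfl ((φ x).apply_symm_apply w)⟩

theorem IsBundle.sum {E F : EqFamily X} (hE : E.IsBundle) (hF : F.IsBundle) :
    (E.sum F).IsBundle where
  continuous_proj := hE.continuous_proj.comp (continuous_sum_fst E F)
  continuous_act := by
    refine continuous_sum_mk ?_ ?_
    · exact hE.continuous_act.comp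
        (continuous_fst.prodMk ((continuous_sum_fst E F).comp continuous_snd))
    · exact hF.continuous_act.comp
        (continuous_fst.prodMk ((continuous_sum_snd E F).comp continuous_snd))
  locally_trivial x₀ := by
    obtain ⟨U, n, φ, hU, hxU, hφ⟩ := hE.locally_trivial x₀
    obtain ⟨V, m, ψ, hV, hxV, hψ⟩ := hF.locally_trivial x₀
    let L : ((Fin n → ℂ) × (Fin m → ℂ)) ≃L[ℂ] (Fin (n + m) → ℂ) :=
      ContinuousLinearEquiv.ofFinrankEq (by simp)
    let χ : ∀ x : (U ∩ V : Set X), (E.sum F).Fib x ≃ₗ[ℂ] (Fin (n + m) → ℂ) := fun x =>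
      ((φ ⟨x, x.2.1⟩).prodCongr (ψ ⟨x, x.2.2⟩)).trans L.toLinearEquiv
    refine ⟨U ∩ V, n + m, χ, hU.inter hV, ⟨hxU, hxV⟩, isHomeomorph_of_isInducing (E.sum F) χ ?_⟩
    let j : {t : (E.sum F).Tot // t.proj ∈ U ∩ V} →
        {t : E.Tot // t.proj ∈ U} × {t : F.Tot // t.proj ∈ V} :=
      fun t => (⟨⟨t.1.proj, t.1.snd.1⟩, t.2.1⟩, ⟨⟨t.1.proj, t.1.snd.2⟩, t.2.2⟩)
    have hj₁ : Continuous fun t => (j t).1 :=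
      ((continuous_sum_fst E F).comp continuous_subtype_val).subtype_mk _
    have hj₂ : Continuous fun t => (j t).2 :=
      ((continuous_sum_snd E F).comp continuous_subtype_val).subtype_mk _
    have hj : IsInducing j := by
      refine IsInducing.of_comp (hj₁.prodMk hj₂)
        (continuous_subtype_val.prodMap continuous_subtype_val) ?_
      have h1 : IsInducing (fun t : (E.sum F).Tot =>
        ((⟨t.proj, t.snd.1⟩ : E.Tot), (⟨t.proj, t.snd.2⟩ : F.Tot))) := ⟨rfl⟩
      exact h1.comp IsInducing.subtypeVal
    have hk := (hφ.isEmbedding.isInducing.prodMap hψ.isEmbedding.isInducing).comp hj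
    let g : (U ∩ V : Set X) × (Fin (n + m) → ℂ) → (U × (Fin n → ℂ)) × (V × (Fin m → ℂ)) :=
      fun p => ((⟨p.1, p.1.2.1⟩, (L.symm p.2).1), (⟨p.1, p.1.2.2⟩, (L.symm p.2).2))
    have hg : Continuous g := by
      have := L.symm.continuous
      have h1 : Continuous fun p : (U ∩ V : Set X) × (Fin (n + m) → ℂ) => (p.1 : X) :=
        continuous_subtype_val.comp continuous_fst
      exact ((h1.subtype_mk _).prodMk (this.comp continuous_snd).fst).prodMk
        ((h1.subtype_mk _).prodMk (this.comp continuous_snd).snd)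
    refine IsInducing.of_comp ?_ hg ?_
    · refine Continuous.prodMk ?_ ?_
      · exact ((hE.continuous_proj.comp (continuous_sum_fst E F)).comp
          continuous_subtype_val).subtype_mk _
      · exact L.continuous.comp
          ((hφ.continuous.comp hj₁).snd.prodMk (hψ.continuous.comp hj₂).snd)
    · convert hk using 1
      funext t
      have hL : L.symm (χ ⟨t.1.proj, t.2⟩ t.1.snd) =
          (φ ⟨t.1.proj, t.2.1⟩ t.1.snd.1, ψ ⟨t.1.proj, t.2.2⟩ t.1.snd.2) := L.symm_apply_apply _
      refine Prod.ext (Prod.ext rfl ?_) (Prod.ext rfl ?_)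
      · exact congrArg (fun p => p.1) hL
      · exact congrArg (fun p => p.2) hL

theorem isBundle_zero (X : GSpace.{u, v} H) : (zero X).IsBundle where
  continuous_proj := continuous_induced_dom
  continuous_act := continuous_induced_rng.2 <|
    continuous_fst.smul (continuous_induced_dom.comp continuous_snd)
  locally_trivial x₀ := by
    let χ : ∀ x : (Set.univ : Set X), (zero X).Fib x ≃ₗ[ℂ] (Fin 0 → ℂ) := fun x =>
      ⟨0, fun _ => PUnit.unit, fun _ => rfl, fun _ => Subsingleton.elim _ _⟩
    refine ⟨Set.univ, 0, χ, isOpen_univ, trivial, isHomeomorph_of_isInducing (zero X) χ ?_⟩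
    have h1 : IsInducing (fun t : (zero X).Tot => t.proj) := ⟨rfl⟩
    let g : ((Set.univ : Set X) : Type u) × (Fin 0 → ℂ) → X := fun p => p.1.1
    refine IsInducing.of_comp (g := g) ?_ (continuous_subtype_val.comp continuous_fst)
      (h1.comp IsInducing.subtypeVal)
    exact ((h1.continuous.comp continuous_subtype_val).subtype_mk _).prodMk continuous_const

theorem IsBundle.pullback (f : GMap Y X) {E : EqFamily X} (hE : E.IsBundle) :
    (E.pullback f).IsBundle where
  continuous_proj := continuous_pullback_proj f E
  continuous_act := by
    refine continuous_pullback_mk ?_ ?_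
    · exact continuous_fst.smul ((continuous_pullback_proj f E).comp continuous_snd)
    · refine (hE.continuous_act.comp (continuous_fst.prodMk
        ((continuous_pullback_lift f E).comp continuous_snd))).congr fun p => ?_
      exact E.act_heq _ _ _ _
  locally_trivial y₀ := by
    obtain ⟨U, n, φ, hU, hxU, hφ⟩ := hE.locally_trivial (f.toFun y₀)
    let χ : ∀ y : (f.toFun ⁻¹' U), (E.pullback f).Fib y ≃ₗ[ℂ] (Fin n → ℂ) := fun y =>
      φ ⟨f.toFun y, y.2⟩
    refine ⟨f.toFun ⁻¹' U, n, χ, hU.preimage f.continuous, hxU,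
      isHomeomorph_of_isInducing (E.pullback f) χ ?_⟩
    let j : {t : (E.pullback f).Tot // t.proj ∈ f.toFun ⁻¹' U} → Y × {t : E.Tot // t.proj ∈ U} :=
      fun t => (t.1.proj, ⟨⟨f.toFun t.1.proj, t.1.snd⟩, t.2⟩)
    have hj₁ : Continuous fun t => (j t).1 :=
      (continuous_pullback_proj f E).comp continuous_subtype_val
    have hj₂ : Continuous fun t => (j t).2 :=
      ((continuous_pullback_lift f E).comp continuous_subtype_val).subtype_mk _
    have hj : IsInducing j := by
      refine IsInducing.of_comp (hj₁.prodMk hj₂)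
        (continuous_id.prodMap continuous_subtype_val) ?_
      have h1 : IsInducing (fun t : (E.pullback f).Tot =>
        (t.proj, (⟨f.toFun t.proj, t.snd⟩ : E.Tot))) := ⟨rfl⟩
      exact h1.comp IsInducing.subtypeVal
    have hk := (IsInducing.id.prodMap hφ.isEmbedding.isInducing).comp hj
    let g : (f.toFun ⁻¹' U) × (Fin n → ℂ) → Y × (U × (Fin n → ℂ)) :=
      fun p => (p.1, (⟨f.toFun p.1, p.1.2⟩, p.2))
    have hg : Continuous g := by
      have h1 : Continuous fun p : (f.toFun ⁻¹' U) × (Fin n → ℂ) => (p.1 : Y) :=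
        continuous_subtype_val.comp continuous_fst
      exact h1.prodMk (((f.continuous.comp h1).subtype_mk _).prodMk continuous_snd)
    refine IsInducing.of_comp ?_ hg hk
    exact (hj₁.subtype_mk _).prodMk (hφ.continuous.comp hj₂).snd


/-- Direct sums of isomorphisms, and the isomorphisms that make isomorphism classes of bundles a
commutative monoid and pullback a homomorphism of monoids. -/
def Iso.sum {E E' F F' : EqFamily X} (i : Iso E E') (j : Iso F F') : Iso (E.sum F) (E'.sum F') where
  toEquiv x := (i.toEquiv x).prodCongr (j.toEquiv x)
  comm h _ _ e v := Prod.ext (i.comm h e v.1) (j.comm h e v.2)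
  continuous_toFun := continuous_sum_mk (i.continuous_toFun.comp (continuous_sum_fst E F))
    (j.continuous_toFun.comp (continuous_sum_snd E F))
  continuous_invFun := continuous_sum_mk (i.continuous_invFun.comp (continuous_sum_fst E' F'))
    (j.continuous_invFun.comp (continuous_sum_snd E' F'))

def sumComm (E F : EqFamily X) : Iso (E.sum F) (F.sum E) where
  toEquiv x := LinearEquiv.prodComm ℂ (E.Fib x) (F.Fib x)
  comm _ _ _ _ _ := rfl
  continuous_toFun := continuous_sum_mk (continuous_sum_snd E F) (continuous_sum_fst E F)
  continuous_invFun := continuous_sum_mk (continuous_sum_snd F E) (continuous_sum_fst F E)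

def sumAssoc (E F D : EqFamily X) : Iso ((E.sum F).sum D) (E.sum (F.sum D)) where
  toEquiv x := LinearEquiv.prodAssoc ℂ (E.Fib x) (F.Fib x) (D.Fib x)
  comm _ _ _ _ _ := rfl
  continuous_toFun := continuous_sum_mk
    ((continuous_sum_fst E F).comp (continuous_sum_fst (E.sum F) D))
    (continuous_sum_mk ((continuous_sum_snd E F).comp (continuous_sum_fst (E.sum F) D))
      (continuous_sum_snd (E.sum F) D))
  continuous_invFun := continuous_sum_mk
    (continuous_sum_mk (continuous_sum_fst E (F.sum D))
      ((continuous_sum_fst F D).comp (continuous_sum_snd E (F.sum D))))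
    ((continuous_sum_snd F D).comp (continuous_sum_snd E (F.sum D)))

def sumZero (E : EqFamily X) (hE : E.IsBundle) : Iso E (E.sum (zero X)) where
  toEquiv _ :=
    { toFun := fun v => (v, PUnit.unit)
      invFun := fun v => v.1
      map_add' := fun _ _ => rfl
      map_smul' := fun _ _ => rfl
      left_inv := fun _ => rfl
      right_inv := fun _ => rfl }
  comm _ _ _ _ _ := rfl
  continuous_toFun := continuous_sum_mk continuous_id (continuous_induced_rng.2 hE.continuous_proj)
  continuous_invFun := continuous_sum_fst E (zero X)

def Iso.pullback (f : GMap Y X) {E F : EqFamily X} (i : Iso E F) :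
    Iso (E.pullback f) (F.pullback f) where
  toEquiv y := i.toEquiv (f.toFun y)
  comm h _ _ _ v := i.comm h _ v
  continuous_toFun := continuous_pullback_mk (continuous_pullback_proj f E)
    (i.continuous_toFun.comp (continuous_pullback_lift f E))
  continuous_invFun := continuous_pullback_mk (continuous_pullback_proj f F)
    (i.continuous_invFun.comp (continuous_pullback_lift f F))

def pullbackSum (f : GMap Y X) (E F : EqFamily X) :
    Iso ((E.sum F).pullback f) ((E.pullback f).sum (F.pullback f)) where
  toEquiv y := LinearEquiv.refl ℂ (E.Fib (f.toFun y) × F.Fib (f.toFun y))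
  comm _ _ _ _ _ := rfl
  continuous_toFun := continuous_sum_mk
    (continuous_pullback_mk (continuous_pullback_proj f (E.sum F))
      ((continuous_sum_fst E F).comp (continuous_pullback_lift f (E.sum F))))
    (continuous_pullback_mk (continuous_pullback_proj f (E.sum F))
      ((continuous_sum_snd E F).comp (continuous_pullback_lift f (E.sum F))))
  continuous_invFun := continuous_pullback_mk
    ((continuous_pullback_proj f E).comp (continuous_sum_fst (E.pullback f) (F.pullback f)))
    (continuous_sum_mk
      ((continuous_pullback_lift f E).comp (continuous_sum_fst (E.pullback f) (F.pullback f)))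
      ((continuous_pullback_lift f F).comp (continuous_sum_snd (E.pullback f) (F.pullback f))))

def pullbackZero (f : GMap Y X) : Iso ((zero X).pullback f) (zero Y) where
  toEquiv _ := LinearEquiv.refl ℂ PUnit.{u + 1}
  comm _ _ _ _ _ := rfl
  continuous_toFun := continuous_induced_rng.2 (continuous_pullback_proj f (zero X))
  continuous_invFun := continuous_pullback_mk continuous_induced_dom
    (continuous_induced_rng.2 (f.continuous.comp continuous_induced_dom))

def pullbackComp (f : GMap Y X) (g : GMap Z Y) (E : EqFamily X) :
    Iso ((E.pullback f).pullback g) (E.pullback (f.comp g)) where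
  toEquiv z := LinearEquiv.refl ℂ (E.Fib (f.toFun (g.toFun z)))
  comm _ _ _ _ _ := rfl
  continuous_toFun := continuous_pullback_mk (continuous_pullback_proj g (E.pullback f))
    ((continuous_pullback_lift f E).comp (continuous_pullback_lift g (E.pullback f)))
  continuous_invFun := continuous_pullback_mk (continuous_pullback_proj (f.comp g) E)
    (continuous_pullback_mk (g.continuous.comp (continuous_pullback_proj (f.comp g) E))
      (continuous_pullback_lift (f.comp g) E))

end EqFamily

/-- An `H`-equivariant complex vector bundle over `X`. -/
structure EqBundle (X : GSpace.{u, v} H) where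
  fam : EqFamily X
  isBundle : fam.IsBundle

instance EqBundle.setoid (X : GSpace.{u, v} H) : Setoid (EqBundle X) where
  r E F := Nonempty (E.fam.Iso F.fam)
  iseqv := ⟨fun E => ⟨EqFamily.Iso.refl E.fam⟩, fun ⟨i⟩ => ⟨i.symm⟩, fun ⟨i⟩ ⟨j⟩ => ⟨i.trans j⟩⟩

/-- The set of isomorphism classes of `H`-equivariant complex vector bundles over `X`. -/
def Vec (X : GSpace.{u, v} H) : Type _ := Quotient (EqBundle.setoid X)

variable {X Y : GSpace.{u, v} H}

/-- The isomorphism class of a bundle. -/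
def Vec.mk (E : EqBundle X) : Vec X := Quotient.mk _ E

instance : Add (Vec X) where
  add := Quotient.map₂ (fun E F => ⟨E.fam.sum F.fam, E.isBundle.sum F.isBundle⟩)
    (by rintro E E' ⟨i⟩ F F' ⟨j⟩; exact ⟨i.sum j⟩)

instance : Zero (Vec X) where
  zero := Vec.mk ⟨EqFamily.zero X, EqFamily.isBundle_zero X⟩

/-- Isomorphism classes of bundles form a commutative monoid under direct sum. -/
instance : AddCommMonoid (Vec X) where
  add_assoc := by
    rintro ⟨E⟩ ⟨F⟩ ⟨D⟩
    exact Quotient.sound ⟨EqFamily.sumAssoc E.fam F.fam D.fam⟩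
  add_comm := by
    rintro ⟨E⟩ ⟨F⟩
    exact Quotient.sound ⟨EqFamily.sumComm E.fam F.fam⟩
  add_zero := by
    rintro ⟨E⟩
    exact Quotient.sound ⟨(EqFamily.sumZero E.fam E.isBundle).symm⟩
  zero_add := by
    rintro ⟨E⟩
    exact Quotient.sound
      ⟨(EqFamily.sumComm _ _).trans (EqFamily.sumZero E.fam E.isBundle).symm⟩
  nsmul := nsmulRec

def EqBundle.pullback (f : GMap Y X) (E : EqBundle X) : EqBundle Y :=
  ⟨E.fam.pullback f, E.isBundle.pullback f⟩

/-- Pullback of isomorphism classes. -/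
def Vec.map (f : GMap Y X) : Vec X →+ Vec Y where
  toFun := Quotient.map (EqBundle.pullback f) (by rintro E F ⟨i⟩; exact ⟨i.pullback f⟩)
  map_zero' := Quotient.sound ⟨EqFamily.pullbackZero f⟩
  map_add' := by
    rintro ⟨E⟩ ⟨F⟩
    exact Quotient.sound ⟨EqFamily.pullbackSum f E.fam F.fam⟩

theorem Vec.map_map {Z : GSpace.{u, v} H} (f : GMap Y X) (g : GMap Z Y) (c : Vec X) :
    Vec.map g (Vec.map f c) = Vec.map (f.comp g) c := by
  rcases c with ⟨E⟩
  exact Quotient.sound ⟨EqFamily.pullbackComp f g E.fam⟩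

end Bundles

/-! ## Equivariant K-theory -/

section KTheory

variable {H : Type v} [Group H] [TopologicalSpace H]

/-- `K_H^0(X)`, the Grothendieck group of the monoid of isomorphism classes. -/
abbrev K0 (X : GSpace.{u, v} H) : Type _ := Algebra.GrothendieckAddGroup (Vec X)

/-- The class `[E]` in `K_H^0(X)`. -/
def K0.mk {X : GSpace.{u, v} H} (E : EqBundle X) : K0 X :=
  Algebra.GrothendieckAddGroup.of (Vec.mk E)

/-- `f^* : K_H^0(X) → K_H^0(Y)` for `f : Y → X`. -/
def K0.map {X Y : GSpace.{u, v} H} (f : GMap Y X) : K0 X →+ K0 Y :=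
  Algebra.GrothendieckAddGroup.lift (Algebra.GrothendieckAddGroup.of.comp (Vec.map f))

theorem K0.map_of {X Y : GSpace.{u, v} H} (f : GMap Y X) (c : Vec X) :
    K0.map f (Algebra.GrothendieckAddGroup.of c) = Algebra.GrothendieckAddGroup.of (Vec.map f c) :=
  DFunLike.congr_fun (Algebra.GrothendieckAddGroup.lift.symm_apply_apply
    (Algebra.GrothendieckAddGroup.of.comp (Vec.map f))) c

theorem K0.map_map {X Y Z : GSpace.{u, v} H} (f : GMap Y X) (g : GMap Z Y) (k : K0 X) :
    K0.map g (K0.map f k) = K0.map (f.comp g) k := by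
  have : (K0.map g).comp (K0.map f) = K0.map (f.comp g) := by
    apply Algebra.GrothendieckAddGroup.lift.symm.injective
    ext c
    change K0.map g (K0.map f (Algebra.GrothendieckAddGroup.of c)) =
      K0.map (f.comp g) (Algebra.GrothendieckAddGroup.of c)
    rw [K0.map_of, K0.map_of, K0.map_of, Vec.map_map]
  exact DFunLike.congr_fun this k

/-- `K_H^n(X)`: the reduced group of `Σⁿ(X₊)`, i.e. the kernel of the restriction to the base
point. -/
def Kn [DiscreteTopology H] (n : ℕ) (X : GSpace.{u, v} H) : AddSubgroup (K0 (X.susp n)) :=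
  (K0.map (X.base n)).ker

/-- `f^* : K_H^n(X) → K_H^n(Y)` for `f : Y → X`. -/
def Kn.map [DiscreteTopology H] (n : ℕ) {X Y : GSpace.{u, v} H} (f : GMap Y X) :
    Kn n X →+ Kn n Y :=
  ((K0.map (f.susp n)).comp (Kn n X).subtype).codRestrict (Kn n Y) fun k => by
    change K0.map (Y.base n) (K0.map (f.susp n) k) = 0
    rw [K0.map_map]
    exact k.2

end KTheory

/-! ## Twisted equivariant K-theory -/

/-- Normalised 2-cocycles of `Q` with values in the circle (with trivial action). -/
structure Cocycle (Q : Type v) [Group Q] where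
  toFun : Q → Q → Circle
  cocycle : ∀ a b c, toFun a (b * c) * toFun b c = toFun (a * b) c * toFun a b
  one_left : ∀ q, toFun 1 q = 1
  one_right : ∀ q, toFun q 1 = 1

section Twisted

variable {Q : Type v} [Group Q]

/-- The central extension of `Q` by the circle defined by `α`: the set `Q × S¹` with the product
`(q₁, z₁) (q₂, z₂) = (q₁ q₂, α(q₁, q₂) z₁ z₂)`. -/
def Ext (_α : Cocycle Q) : Type v := Q × Circle

namespace Ext

variable (α : Cocycle Q)

instance [TopologicalSpace Q] : TopologicalSpace (Ext α) :=
  inferInstanceAs (TopologicalSpace (Q × Circle))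

instance : Group (Ext α) where
  mul a b := (a.1 * b.1, α.toFun a.1 b.1 * a.2 * b.2)
  one := (1, 1)
  inv a := (a.1⁻¹, (α.toFun a.1⁻¹ a.1 * a.2)⁻¹)
  mul_assoc a b c := by
    refine Prod.ext (mul_assoc a.1 b.1 c.1) ?_
    change α.toFun (a.1 * b.1) c.1 * (α.toFun a.1 b.1 * a.2 * b.2) * c.2 =
      α.toFun a.1 (b.1 * c.1) * a.2 * (α.toFun b.1 c.1 * b.2 * c.2)
    calc _ = (α.toFun (a.1 * b.1) c.1 * α.toFun a.1 b.1) * (a.2 * b.2 * c.2) := by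
          simp only [mul_assoc]
      _ = (α.toFun a.1 (b.1 * c.1) * α.toFun b.1 c.1) * (a.2 * b.2 * c.2) := by rw [α.cocycle]
      _ = _ := by simp only [mul_assoc, mul_left_comm]
  one_mul a := by
    refine Prod.ext (one_mul a.1) ?_
    change α.toFun 1 a.1 * 1 * a.2 = a.2
    rw [α.one_left, one_mul, one_mul]
  mul_one a := by
    refine Prod.ext (mul_one a.1) ?_
    change α.toFun a.1 1 * a.2 * 1 = a.2
    rw [α.one_right, one_mul, mul_one]
  inv_mul_cancel a := by
    refine Prod.ext (inv_mul_cancel a.1) ?_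
    change α.toFun a.1⁻¹ a.1 * (α.toFun a.1⁻¹ a.1 * a.2)⁻¹ * a.2 = 1
    rw [mul_inv, mul_inv_cancel_left, inv_mul_cancel]

/-- The projection to `Q`. -/
def proj : Ext α →* Q where
  toFun a := a.1
  map_one' := rfl
  map_mul' _ _ := rfl

/-- The element `z` of the central circle. -/
def central (z : Circle) : Ext α := (1, z)

theorem continuous_proj [TopologicalSpace Q] : Continuous (proj α) := continuous_fst

end Ext

variable [TopologicalSpace Q] (α : Cocycle Q)

/-- A `Q`-space as a space with an action of the central extension. -/
abbrev GSpace.ext (X : GSpace.{u, v} Q) : GSpace.{u, v} (Ext α) :=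
  X.comap (Ext.proj α) (Ext.continuous_proj α)

variable {α}

/-- The central circle acts on the fibres by multiplication by scalars. -/
def EqFamily.IsScalar {X : GSpace.{u, v} Q} (E : EqFamily (X.ext α)) : Prop :=
  ∀ (z : Circle) (x : X.ext α) (e : Ext.central α z • x = x) (v : E.Fib x),
    E.act (Ext.central α z) e v = (z : ℂ) • v

variable (α)

/-- The monoid of isomorphism classes of vector bundles over `X`, equivariant for the central
extension of `Q`, on which the central circle acts by multiplication by scalars. -/
def TwVec (X : GSpace.{u, v} Q) : AddSubmonoid (Vec (X.ext α)) where
  carrier := {c | ∃ E : EqBundle (X.ext α), E.fam.IsScalar ∧ Vec.mk E = c}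
  zero_mem' := ⟨⟨EqFamily.zero _, EqFamily.isBundle_zero _⟩, fun _ _ _ _ => rfl, rfl⟩
  add_mem' := by
    rintro _ _ ⟨E, hE, rfl⟩ ⟨F, hF, rfl⟩
    exact ⟨⟨E.fam.sum F.fam, E.isBundle.sum F.isBundle⟩,
      fun z x e v => Prod.ext (hE z x e v.1) (hF z x e v.2), rfl⟩

/-- Pullback of twisted bundles. -/
def TwVec.map {X Y : GSpace.{u, v} Q} (f : GMap Y X) : TwVec α X →+ TwVec α Y :=
  ((Vec.map (f.comap (Ext.proj α) (Ext.continuous_proj α))).comp (TwVec α X).subtype).codRestrict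
    (TwVec α Y) (by
      rintro ⟨_, E, hE, rfl⟩
      exact ⟨E.pullback (f.comap (Ext.proj α) (Ext.continuous_proj α)),
        fun z y _ v => hE z (f.toFun y) _ v, rfl⟩)

/-- The `α`-twisted `Q`-equivariant group `^αK_Q^0(X)`. -/
abbrev TwK0 (X : GSpace.{u, v} Q) : Type _ := Algebra.GrothendieckAddGroup (TwVec α X)

/-- The class in `^αK_Q^0(X)` of an `α`-twisted bundle. -/
def TwK0.mk {X : GSpace.{u, v} Q} (E : EqBundle (X.ext α)) (hE : E.fam.IsScalar) : TwK0 α X :=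
  Algebra.GrothendieckAddGroup.of (⟨Vec.mk E, E, hE, rfl⟩ : TwVec α X)

def TwK0.map {X Y : GSpace.{u, v} Q} (f : GMap Y X) : TwK0 α X →+ TwK0 α Y :=
  Algebra.GrothendieckAddGroup.lift (Algebra.GrothendieckAddGroup.of.comp (TwVec.map α f))

theorem TwK0.map_of {X Y : GSpace.{u, v} Q} (f : GMap Y X) (c : TwVec α X) :
    TwK0.map α f (Algebra.GrothendieckAddGroup.of c) =
      Algebra.GrothendieckAddGroup.of (TwVec.map α f c) :=
  DFunLike.congr_fun (Algebra.GrothendieckAddGroup.lift.symm_apply_apply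
    (Algebra.GrothendieckAddGroup.of.comp (TwVec.map α f))) c

theorem TwK0.map_map {X Y Z : GSpace.{u, v} Q} (f : GMap Y X) (g : GMap Z Y) (k : TwK0 α X) :
    TwK0.map α g (TwK0.map α f k) = TwK0.map α (f.comp g) k := by
  have : (TwK0.map α g).comp (TwK0.map α f) = TwK0.map α (f.comp g) := by
    apply Algebra.GrothendieckAddGroup.lift.symm.injective
    ext c
    have : TwVec.map α g (TwVec.map α f c) = TwVec.map α (f.comp g) c :=
      Subtype.ext (Vec.map_map (f.comap (Ext.proj α) (Ext.continuous_proj α))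
        (g.comap (Ext.proj α) (Ext.continuous_proj α)) c.1)
    change TwK0.map α g (TwK0.map α f (Algebra.GrothendieckAddGroup.of c)) =
      TwK0.map α (f.comp g) (Algebra.GrothendieckAddGroup.of c)
    rw [TwK0.map_of, TwK0.map_of, TwK0.map_of, this]
  exact DFunLike.congr_fun this k

/-- `^αK_Q^n(X)`: the reduced group of `Σⁿ(X₊)`, i.e. the kernel of the restriction to the base
point. -/
def TwKn [DiscreteTopology Q] (n : ℕ) (X : GSpace.{u, v} Q) : AddSubgroup (TwK0 α (X.susp n)) :=
  (TwK0.map α (X.base n)).ker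

/-- `f^* : ^αK_Q^n(X) → ^αK_Q^n(Y)` for `f : Y → X`. -/
def TwKn.map [DiscreteTopology Q] (n : ℕ) {X Y : GSpace.{u, v} Q} (f : GMap Y X) :
    TwKn α n X →+ TwKn α n Y :=
  ((TwK0.map α (f.susp n)).comp (TwKn α n X).subtype).codRestrict (TwKn α n Y) fun k => by
    change TwK0.map α (Y.base n) (TwK0.map α (f.susp n) k) = 0
    rw [TwK0.map_map]
    exact k.2

end Twisted

/-! ## Irreducible representations -/

section Representations

variable {A : Type v} [Group A]

/-- The linear representation on `ℂᵈ` given by a homomorphism `A → U(d)`. -/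
def unitaryRep {d : ℕ} (ρ : A →* Matrix.unitaryGroup (Fin d) ℂ) :
    Representation ℂ A (Fin d → ℂ) :=
  (Matrix.toLinAlgEquiv' : _ ≃ₐ[ℂ] ((Fin d → ℂ) →ₗ[ℂ] (Fin d → ℂ))).toMonoidHom.comp
    ((Matrix.unitaryGroup (Fin d) ℂ).subtype.comp ρ)

theorem unitaryRep_apply {d : ℕ} (ρ : A →* Matrix.unitaryGroup (Fin d) ℂ) (a : A)
    (v : Fin d → ℂ) : unitaryRep ρ a v = Matrix.mulVec (ρ a).1 v := rfl

/-- An irreducible unitary representation `τ : A → U(V_τ)`, on `V_τ = ℂᵈ`. -/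
structure IrrRep (A : Type v) [Group A] where
  d : ℕ
  ρ : A →* Matrix.unitaryGroup (Fin d) ℂ
  irr : (unitaryRep ρ).IsIrreducible

instance IrrRep.setoid (A : Type v) [Group A] : Setoid (IrrRep A) where
  r τ τ' := Nonempty ((unitaryRep τ.ρ).Equiv (unitaryRep τ'.ρ))
  iseqv := ⟨fun _ => ⟨.refl _⟩, fun ⟨i⟩ => ⟨i.symm⟩, fun ⟨i⟩ ⟨j⟩ => ⟨i.trans j⟩⟩

/-- `Irr(A)`, the set of isomorphism classes of complex irreducible representations of `A`. -/
def Irr (A : Type v) [Group A] : Type v := Quotient (IrrRep.setoid A)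

def Irr.mk (τ : IrrRep A) : Irr A := Quotient.mk _ τ

theorem IrrRep.d_pos (τ : IrrRep A) : 0 < τ.d := by
  rcases Nat.eq_zero_or_pos τ.d with h | h
  · exfalso
    have : IsEmpty (Fin τ.d) := by rw [h]; infer_instance
    obtain ⟨x, y, hxy⟩ := τ.irr.toNontrivial
    refine hxy (Subrepresentation.toSubmodule_injective ?_)
    exact Subsingleton.elim _ _
  · exact h

/-- Schur's lemma. -/
theorem IrrRep.schur (τ : IrrRep A) (N : Matrix (Fin τ.d) (Fin τ.d) ℂ)
    (h : ∀ a, N * (τ.ρ a).1 = (τ.ρ a).1 * N) : ∃ c : ℂ, N = c • 1 := by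
  have := τ.irr
  let f : (unitaryRep τ.ρ).IntertwiningMap (unitaryRep τ.ρ) :=
    ⟨Matrix.toLin' N, fun a => by
      have := congrArg Matrix.toLin' (h a)
      rwa [Matrix.toLin'_mul, Matrix.toLin'_mul] at this⟩
  obtain ⟨c, hc⟩ := (Representation.IsIrreducible.algebraMap_intertwiningMap_bijective_of_isAlgClosed
    (ρ := unitaryRep τ.ρ)).2 f
  refine ⟨c, Matrix.toLin'.injective (LinearMap.ext fun v => ?_)⟩
  have : (algebraMap ℂ ((unitaryRep τ.ρ).IntertwiningMap (unitaryRep τ.ρ)) c) v = f v := by rw [hc]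
  have h2 : Matrix.toLin' N v = c • v := this.symm
  rw [h2]
  simp

theorem IrrRep.schur_unitary (τ : IrrRep A) (N : Matrix.unitaryGroup (Fin τ.d) ℂ)
    (h : ∀ a, N * τ.ρ a = τ.ρ a * N) :
    ∃ z : Circle, N.1 = (z : ℂ) • (1 : Matrix (Fin τ.d) (Fin τ.d) ℂ) := by
  obtain ⟨c, hc⟩ := τ.schur N.1 fun a => congrArg Subtype.val (h a)
  have h1 : N.1 * star N.1 = 1 := Matrix.mem_unitaryGroup_iff.1 N.2
  have h2 : c * star c = 1 := by
    have := congrFun (congrFun h1 ⟨0, τ.d_pos⟩) ⟨0, τ.d_pos⟩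
    rw [hc] at this
    simpa [Matrix.star_eq_conjTranspose, Matrix.mul_apply, Matrix.one_apply, mul_comm] using this
  refine ⟨⟨c, ?_⟩, hc⟩
  change c ∈ Metric.sphere (0 : ℂ) 1
  rw [mem_sphere_zero_iff_norm]
  have h3 : ‖c‖ * ‖c‖ = 1 := by simpa using congrArg norm h2
  nlinarith [norm_nonneg c]

theorem IrrRep.scalar_inj (τ : IrrRep A) {w z : ℂ} {U : Matrix.unitaryGroup (Fin τ.d) ℂ} (h : w • U.1 = z • U.1) :
    w = z := by
  have h1 : (w • U.1) * star U.1 = (z • U.1) * star U.1 := by rw [h]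
  have hU : U.1 * star U.1 = 1 := Matrix.mem_unitaryGroup_iff.1 U.2
  rw [smul_mul_assoc, smul_mul_assoc, hU] at h1
  have := congrFun (congrFun h1 ⟨0, τ.d_pos⟩) ⟨0, τ.d_pos⟩
  simpa using this

/-- Isomorphic irreducible unitary representations are unitarily equivalent. -/
theorem exists_unitary {d : ℕ} (ρ' ρ : A →* Matrix.unitaryGroup (Fin d) ℂ)
    (h : (unitaryRep ρ').IsIrreducible) (e : (unitaryRep ρ').Equiv (unitaryRep ρ)) :
    ∃ M : Matrix.unitaryGroup (Fin d) ℂ, ∀ a : A, ρ' a = M⁻¹ * ρ a * M := by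
  let τ : IrrRep A := ⟨d, ρ', h⟩
  let T : Matrix (Fin d) (Fin d) ℂ := LinearMap.toMatrix' e.toLinearEquiv.toLinearMap
  have hT : ∀ a, T * (ρ' a).1 = (ρ a).1 * T := fun a => by
    apply Matrix.toLin'.injective
    rw [Matrix.toLin'_mul, Matrix.toLin'_mul, Matrix.toLin'_toMatrix']
    exact e.isIntertwining' a
  have hT' : ∀ a, star T * (ρ a).1 = (ρ' a).1 * star T := fun a => by
    have h1 := congrArg star (hT a⁻¹)
    rw [star_mul, star_mul, map_inv, map_inv] at h1
    have h2 : ∀ U : Matrix.unitaryGroup (Fin d) ℂ, star (U⁻¹).1 = U.1 := fun U => star_star U.1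
    rw [h2] at h1
    rw [h2] at h1
    exact h1.symm
  obtain ⟨c, hc⟩ := τ.schur (star T * T) fun a => by
    rw [mul_assoc, hT, ← mul_assoc, hT', mul_assoc]
  let i₀ : Fin d := ⟨0, τ.d_pos⟩
  have hc0 : c = ((∑ i, ‖T i i₀‖ ^ 2 : ℝ) : ℂ) := by
    have h1 : (star T * T) i₀ i₀ = (c • (1 : Matrix (Fin d) (Fin d) ℂ)) i₀ i₀ :=
      congrFun (congrFun hc i₀) i₀
    simp only [Matrix.mul_apply, Matrix.star_eq_conjTranspose, Matrix.conjTranspose_apply,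
      Matrix.smul_apply, Matrix.one_apply_eq, smul_eq_mul, mul_one] at h1
    rw [← h1]
    push_cast
    exact Finset.sum_congr rfl fun i _ => by
      rw [← Complex.conj_mul']; rfl
  set r : ℝ := ∑ i, ‖T i i₀‖ ^ 2 with hr
  have hr0 : 0 ≤ r := Finset.sum_nonneg fun i _ => by positivity
  have hrne : r ≠ 0 := by
    intro h0
    have hz : ∀ i, T i i₀ = 0 := fun i => by
      have := (Finset.sum_eq_zero_iff_of_nonneg (fun i _ => by positivity)).1 h0 i
        (Finset.mem_univ i)
      simpa using this
    have h1 : e.toLinearEquiv (Pi.single i₀ 1) = 0 := by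
      have : Matrix.toLin' T (Pi.single i₀ 1) = 0 := by
        ext i; simp [hz]
      rwa [show Matrix.toLin' T = _ from Matrix.toLin'_toMatrix' _] at this
    have h2 := (LinearEquiv.map_eq_zero_iff _).1 h1
    exact one_ne_zero ((Pi.single_eq_same (M := fun _ => ℂ) i₀ 1).symm.trans (congrFun h2 i₀))
  let s : ℂ := ((Real.sqrt r)⁻¹ : ℝ)
  have hs : star s * s * c = 1 := by
    rw [hc0]
    have : ((Real.sqrt r)⁻¹ * (Real.sqrt r)⁻¹ * r : ℝ) = 1 := by
      rw [← mul_inv, Real.mul_self_sqrt hr0, inv_mul_cancel₀ hrne]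
    simp only [s, Complex.star_def, Complex.conj_ofReal]
    exact_mod_cast this
  let M : Matrix.unitaryGroup (Fin d) ℂ := ⟨s • T, by
    rw [Matrix.mem_unitaryGroup_iff', star_smul, smul_mul_smul_comm]
    rw [hc, smul_smul, hs, one_smul]⟩
  refine ⟨M, fun a => ?_⟩
  rw [mul_assoc, eq_inv_mul_iff_mul_eq]
  apply Subtype.ext
  change (s • T) * (ρ' a).1 = (ρ a).1 * (s • T)
  rw [smul_mul_assoc, mul_smul_comm]
  exact congrArg (s • ·) (hT a)

end Representations

section Conjugation

variable {G : Type v} [Group G] {A : Subgroup G} [A.Normal]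

/-- The conjugate representation `(g · τ)(a) = τ(g⁻¹ a g)`. -/
def IrrRep.conj (g : G) (τ : IrrRep A) : IrrRep A where
  d := τ.d
  ρ := τ.ρ.comp (MulAut.conjNormal g⁻¹ : MulAut A).toMonoidHom
  irr := by
    let i : Subrepresentation (unitaryRep τ.ρ) ≃o Subrepresentation
        (unitaryRep (τ.ρ.comp (MulAut.conjNormal g⁻¹ : MulAut A).toMonoidHom)) :=
      { toFun := fun S => ⟨S.toSubmodule, fun a _ hv => S.apply_mem_toSubmodule _ hv⟩
        invFun := fun S => ⟨S.toSubmodule, fun a v hv => by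
          have := S.apply_mem_toSubmodule (MulAut.conjNormal g a) hv
          have e : (MulAut.conjNormal g⁻¹ : MulAut A) (MulAut.conjNormal g a) = a := by
            ext; simp
          change unitaryRep τ.ρ ((MulAut.conjNormal g⁻¹ : MulAut A) (MulAut.conjNormal g a)) v ∈ _
            at this
          rwa [e] at this⟩
        left_inv := fun _ => rfl
        right_inv := fun _ => rfl
        map_rel_iff' := Iff.rfl }
    exact i.isSimpleOrder_iff.1 τ.irr

/-- `G` acts on `Irr(A)` by conjugation. -/
instance : MulAction G (Irr A) where
  smul g := Quotient.map (IrrRep.conj g) (by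
    rintro τ τ' ⟨i⟩
    exact ⟨.mk i.toLinearEquiv fun a => i.isIntertwining' (MulAut.conjNormal g⁻¹ a)⟩)
  one_smul := by
    rintro ⟨τ⟩
    refine Quotient.sound ⟨.mk (LinearEquiv.refl ℂ (Fin τ.d → ℂ)) fun a => ?_⟩
    have : (MulAut.conjNormal (1 : G)⁻¹ : MulAut A) a = a := by simp
    change unitaryRep τ.ρ ((MulAut.conjNormal (1 : G)⁻¹ : MulAut A) a) = unitaryRep τ.ρ a
    rw [this]
  mul_smul g h := by
    rintro ⟨τ⟩
    refine Quotient.sound ⟨.mk (LinearEquiv.refl ℂ (Fin τ.d → ℂ)) fun a => ?_⟩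
    have : (MulAut.conjNormal (g * h)⁻¹ : MulAut A) a =
        (MulAut.conjNormal h⁻¹ : MulAut A) ((MulAut.conjNormal g⁻¹ : MulAut A) a) := by
      simp
    change unitaryRep τ.ρ ((MulAut.conjNormal (g * h)⁻¹ : MulAut A) a) = unitaryRep τ.ρ
      ((MulAut.conjNormal h⁻¹ : MulAut A) ((MulAut.conjNormal g⁻¹ : MulAut A) a))
    rw [this]

variable (A) in
/-- The set of orbits `G \ Irr(A)`. -/
abbrev IrrOrbits : Type v := MulAction.orbitRel.Quotient G (Irr A)

/-- `Q_[τ]`, the image in `Q = G/A` of the isotropy group `G_[τ]` of `[τ] ∈ Irr(A)`. -/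
def IrrRep.isotropy (τ : IrrRep A) : Subgroup (G ⧸ A) :=
  (MulAction.stabilizer G (Irr.mk τ)).map (QuotientGroup.mk' A)

/-- The choices made in the construction of the cocycle `α_τ`: a normalised section
`σ : Q_[τ] → G_[τ]` of the projection, and unitary matrices `M_q` with `M_1 = 1` such that
`τ(σ(q)⁻¹ a σ(q)) = M_q⁻¹ τ(a) M_q` for `a ∈ A`. -/
structure TwistChoice (τ : IrrRep A) where
  σ : τ.isotropy → G
  mk_σ : ∀ q, (σ q : G ⧸ A) = q
  σ_one : σ 1 = 1
  M : τ.isotropy → Matrix.unitaryGroup (Fin τ.d) ℂ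
  M_one : M 1 = 1
  M_spec : ∀ q (a : A), τ.ρ (MulAut.conjNormal (σ q)⁻¹ a) = (M q)⁻¹ * τ.ρ a * M q

namespace TwistChoice

/-- The choices can be made. -/
theorem exists_choice (τ : IrrRep A) : Nonempty (TwistChoice τ) := by
  classical
  have h : ∀ q : τ.isotropy, ∃ g : G, g • Irr.mk τ = Irr.mk τ ∧ (g : G ⧸ A) = q := by
    rintro ⟨_, g, hg, rfl⟩
    exact ⟨g, hg, rfl⟩
  choose σ₀ hσ₀ hσ₀' using h
  have hU : ∀ q : τ.isotropy, ∃ M : Matrix.unitaryGroup (Fin τ.d) ℂ, ∀ a : A,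
      τ.ρ (MulAut.conjNormal (σ₀ q)⁻¹ a) = M⁻¹ * τ.ρ a * M := fun q => by
    obtain ⟨e⟩ : Nonempty ((unitaryRep (τ.conj (σ₀ q)).ρ).Equiv (unitaryRep τ.ρ)) :=
      Quotient.exact (hσ₀ q)
    exact exists_unitary (τ.conj (σ₀ q)).ρ τ.ρ (τ.conj (σ₀ q)).irr e
  choose M₀ hM₀ using hU
  refine ⟨⟨fun q => if q = 1 then 1 else σ₀ q, fun q => ?_, if_pos rfl,
    fun q => if q = 1 then 1 else M₀ q, if_pos rfl, fun q a => ?_⟩⟩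
  · by_cases hq : q = 1
    · simp [hq]
    · simp only [if_neg hq, hσ₀']
  · by_cases hq : q = 1
    · simp [hq]
    · simp only [if_neg hq, hM₀]

variable {τ : IrrRep A} (c : TwistChoice τ)

/-- `χ(q₁, q₂) = σ(q₁q₂)⁻¹ σ(q₁) σ(q₂) ∈ A`. -/
def χ (q₁ q₂ : τ.isotropy) : A :=
  ⟨(c.σ (q₁ * q₂))⁻¹ * c.σ q₁ * c.σ q₂, by
    rw [← QuotientGroup.eq_one_iff]
    simp [c.mk_σ]⟩

/-- `τ(χ(q₁, q₂)) M_{q₂}⁻¹ M_{q₁}⁻¹ M_{q₁q₂}`, a scalar matrix. -/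
def N (q₁ q₂ : τ.isotropy) : Matrix.unitaryGroup (Fin τ.d) ℂ :=
  τ.ρ (c.χ q₁ q₂) * (c.M q₂)⁻¹ * (c.M q₁)⁻¹ * c.M (q₁ * q₂)

theorem M_mul (q : τ.isotropy) (a : A) :
    c.M q * τ.ρ (MulAut.conjNormal (c.σ q)⁻¹ a) = τ.ρ a * c.M q := by
  rw [c.M_spec]; group

theorem ρ_mul_M (q : τ.isotropy) (a : A) :
    τ.ρ a * c.M q = c.M q * τ.ρ (MulAut.conjNormal (c.σ q)⁻¹ a) := (c.M_mul q a).symm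

theorem N_comm (q₁ q₂ : τ.isotropy) (a : A) : c.N q₁ q₂ * τ.ρ a = τ.ρ a * c.N q₁ q₂ := by
  have key : ∀ (q : τ.isotropy) (b : A),
      (c.M q)⁻¹ * τ.ρ b = τ.ρ (MulAut.conjNormal (c.σ q)⁻¹ b) * (c.M q)⁻¹ := fun q b => by
    rw [c.M_spec]; group
  have h12 : c.M (q₁ * q₂) * τ.ρ a =
      τ.ρ (MulAut.conjNormal (c.σ (q₁ * q₂)) a) * c.M (q₁ * q₂) := by
    rw [c.ρ_mul_M]
    congr 2
    ext; simp
  unfold N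
  rw [mul_assoc, h12, ← mul_assoc, mul_assoc _ (c.M q₁)⁻¹, key, ← mul_assoc,
    mul_assoc _ (c.M q₂)⁻¹, key, ← mul_assoc, ← map_mul, ← mul_assoc, ← mul_assoc, ← mul_assoc,
    ← map_mul]
  congr 4
  ext
  simp [MulAut.conjNormal_apply, χ, mul_assoc]

/-- The value of the cocycle: the scalar by which `N` acts. -/
def α (q₁ q₂ : τ.isotropy) : Circle := (τ.schur_unitary (c.N q₁ q₂) (c.N_comm q₁ q₂)).choose

theorem N_eq (q₁ q₂ : τ.isotropy) :
    (c.N q₁ q₂).1 = (c.α q₁ q₂ : ℂ) • (1 : Matrix (Fin τ.d) (Fin τ.d) ℂ) :=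
  (τ.schur_unitary (c.N q₁ q₂) (c.N_comm q₁ q₂)).choose_spec

theorem α_mul (q₁ q₂ : τ.isotropy) :
    (c.α q₁ q₂ : ℂ) • ((c.M q₁).1 * (c.M q₂).1) = (c.M (q₁ * q₂)).1 * (τ.ρ (c.χ q₁ q₂)).1 := by
  have h : τ.ρ (c.χ q₁ q₂) * (c.M q₂)⁻¹ * (c.M q₁)⁻¹ * c.M (q₁ * q₂) = c.N q₁ q₂ := rfl
  have h2 : c.M (q₁ * q₂) * τ.ρ (c.χ q₁ q₂) =
      c.M (q₁ * q₂) * c.N q₁ q₂ * (c.M (q₁ * q₂))⁻¹ * (c.M q₁ * c.M q₂) := by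
    rw [← h]; group
  have h3 := congrArg Subtype.val h2
  have hM : (c.M (q₁ * q₂)).1 * ((c.M (q₁ * q₂))⁻¹).1 = 1 := by
    rw [← Submonoid.coe_mul, mul_inv_cancel]; rfl
  simp only [Submonoid.coe_mul, c.N_eq] at h3
  rw [h3, mul_smul_comm, mul_one, smul_mul_assoc, hM, smul_mul_assoc, one_mul]

theorem χ_mul (a b d : τ.isotropy) :
    c.χ (a * b) d * (MulAut.conjNormal (c.σ d)⁻¹ : MulAut A) (c.χ a b) =
      c.χ a (b * d) * c.χ b d := by
  ext
  simp [χ, mul_assoc]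

/-- The cocycle `α_τ ∈ Z²(Q_[τ], S¹)`, with
`α_τ(q₁, q₂) = τ(χ(q₁, q₂)) M_{q₂}⁻¹ M_{q₁}⁻¹ M_{q₁q₂}`. -/
def cocycle : Cocycle τ.isotropy where
  toFun := c.α
  cocycle a b d := by
    ext
    have h1 : ((c.α (a * b) d : ℂ) * (c.α a b : ℂ)) • ((c.M a).1 * (c.M b).1 * (c.M d).1) =
        (c.M (a * b * d)).1 * (τ.ρ (c.χ (a * b) d *
          (MulAut.conjNormal (c.σ d)⁻¹ : MulAut A) (c.χ a b))).1 := by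
      have hr := congrArg Subtype.val (c.ρ_mul_M d (c.χ a b))
      simp only [Submonoid.coe_mul] at hr
      rw [mul_smul, ← smul_mul_assoc, c.α_mul, mul_assoc, hr, ← mul_assoc, ← smul_mul_assoc,
        c.α_mul, map_mul, Submonoid.coe_mul, mul_assoc]
    have h2 : ((c.α a (b * d) : ℂ) * (c.α b d : ℂ)) • ((c.M a).1 * (c.M b).1 * (c.M d).1) =
        (c.M (a * b * d)).1 * (τ.ρ (c.χ a (b * d) * c.χ b d)).1 := by
      rw [mul_smul, mul_assoc (c.M a).1, ← mul_smul_comm, c.α_mul, ← mul_assoc, ← smul_mul_assoc,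
        c.α_mul, map_mul, Submonoid.coe_mul, mul_assoc, mul_assoc]
    rw [c.χ_mul, ← h2] at h1
    exact (τ.scalar_inj (U := c.M a * c.M b * c.M d) h1).symm
  one_left q := by
    ext
    refine τ.scalar_inj (U := c.M 1 * c.M q) ((c.α_mul 1 q).trans ?_)
    have : c.χ 1 q = 1 := by ext; simp [χ, c.σ_one]
    rw [this]
    simp [c.M_one]
  one_right q := by
    ext
    refine τ.scalar_inj (U := c.M q * c.M 1) ((c.α_mul q 1).trans ?_)
    have : c.χ q 1 = 1 := by ext; simp [χ, c.σ_one]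
    rw [this]
    simp [c.M_one]

end TwistChoice
end Conjugation

/-! ## The bundles `Hom_A(V_τ, E)` -/

section HomBundle

variable {G : Type v} [Group G] [TopologicalSpace G] {A : Subgroup G}

variable (A) in
/-- The subgroup `A` acts trivially on `X`. -/
def GSpace.TrivialOn (X : GSpace.{u, v} G) : Prop := ∀ (a : A) (x : X), (a : G) • x = x

theorem GSpace.out_smul {X : GSpace.{u, v} G} (hX : X.TrivialOn A) (g : G) (x : X) :
    (g : G ⧸ A).out • x = g • x := by
  obtain ⟨a, ha⟩ := QuotientGroup.mk_out_eq_mul A g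
  rw [ha, mul_smul, hX]

theorem GSpace.TrivialOn.susp [DiscreteTopology G] {X : GSpace.{u, v} G} (hX : X.TrivialOn A)
    (n : ℕ) : (X.susp n).TrivialOn A := by
  intro a t
  cases t using OnePoint.rec with
  | infty => rfl
  | coe p => exact congrArg (fun y => OnePoint.some (p.1, y)) (hX a p.2)

variable [A.Normal]

variable {τ : IrrRep A}

/-- The fibre `Hom_A(V_τ, E_x)`. -/
def homAFib {X : GSpace.{u, v} G} (hX : X.TrivialOn A) (τ : IrrRep A) (E : EqFamily X) (x : X) :
    Submodule ℂ ((Fin τ.d → ℂ) →ₗ[ℂ] E.Fib x) where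
  carrier := {f | ∀ (a : A) (v : Fin τ.d → ℂ),
    f (unitaryRep τ.ρ a v) = E.act (a : G) (hX a x) (f v)}
  zero_mem' a v := by simp
  add_mem' {f g} hf hg a v := by simp [hf a v, hg a v]
  smul_mem' z f hf a v := by simp [hf a v]

/-- The map `Hom_A(V_τ, E_x) → Hom_A(V_τ, E_y)`, `f ↦ (v ↦ z σ(q) f(M_q⁻¹ v))`, where
`y = σ(q) x`. -/
def homAAct (c : TwistChoice τ) {X : GSpace.{u, v} G} (hX : X.TrivialOn A) (E : EqFamily X)
    (q : τ.isotropy) (z : Circle) {x y : X} (h : c.σ q • x = y) :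
    homAFib hX τ E x →ₗ[ℂ] homAFib hX τ E y where
  toFun f := ⟨(z : ℂ) • (E.act (c.σ q) h ∘ₗ f.1 ∘ₗ Matrix.toLin' ((c.M q)⁻¹).1), fun a v => by
    have h1 : Matrix.toLin' ((c.M q)⁻¹).1 (unitaryRep τ.ρ a v) =
        unitaryRep τ.ρ (MulAut.conjNormal (c.σ q)⁻¹ a) (Matrix.toLin' ((c.M q)⁻¹).1 v) := by
      have h2 : (c.M q)⁻¹ * τ.ρ a = τ.ρ (MulAut.conjNormal (c.σ q)⁻¹ a) * (c.M q)⁻¹ := by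
        rw [c.M_spec]; group
      have h3 := congrArg Subtype.val h2
      simp only [Submonoid.coe_mul] at h3
      rw [unitaryRep_apply, unitaryRep_apply, Matrix.toLin'_apply, Matrix.toLin'_apply,
        Matrix.mulVec_mulVec, Matrix.mulVec_mulVec, h3]
    simp only [LinearMap.smul_apply, LinearMap.comp_apply, map_smul]
    rw [h1, f.2 (MulAut.conjNormal (c.σ q)⁻¹ a)]
    have e₁ : (c.σ q * ((MulAut.conjNormal (c.σ q)⁻¹ : MulAut A) a : G)) • x = y := by
      rw [mul_smul, hX, h]
    have e₂ : ((a : G) * c.σ q) • x = y := by rw [mul_smul, h, hX]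
    rw [← E.act_mul _ _ (hX _ x) h e₁, ← E.act_mul _ _ h (hX a y) e₂,
      E.act_congr (by simp [mul_assoc]) e₁ e₂]⟩
  map_add' f g := by ext v; simp
  map_smul' w f := by
    ext v
    simp [smul_comm w]

theorem homAAct_one (c : TwistChoice τ) {X : GSpace.{u, v} G} (hX : X.TrivialOn A)
    (E : EqFamily X) {x : X} (z : Circle) (h : c.σ 1 • x = x) (f : homAFib hX τ E x) :
    homAAct c hX E 1 z h f = (z : ℂ) • f := by
  ext v
  have h1 : ∀ w, E.act (c.σ 1) h w = w := fun w =>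
    (E.act_congr c.σ_one h (one_smul G x) w).trans (E.act_one _ w)
  simp [homAAct, h1, c.M_one]

theorem homAAct_mul (c : TwistChoice τ) {X : GSpace.{u, v} G} (hX : X.TrivialOn A)
    (E : EqFamily X) (q r : τ.isotropy) (w z : Circle) {x x' y : X} (h : c.σ r • x = x')
    (h' : c.σ q • x' = y) (h'' : c.σ (q * r) • x = y) (f : homAFib hX τ E x) :
    homAAct c hX E (q * r) (c.α q r * w * z) h'' f =
      homAAct c hX E q w h' (homAAct c hX E r z h f) := by
  apply Subtype.ext
  apply LinearMap.ext
  intro v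
  change ((c.α q r * w * z : Circle) : ℂ) • E.act (c.σ (q * r)) h''
      (f.1 (Matrix.toLin' ((c.M (q * r))⁻¹).1 v)) =
    (w : ℂ) • E.act (c.σ q) h' ((z : ℂ) • E.act (c.σ r) h
      (f.1 (Matrix.toLin' ((c.M r)⁻¹).1 (Matrix.toLin' ((c.M q)⁻¹).1 v))))
  have e₁ : (c.σ q * c.σ r) • x = y := by rw [mul_smul, h, h']
  have e₂ : (c.σ (q * r) * (c.χ q r : G)) • x = y := by rw [mul_smul, hX, h'']
  rw [map_smul, ← E.act_mul _ _ h h' e₁,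
    E.act_congr (by simp [TwistChoice.χ, mul_assoc]) e₁ e₂, E.act_mul _ _ (hX _ x) h'' e₂,
    ← f.2 (c.χ q r)]
  have h1 : τ.ρ (c.χ q r) * ((c.M r)⁻¹ * (c.M q)⁻¹) = c.N q r * (c.M (q * r))⁻¹ := by
    unfold TwistChoice.N; group
  have h2 := congrArg Subtype.val h1
  simp only [Submonoid.coe_mul, c.N_eq, smul_mul_assoc, one_mul] at h2
  have h3 : unitaryRep τ.ρ (c.χ q r) (Matrix.toLin' ((c.M r)⁻¹).1
      (Matrix.toLin' ((c.M q)⁻¹).1 v)) =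
      (c.α q r : ℂ) • Matrix.toLin' ((c.M (q * r))⁻¹).1 v := by
    have h4 := congrArg (fun U => Matrix.mulVec U v) h2
    simpa only [unitaryRep_apply, Matrix.toLin'_apply, Matrix.mulVec_mulVec, Matrix.smul_mulVec]
      using h4
  rw [h3, map_smul, map_smul, smul_smul, smul_smul, Circle.coe_mul, Circle.coe_mul]
  congr 1
  ring

instance [DiscreteTopology G] : DiscreteTopology (G ⧸ A) :=
  discreteTopology_iff_forall_isOpen.2 fun _ =>
    (QuotientGroup.isQuotientMap_mk A).isOpen_preimage.1 (isOpen_discrete _)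

variable [DiscreteTopology G]

/-- A `G`-space on which `A` acts trivially is a `G/A`-space: a coset acts as any of its elements
does. -/
def GSpace.quot (X : GSpace.{u, v} G) (hX : X.TrivialOn A) : GSpace.{u, v} (G ⧸ A) :=
  letI : MulAction (G ⧸ A) X :=
    { smul := fun q x => q.out • x
      one_smul := fun x => (GSpace.out_smul hX 1 x).trans (one_smul G x)
      mul_smul := fun q r x => by
        obtain ⟨g, rfl⟩ := QuotientGroup.mk_surjective q
        obtain ⟨h, rfl⟩ := QuotientGroup.mk_surjective r
        change ((g * h : G) : G ⧸ A).out • x = (g : G ⧸ A).out • (h : G ⧸ A).out • x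
        rw [GSpace.out_smul hX, GSpace.out_smul hX, GSpace.out_smul hX, mul_smul] }
  { carrier := X
    cont := ⟨continuous_prod_of_discrete_left.2 fun q => continuous_const_smul q.out⟩ }

theorem GSpace.quot_smul {X : GSpace.{u, v} G} (hX : X.TrivialOn A) (g : G) (x : X.quot hX) :
    (g : G ⧸ A) • x = (g • (show X from x) : X) := GSpace.out_smul hX g x

/-- A `G`-space on which `A` acts trivially, as a `Q_[τ]`-space. -/
def GSpace.res (X : GSpace.{u, v} G) (hX : X.TrivialOn A) (τ : IrrRep A) :
    GSpace.{u, v} τ.isotropy :=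
  (X.quot hX).comap τ.isotropy.subtype continuous_subtype_val

/-- A `G`-map as a `Q_[τ]`-map. -/
def GMap.res {X Y : GSpace.{u, v} G} (f : GMap X Y) (hX : X.TrivialOn A) (hY : Y.TrivialOn A)
    (τ : IrrRep A) : GMap (X.res hX τ) (Y.res hY τ) where
  toFun := f.toFun
  continuous := f.continuous
  map_smul q x := f.map_smul (q : G ⧸ A).out x

theorem TwistChoice.σ_smul (c : TwistChoice τ) {X : GSpace.{u, v} G} (hX : X.TrivialOn A)
    {p : Ext c.cocycle} {x y : (X.res hX τ).ext c.cocycle} (h : p • x = y) :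
    c.σ (Ext.proj c.cocycle p) • (show X from x) = (show X from y) := by
  have h1 := GSpace.quot_smul hX (c.σ (Ext.proj c.cocycle p)) x
  rw [c.mk_σ] at h1
  exact h1.symm.trans h

/-- The family `Hom_A(V_τ, E)` over `X`, with the action of the central extension of `Q_[τ]`
defined by `α_τ`, `((q, z) f)(v) = z σ(q) f(M_q⁻¹ v)`. A linear map `f : V_τ → E_x` is topologised
through the point `x` and the values `f(v) ∈ E`. -/
def homA (c : TwistChoice τ) {X : GSpace.{u, v} G} (hX : X.TrivialOn A) (E : EqFamily X) :
    EqFamily ((X.res hX τ).ext c.cocycle) where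
  Fib x := homAFib hX τ E x
  acg x := (homAFib hX τ E x).addCommGroup
  mod x := (homAFib hX τ E x).module
  top := TopologicalSpace.induced
    (fun t => ((t.proj : X), fun v : Fin τ.d → ℂ => (⟨t.proj, t.snd.1 v⟩ : E.Tot))) inferInstance
  act p _ _ h := homAAct c hX E p.1 p.2 (c.σ_smul hX h)
  act_one e f := (homAAct_one c hX E 1 (c.σ_smul hX e) f).trans
    ((congrArg (· • f) Circle.coe_one).trans (one_smul ℂ f))
  act_mul g h _ _ _ hxy hyz hxz f := homAAct_mul c hX E g.1 h.1 g.2 h.2 (c.σ_smul hX hxy)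
    (c.σ_smul hX hyz) (c.σ_smul hX hxz) f

theorem homA_isScalar (c : TwistChoice τ) {X : GSpace.{u, v} G} (hX : X.TrivialOn A)
    (E : EqFamily X) : (homA c hX E).IsScalar := fun z _ e f =>
  homAAct_one c hX E z (c.σ_smul hX e) f

end HomBundle
end EqK
end

/-!
The fibre of a `G`-bundle `E` is a representation of `A`, so it is the sum over `Irr(A)` of its
isotypic parts `V_π ⊗ Hom_A(V_π, E)`. The group `G` permutes these, and the part at `τ` determines
those at the other points of the orbit of `[τ]`. The matrices `M_q` extend `τ` to a projective
representation of `G_[τ]`, so that the twisted bundle `F` becomes the `G_[τ]`-bundle `F ⊗ V_τ`, and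
`(F_τ) ↦ ⨁_τ Ind(F_τ ⊗ V_τ)` is inverse to `E ↦ (Hom_A(V_τ, E))`. By Schur's lemma only the
component of `Ind(F_τ ⊗ V_τ)` at the base coset contributes to `Hom_A(V_τ, -)`, so the unit
`F_τ → Hom_A(V_τ, ⨁_τ Ind(F_τ ⊗ V_τ))` is an isomorphism. A morphism is an isomorphism as soon as it
becomes one under `Hom_A(V_τ, -)` for one `τ` in each orbit, and by the triangle identity the counit
`⨁_τ Ind(Hom_A(V_τ, E) ⊗ V_τ) → E` does.

Local triviality is the analytic input: `Hom_A(V_τ, E)` and `F ⊗ V_τ` are obtained from sums of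
copies of bundles, the former as the image of the averaging projection, and a projection which
varies continuously has a locally trivial image.

The isomorphism of monoids passes to Grothendieck groups, and its naturality, applied to the
inclusion of the base point of `Σⁿ(X₊)`, shows that it respects the reduced groups.
-/

noncomputable section

namespace EqK

/-! ### Representations of finite groups -/

section Representations

variable {A : Type v} [Group A]

open scoped MatrixOrder ComplexOrder Matrix in
theorem exists_isUnit_conj_mem_unitaryGroup [Finite A] {n : Type*} [Fintype n] [DecidableEq n]
    (R : A →* Matrix n n ℂ) :
    ∃ B : Matrix n n ℂ, IsUnit B.det ∧ ∀ a, B * R a * B⁻¹ ∈ Matrix.unitaryGroup n ℂ := by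
  classical
  have := Fintype.ofFinite A
  -- The averaged form `H` is invariant, and `H = Bᴴ * B` makes `B` an isometry to the standard one.
  let H : Matrix n n ℂ := ∑ a, (R a)ᴴ * R a
  have posDef : H.PosDef := by
    have one_add : H = 1 + ∑ a ∈ Finset.univ.erase (1 : A), (R a)ᴴ * R a := by
      simp only [H, ← Finset.add_sum_erase _ _ (Finset.mem_univ (1 : A)), map_one,
        Matrix.conjTranspose_one, one_mul]
    rw [one_add]
    exact Matrix.PosDef.one.add_posSemidef
      (Matrix.posSemidef_sum _ fun a _ => Matrix.posSemidef_conjTranspose_mul_self (R a))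
  have invariant (b : A) : (R b)ᴴ * H * R b = H := by
    simp only [H, Finset.mul_sum, Finset.sum_mul]
    rw [← Equiv.sum_comp (Equiv.mulRight b) (fun a => (R a)ᴴ * R a)]
    exact Finset.sum_congr rfl fun a _ => by simp [Matrix.mul_assoc]
  obtain ⟨B, hB : H = Bᴴ * B⟩ :=
    CStarAlgebra.nonneg_iff_eq_star_mul_self.1 posDef.posSemidef.nonneg
  have unit : IsUnit B.det := by
    have := (Matrix.isUnit_iff_isUnit_det _).1 (hB ▸ posDef.isUnit)
    exact isUnit_of_mul_isUnit_right (Matrix.det_mul _ B ▸ this)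
  refine ⟨B, unit, fun a => Matrix.mem_unitaryGroup_iff'.2 ?_⟩
  calc (B * R a * B⁻¹)ᴴ * (B * R a * B⁻¹)
      = B⁻¹ᴴ * ((R a)ᴴ * (Bᴴ * B) * R a) * B⁻¹ := by
        simp only [Matrix.conjTranspose_mul, mul_assoc]
    _ = (B * B⁻¹)ᴴ * (B * B⁻¹) := by
        rw [← hB, invariant, hB, Matrix.conjTranspose_mul]; simp only [mul_assoc]
    _ = 1 := by rw [Matrix.mul_nonsing_inv B unit, Matrix.conjTranspose_one, one_mul]

theorem exists_equiv_unitaryRep [Finite A] {W : Type*} [AddCommGroup W] [Module ℂ W]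
    [FiniteDimensional ℂ W] (ρ : Representation ℂ A W) :
    ∃ U : A →* Matrix.unitaryGroup (Fin (Module.finrank ℂ W)) ℂ,
      Nonempty (ρ.Equiv (unitaryRep U)) := by
  let b := Module.finBasis ℂ W
  let R := (LinearMap.toMatrixAlgEquiv b).toMonoidHom.comp ρ
  obtain ⟨B, unit, hB⟩ := exists_isUnit_conj_mem_unitaryGroup R
  let U : A →* Matrix.unitaryGroup (Fin (Module.finrank ℂ W)) ℂ :=
    { toFun := fun a => ⟨B * R a * B⁻¹, hB a⟩
      map_one' := Subtype.ext (by simp [Matrix.mul_nonsing_inv B unit])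
      map_mul' := fun a a' => Subtype.ext (by
        simp [mul_assoc, Matrix.nonsing_inv_mul_cancel_left _ _ unit]) }
  refine ⟨U, ⟨.mk (b.equivFun ≪≫ₗ Matrix.toLinearEquiv' B (B.invertibleOfIsUnitDet unit))
    fun a => LinearMap.ext fun w => ?_⟩⟩
  have toMatrix : b.equivFun (ρ a w) = (R a).mulVec (b.equivFun w) :=
    (LinearMap.toMatrix_mulVec_repr b b (ρ a) w).symm
  change B.mulVec (b.equivFun (ρ a w)) = (B * R a * B⁻¹).mulVec (B.mulVec (b.equivFun w))
  rw [toMatrix, Matrix.mulVec_mulVec, Matrix.mulVec_mulVec, mul_assoc,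
    Matrix.nonsing_inv_mul B unit, mul_one]

theorem isIrreducible_of_isAtom_range {V W : Type*} [AddCommGroup V] [Module ℂ V]
    [AddCommGroup W] [Module ℂ W] {σ : Representation ℂ A V} {ρ : Representation ℂ A W}
    {j : σ.IntertwiningMap ρ} (hj : Function.Injective j) (hr : IsAtom j.range) :
    σ.IsIrreducible := by
  let J := Representation.IntertwiningMap.equivLinearMapAsModule σ ρ j
  have atom : IsAtom (LinearMap.range J) :=
    (Subrepresentation.subrepresentationSubmoduleOrderIso.isAtom_iff j.range).2 hr
  have := isSimpleModule_iff_isAtom.2 atom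
  exact (Representation.irreducible_iff_isSimpleModule_asModule σ).2
    (IsSimpleModule.congr (LinearEquiv.ofInjective J hj))

theorem exists_intertwiningMap_mem [Finite A] {W : Type*} [AddCommGroup W] [Module ℂ W]
    [FiniteDimensional ℂ W] {ρ : Representation ℂ A W} {S : Subrepresentation ρ} (hS : S ≠ ⊥) :
    ∃ (π : IrrRep A) (f : (unitaryRep π.ρ).IntertwiningMap ρ), f ≠ 0 ∧ ∀ v, f v ∈ S := by
  have : WellFoundedLT (Subrepresentation ρ) :=
    StrictMono.wellFoundedLT (f := Subrepresentation.toSubmodule) fun _ _ h => h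
  obtain ⟨T, atom, hTS⟩ := (IsAtomic.eq_bot_or_exists_atom_le S).resolve_left hS
  obtain ⟨U, ⟨e⟩⟩ := exists_equiv_unitaryRep T.toRepresentation
  let inclusion : T.toRepresentation.IntertwiningMap ρ := ⟨T.toSubmodule.subtype, fun _ => rfl⟩
  let j := inclusion.comp e.symm.toIntertwiningMap
  have injective : Function.Injective j := Subtype.val_injective.comp e.symm.injective
  have range : j.range = T := SetLike.ext fun w => (j.mem_range _ _ w).trans
    ⟨fun ⟨v, hv⟩ => hv ▸ (e.symm v).2,
      fun hw => ⟨e ⟨w, hw⟩, congrArg Subtype.val (e.symm_apply_apply ⟨w, hw⟩)⟩⟩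
  refine ⟨⟨_, U, isIrreducible_of_isAtom_range injective (range.symm ▸ atom)⟩, j, fun j_eq => ?_,
    fun v => hTS (e.symm v).2⟩
  obtain ⟨w, hw, w_ne⟩ := T.toSubmodule.ne_bot_iff.1 fun h =>
    atom.1 (Subrepresentation.toSubmodule_injective h)
  obtain ⟨v, rfl⟩ := (j.mem_range _ _ w).1 (range.symm ▸ hw)
  exact w_ne (congrArg (fun f : (unitaryRep U).IntertwiningMap ρ => f v) j_eq)

theorem bijective_of_bijective_comp [Finite A] {W W' : Type*} [AddCommGroup W] [Module ℂ W]
    [FiniteDimensional ℂ W] [AddCommGroup W'] [Module ℂ W'] [FiniteDimensional ℂ W']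
    {ρ : Representation ℂ A W} {ρ' : Representation ℂ A W'} (Φ : ρ.IntertwiningMap ρ')
    (hΦ : ∀ π : IrrRep A, Function.Bijective
      fun f : (unitaryRep π.ρ).IntertwiningMap ρ => Φ.comp f) :
    Function.Bijective Φ := by
  constructor
  · have ker_eq_bot : Φ.ker = ⊥ := by
      by_contra ker_ne_bot
      obtain ⟨π, f, f_ne, hf⟩ := exists_intertwiningMap_mem ker_ne_bot
      refine f_ne ((hΦ π).1 (DFunLike.ext _ _ fun v => ?_))
      exact (hf v).trans (map_zero Φ).symm
    exact LinearMap.ker_eq_bot.1 (congrArg Subrepresentation.toSubmodule ker_eq_bot)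
  · obtain ⟨C, hC⟩ := exists_isCompl Φ.range
    have C_eq_bot : C = ⊥ := by
      by_contra C_ne_bot
      obtain ⟨π, f, f_ne, hf⟩ := exists_intertwiningMap_mem C_ne_bot
      obtain ⟨g, rfl⟩ := (hΦ π).2 f
      refine f_ne (DFunLike.ext _ _ fun v => ?_)
      have mem_inf : Φ (g v) ∈ Φ.range ⊓ C := ⟨(Φ.mem_range _ _ _).2 ⟨g v, rfl⟩, hf v⟩
      exact hC.inf_eq_bot.le mem_inf
    have range_eq_top : Φ.range = ⊤ := eq_top_of_isCompl_bot (C_eq_bot ▸ hC)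
    exact LinearMap.range_eq_top.1 (congrArg Subrepresentation.toSubmodule range_eq_top)

theorem finite_irr [Finite A] : Finite (Irr A) := by
  classical
  have := Fintype.ofFinite A
  have : Invertible (Nat.card A : ℂ) := invertibleOfNonzero (Nat.cast_ne_zero.2 Nat.card_pos.ne')
  let B : LinearMap.BilinForm ℂ (A → ℂ) := (Nat.card A : ℂ)⁻¹ • ∑ a : A,
    (LinearMap.mul ℂ ℂ).compl₁₂ (LinearMap.proj a) (LinearMap.proj a⁻¹)
  let χ (o : Irr A) : A → ℂ := (unitaryRep o.out.ρ).character
  have orthonormal (o o' : Irr A) : B (χ o) (χ o') = if o' = o then 1 else 0 := by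
    have := o.out.irr
    have := o'.out.irr
    have equiv_iff : Nonempty ((unitaryRep o'.out.ρ).Equiv (unitaryRep o.out.ρ)) ↔ o' = o :=
      Quotient.out_equiv_out (s := IrrRep.setoid A)
    simpa [B, χ, equiv_iff] using
      Representation.char_orthonormal (ρ := unitaryRep o.out.ρ) (σ := unitaryRep o'.out.ρ)
  have linearIndependent : LinearIndependent ℂ χ :=
    LinearMap.BilinForm.linearIndependent_of_iIsOrtho (B := B)
      (fun o o' h => (orthonormal o o').trans (if_neg h.symm)) (fun o => by simp [orthonormal])
  exact linearIndependent.finite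

end Representations

/-! ### Locally trivial families -/

section Charts

open Filter Bundle

variable {B : Type*} [TopologicalSpace B]

/-- A linear trivialization, with model fibre `W`, of a family of vector spaces over the open set
`source`: `coord b` and `frame b` are mutually inverse for `b ∈ source`, and are arbitrary linear
maps for the other `b`. -/
structure Chart (Fib : B → Type*) [∀ b, AddCommGroup (Fib b)] [∀ b, Module ℂ (Fib b)]
    [TopologicalSpace (TotalSpace Unit Fib)] (W : Type*) [AddCommGroup W] [Module ℂ W]
    [TopologicalSpace W] where
  source : Set B
  coord : ∀ b, Fib b →ₗ[ℂ] W
  frame : ∀ b, W →ₗ[ℂ] Fib b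
  isOpen_source : IsOpen source
  frame_coord : ∀ b ∈ source, ∀ v, frame b (coord b v) = v
  coord_frame : ∀ b ∈ source, ∀ w, coord b (frame b w) = w
  continuousAt_coord : ∀ t : TotalSpace Unit Fib, t.proj ∈ source →
    ContinuousAt (fun s : TotalSpace Unit Fib => (s.proj, coord s.proj s.snd)) t
  continuousAt_frame : ∀ p : B × W, p.1 ∈ source →
    ContinuousAt (fun q : B × W => (⟨q.1, frame q.1 q.2⟩ : TotalSpace Unit Fib)) p

/-- Local triviality of a family of vector spaces; the ranks of the charts may vary. -/
def IsLocallyTrivial (Fib : B → Type*) [∀ b, AddCommGroup (Fib b)] [∀ b, Module ℂ (Fib b)]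
    [TopologicalSpace (TotalSpace Unit Fib)] : Prop :=
  ∀ b, ∃ (n : ℕ) (c : Chart Fib (Fin n → ℂ)), b ∈ c.source

variable {Fib Fib' : B → Type*} [∀ b, AddCommGroup (Fib b)] [∀ b, Module ℂ (Fib b)]
  [TopologicalSpace (TotalSpace Unit Fib)] [∀ b, AddCommGroup (Fib' b)]
  [∀ b, Module ℂ (Fib' b)] [TopologicalSpace (TotalSpace Unit Fib')]
  {W W' : Type*} [NormedAddCommGroup W] [NormedSpace ℂ W] [NormedAddCommGroup W']
  [NormedSpace ℂ W'] {Z : Type*} [TopologicalSpace Z] {p : Z → B}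

theorem Chart.continuousAt_mk_iff (c : Chart Fib W) {s : ∀ z, Fib (p z)} {z : Z}
    (hz : p z ∈ c.source) :
    ContinuousAt (fun z => (⟨p z, s z⟩ : TotalSpace Unit Fib)) z ↔
      ContinuousAt p z ∧ ContinuousAt (fun z => c.coord (p z) (s z)) z := by
  constructor
  · intro h
    have coord_comp := (c.continuousAt_coord ⟨p z, s z⟩ hz).comp_of_eq h rfl
    exact ⟨coord_comp.fst, coord_comp.snd⟩
  · rintro ⟨hp, hs⟩
    have frame_comp := (c.continuousAt_frame (p z, _) hz).comp_of_eq (hp.prodMk hs) rfl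
    refine frame_comp.congr ?_
    filter_upwards [hp (c.isOpen_source.mem_nhds hz)] with z hz
    exact congrArg (TotalSpace.mk (p z)) (c.frame_coord _ hz (s z))

/-- A chart as a homeomorphism from the part of the total space over its source. -/
def Chart.homeomorph (c : Chart Fib W) :
    {t : TotalSpace Unit Fib // t.proj ∈ c.source} ≃ₜ c.source × W where
  toFun t := (⟨t.1.proj, t.2⟩, c.coord t.1.proj t.1.snd)
  invFun q := ⟨⟨q.1, c.frame q.1 q.2⟩, q.1.2⟩
  left_inv t := Subtype.ext (congrArg (TotalSpace.mk t.1.proj) (c.frame_coord _ t.2 t.1.snd))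
  right_inv q := Prod.ext rfl (c.coord_frame _ q.1.2 q.2)
  continuous_toFun := by
    have coord : Continuous fun t : {t : TotalSpace Unit Fib // t.proj ∈ c.source} =>
        (t.1.proj, c.coord t.1.proj t.1.snd) := continuous_iff_continuousAt.2 fun t =>
      (c.continuousAt_coord t.1 t.2).comp continuous_subtype_val.continuousAt
    exact (coord.fst.subtype_mk _).prodMk coord.snd
  continuous_invFun := (continuous_iff_continuousAt.2 fun q =>
    (c.continuousAt_frame (q.1, q.2) q.1.2).comp_of_eq
      (continuous_subtype_val.prodMap continuous_id).continuousAt rfl).subtype_mk _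

theorem Chart.isLocallyTrivial_at [FiniteDimensional ℂ W] (c : Chart Fib W) {b : B}
    (hb : b ∈ c.source) : ∃ (n : ℕ) (c' : Chart Fib (Fin n → ℂ)), b ∈ c'.source := by
  let e : W ≃L[ℂ] (Fin (Module.finrank ℂ W) → ℂ) := .ofFinrankEq (by simp)
  exact ⟨_,
    { source := c.source
      coord := fun b => e.toLinearEquiv.toLinearMap ∘ₗ c.coord b
      frame := fun b => c.frame b ∘ₗ e.symm.toLinearEquiv.toLinearMap
      isOpen_source := c.isOpen_source
      frame_coord := fun b hb v => by simp [c.frame_coord b hb]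
      coord_frame := fun b hb w => by simp [c.coord_frame b hb]
      continuousAt_coord := fun t ht => (c.continuousAt_coord t ht).fst.prodMk
        (e.continuous.continuousAt.comp (c.continuousAt_coord t ht).snd)
      continuousAt_frame := fun p hp => (c.continuousAt_frame (p.1, e.symm p.2) hp).comp_of_eq
        (continuousAt_fst.prodMk (e.symm.continuous.continuousAt.comp continuousAt_snd)) rfl }, hb⟩

theorem IsLocallyTrivial.continuous_proj (h : IsLocallyTrivial Fib) :
    Continuous fun t : TotalSpace Unit Fib => t.proj :=
  continuous_iff_continuousAt.2 fun t =>
    let ⟨_, c, ht⟩ := h t.proj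
    (c.continuousAt_coord t ht).fst

theorem IsLocallyTrivial.finiteDimensional (h : IsLocallyTrivial Fib) (b : B) :
    FiniteDimensional ℂ (Fib b) :=
  let ⟨_, c, hb⟩ := h b
  .of_injective (c.coord b) (Function.LeftInverse.injective (c.frame_coord b hb))

section Operations

theorem IsLocallyTrivial.continuous_add (h : IsLocallyTrivial Fib) {s s' : ∀ z, Fib (p z)}
    (hs : Continuous fun z => (⟨p z, s z⟩ : TotalSpace Unit Fib))
    (hs' : Continuous fun z => (⟨p z, s' z⟩ : TotalSpace Unit Fib)) :
    Continuous fun z => (⟨p z, s z + s' z⟩ : TotalSpace Unit Fib) :=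
  continuous_iff_continuousAt.2 fun z => by
    obtain ⟨n, c, hz⟩ := h (p z)
    have coord_s := (c.continuousAt_mk_iff hz).1 hs.continuousAt
    have coord_s' := (c.continuousAt_mk_iff hz).1 hs'.continuousAt
    refine (c.continuousAt_mk_iff hz).2 ⟨coord_s.1, ?_⟩
    simpa only [map_add] using coord_s.2.fun_add coord_s'.2

theorem IsLocallyTrivial.continuous_smul (h : IsLocallyTrivial Fib) {a : Z → ℂ}
    (ha : Continuous a) {s : ∀ z, Fib (p z)}
    (hs : Continuous fun z => (⟨p z, s z⟩ : TotalSpace Unit Fib)) :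
    Continuous fun z => (⟨p z, a z • s z⟩ : TotalSpace Unit Fib) :=
  continuous_iff_continuousAt.2 fun z => by
    obtain ⟨n, c, hz⟩ := h (p z)
    have coord_s := (c.continuousAt_mk_iff hz).1 hs.continuousAt
    refine (c.continuousAt_mk_iff hz).2 ⟨coord_s.1, ?_⟩
    simpa only [map_smul] using ha.continuousAt.fun_smul coord_s.2

theorem IsLocallyTrivial.continuous_zero (h : IsLocallyTrivial Fib) (hp : Continuous p) :
    Continuous fun z => (⟨p z, 0⟩ : TotalSpace Unit Fib) :=
  continuous_iff_continuousAt.2 fun z => by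
    obtain ⟨n, c, hz⟩ := h (p z)
    refine (c.continuousAt_mk_iff hz).2 ⟨hp.continuousAt, ?_⟩
    simpa only [map_zero] using continuousAt_const

theorem IsLocallyTrivial.continuous_sum (h : IsLocallyTrivial Fib) (hp : Continuous p) {ι : Type*}
    (I : Finset ι) {s : ι → ∀ z, Fib (p z)}
    (hs : ∀ i, Continuous fun z => (⟨p z, s i z⟩ : TotalSpace Unit Fib)) :
    Continuous fun z => (⟨p z, ∑ i ∈ I, s i z⟩ : TotalSpace Unit Fib) := by
  classical
  induction I using Finset.induction_on with
  | empty => simpa only [Finset.sum_empty] using h.continuous_zero hp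
  | insert i I hi ih =>
    simp only [Finset.sum_insert hi]
    exact h.continuous_add (hs i) ih

end Operations

/-- The matrix of a fibrewise linear map in two charts. -/
def Chart.matrix [FiniteDimensional ℂ W] (c : Chart Fib W) (c' : Chart Fib' W')
    (Φ : ∀ b, Fib b →ₗ[ℂ] Fib' b) (b : B) : W →L[ℂ] W' :=
  LinearMap.toContinuousLinearMap (c'.coord b ∘ₗ Φ b ∘ₗ c.frame b)

theorem Chart.continuousAt_matrix [FiniteDimensional ℂ W] (c : Chart Fib W) (c' : Chart Fib' W')
    {Φ : ∀ b, Fib b →ₗ[ℂ] Fib' b}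
    (hΦ : Continuous fun t : TotalSpace Unit Fib =>
      (⟨t.proj, Φ t.proj t.snd⟩ : TotalSpace Unit Fib'))
    {b : B} (hb : b ∈ c.source) (hb' : b ∈ c'.source) : ContinuousAt (c.matrix c' Φ) b := by
  refine continuousAt_clm_apply.2 fun w => ?_
  have frame_w : ContinuousAt (fun b => (⟨b, c.frame b w⟩ : TotalSpace Unit Fib)) b :=
    (c.continuousAt_frame (b, w) hb).comp_of_eq (continuousAt_id.prodMk continuousAt_const) rfl
  exact ((c'.continuousAt_mk_iff hb').1 (hΦ.continuousAt.comp frame_w)).2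

theorem Chart.matrix_symm_eq_inverse [FiniteDimensional ℂ W] [FiniteDimensional ℂ W']
    (c : Chart Fib W) (c' : Chart Fib' W') (Φ : ∀ b, Fib b ≃ₗ[ℂ] Fib' b) {b : B}
    (hb : b ∈ c.source) (hb' : b ∈ c'.source) :
    c'.matrix c (fun b => (Φ b).symm.toLinearMap) b =
      (c.matrix c' (fun b => (Φ b).toLinearMap) b).inverse := by
  symm
  refine ContinuousLinearMap.inverse_eq ?_ ?_
  · ext1 w
    simp [matrix, c.frame_coord b hb, c'.coord_frame b hb']
  · ext1 w
    simp [matrix, c'.frame_coord b hb', c.coord_frame b hb]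

theorem Chart.isInvertible_matrix [FiniteDimensional ℂ W] [FiniteDimensional ℂ W']
    (c : Chart Fib W) (c' : Chart Fib' W') (Φ : ∀ b, Fib b ≃ₗ[ℂ] Fib' b) {b : B}
    (hb : b ∈ c.source) (hb' : b ∈ c'.source) :
    (c.matrix c' (fun b => (Φ b).toLinearMap) b).IsInvertible := by
  refine .of_inverse (g := c'.matrix c (fun b => (Φ b).symm.toLinearMap) b) ?_ ?_
  · ext1 w
    simp [matrix, c.frame_coord b hb, c'.coord_frame b hb']
  · ext1 w
    simp [matrix, c'.frame_coord b hb', c.coord_frame b hb]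

theorem IsLocallyTrivial.continuous_symm (h : IsLocallyTrivial Fib) (h' : IsLocallyTrivial Fib')
    (Φ : ∀ b, Fib b ≃ₗ[ℂ] Fib' b)
    (hΦ : Continuous fun t : TotalSpace Unit Fib =>
      (⟨t.proj, Φ t.proj t.snd⟩ : TotalSpace Unit Fib')) :
    Continuous fun t : TotalSpace Unit Fib' =>
      (⟨t.proj, (Φ t.proj).symm t.snd⟩ : TotalSpace Unit Fib) := by
  refine continuous_iff_continuousAt.2 fun t => ?_
  obtain ⟨n, c, hb⟩ := h t.proj
  obtain ⟨n', c', hb'⟩ := h' t.proj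
  have proj : ContinuousAt (fun s : TotalSpace Unit Fib' => s.proj) t :=
    h'.continuous_proj.continuousAt
  have inverse : ContinuousAt
      (c'.matrix c fun b => (Φ b).symm.toLinearMap) t.proj := by
    refine ((c.isInvertible_matrix c' Φ hb hb').contDiffAt_map_inverse (n := 0)).continuousAt.comp
      (c.continuousAt_matrix c' hΦ hb hb') |>.congr ?_
    filter_upwards [c.isOpen_source.mem_nhds hb, c'.isOpen_source.mem_nhds hb'] with b hb hb'
    exact (c.matrix_symm_eq_inverse c' Φ hb hb').symm
  refine (c.continuousAt_mk_iff (p := fun s : TotalSpace Unit Fib' => s.proj) hb).2 ⟨proj, ?_⟩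
  refine ((inverse.comp proj).clm_apply (c'.continuousAt_coord t hb').snd).congr ?_
  filter_upwards [proj (c'.isOpen_source.mem_nhds hb')] with s hs
  exact congrArg (fun v => c.coord s.proj ((Φ s.proj).symm v)) (c'.frame_coord _ hs s.snd)

section Retract

variable {j : ∀ b, Fib b →ₗ[ℂ] Fib' b} {r : ∀ b, Fib' b →ₗ[ℂ] Fib b}

/-- For close projections `P` and `Q`, this maps the range of `Q` isomorphically to that of `P`. -/
def rangeComparison {R : Type*} [Ring R] (P Q : R) : R :=
  P * Q + (1 - P) * (1 - Q)

theorem rangeComparison_self {R : Type*} [Ring R] {P : R} (hP : IsIdempotentElem P) :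
    rangeComparison P P = 1 := by
  rw [rangeComparison, hP.eq, hP.one_sub.eq, add_sub_cancel]

theorem inverse_rangeComparison_mul {R : Type*} [Ring R] {P Q : R} (hQ : IsIdempotentElem Q)
    (h : IsUnit (rangeComparison P Q)) : Ring.inverse (rangeComparison P Q) * (P * Q) = Q := by
  have comparison_mul : rangeComparison P Q * Q = P * Q := by
    simp only [rangeComparison, add_mul, mul_assoc, hQ.eq, hQ.one_sub_mul_self, mul_zero, add_zero]
  rw [← comparison_mul, Ring.inverse_mul_cancel_left _ _ h]

theorem mul_inverse_rangeComparison {R : Type*} [Ring R] {P Q : R} (hP : IsIdempotentElem P)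
    (h : IsUnit (rangeComparison P Q)) : P * Q * Ring.inverse (rangeComparison P Q) = P := by
  have mul_comparison : P * rangeComparison P Q = P * Q := by
    simp only [rangeComparison, mul_add, ← mul_assoc, hP.eq, hP.mul_one_sub_self, zero_mul,
      add_zero]
  rw [← mul_comparison, Ring.mul_inverse_cancel_right _ _ h]

/-- The projection onto the image of `Fib` in a chart of `Fib'`, for a retraction `r` of `j`. -/
def Chart.projection [FiniteDimensional ℂ W] (c : Chart Fib' W) (j : ∀ b, Fib b →ₗ[ℂ] Fib' b)
    (r : ∀ b, Fib' b →ₗ[ℂ] Fib b) : B → W →L[ℂ] W :=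
  c.matrix c fun b => j b ∘ₗ r b

omit [TopologicalSpace (TotalSpace Unit Fib)] in
theorem Chart.projection_coord [FiniteDimensional ℂ W] (c : Chart Fib' W)
    (hrj : ∀ b v, r b (j b v) = v) {b : B} (hb : b ∈ c.source) (v : Fib b) :
    c.projection j r b (c.coord b (j b v)) = c.coord b (j b v) := by
  simp [projection, matrix, c.frame_coord b hb, hrj]

omit [TopologicalSpace (TotalSpace Unit Fib)] in
theorem Chart.isIdempotentElem_projection [FiniteDimensional ℂ W] (c : Chart Fib' W)
    (hrj : ∀ b v, r b (j b v) = v) {b : B} (hb : b ∈ c.source) :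
    IsIdempotentElem (c.projection j r b) :=
  ContinuousLinearMap.ext fun _ => c.projection_coord hrj hb _

/-- If the family `Fib` is a retract of `Fib'`, then a chart `c` of `Fib'` around `b₀` gives a chart
of `Fib` around `b₀`, modelled on the range of the projection at `b₀`. -/
def Chart.retract [FiniteDimensional ℂ W] (c : Chart Fib' W)
    (hj : Continuous fun t : TotalSpace Unit Fib =>
      (⟨t.proj, j t.proj t.snd⟩ : TotalSpace Unit Fib'))
    (hr : Continuous fun t : TotalSpace Unit Fib' =>
      (⟨t.proj, r t.proj t.snd⟩ : TotalSpace Unit Fib))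
    (hrj : ∀ b v, r b (j b v) = v) {b₀ : B} (hb₀ : b₀ ∈ c.source) :
    Chart Fib (c.projection j r b₀).range :=
  have : CompleteSpace W := FiniteDimensional.complete ℂ W
  let P := c.projection j r
  let Γ b := rangeComparison (P b₀) (P b)
  have continuousAt_Γ {b} (hb : b ∈ c.source) : ContinuousAt Γ b := by
    have continuousAt_P : ContinuousAt P b :=
      c.continuousAt_matrix c (Φ := fun b => j b ∘ₗ r b) (hj.comp hr) hb hb
    exact (continuousAt_const.mul continuousAt_P).add
      (continuousAt_const.mul (continuousAt_const.sub continuousAt_P))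
  { source := c.source ∩ Γ ⁻¹' {T | IsUnit T}
    coord := fun b => (P b₀).toLinearMap.rangeRestrict ∘ₗ c.coord b ∘ₗ j b
    frame := fun b => r b ∘ₗ c.frame b ∘ₗ (Ring.inverse (Γ b)).toLinearMap ∘ₗ Submodule.subtype _
    isOpen_source := ContinuousOn.isOpen_inter_preimage
      (fun b hb => (continuousAt_Γ hb).continuousWithinAt) c.isOpen_source Units.isOpen
    frame_coord := fun b hb v => by
      have inverse_coord :=
        congr($(inverse_rangeComparison_mul (c.isIdempotentElem_projection hrj hb.1) hb.2)
          (c.coord b (j b v)))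
      simp only [mul_apply_eq_comp, c.projection_coord hrj hb.1] at inverse_coord
      calc r b (c.frame b (Ring.inverse (Γ b) (P b₀ (c.coord b (j b v)))))
          = r b (c.frame b (c.coord b (j b v))) := by rw [inverse_coord]
        _ = v := by rw [c.frame_coord b hb.1, hrj]
    coord_frame := fun b hb w => Subtype.ext <| by
      have hP := c.isIdempotentElem_projection hrj hb₀
      obtain ⟨w, v, rfl⟩ := w
      exact (congr($(mul_inverse_rangeComparison hP hb.2) (P b₀ v))).trans congr($hP v)
    continuousAt_coord := fun t ht => by
      have coord_j := c.continuousAt_mk_iff ht.1 |>.1 hj.continuousAt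
      exact coord_j.1.prodMk (((P b₀).continuous.subtype_mk _).continuousAt.comp coord_j.2)
    continuousAt_frame := fun p hp => by
      have inverse : ContinuousAt (fun b => Ring.inverse (Γ b)) p.1 := by
        obtain ⟨T, hT⟩ := hp.2
        exact (hT ▸ NormedRing.inverse_continuousAt T).comp (continuousAt_Γ hp.1)
      have inverse_apply : ContinuousAt
          (fun q : B × (P b₀).range => Ring.inverse (Γ q.1) (q.2 : W)) p :=
        (inverse.comp continuousAt_fst).clm_apply
          (continuous_subtype_val.continuousAt.comp continuousAt_snd)
      exact hr.continuousAt.comp ((c.continuousAt_frame (p.1, _) hp.1).comp_of_eq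
        (continuousAt_fst.prodMk inverse_apply) rfl) }

theorem IsLocallyTrivial.of_retract (h : IsLocallyTrivial Fib')
    (hj : Continuous fun t : TotalSpace Unit Fib =>
      (⟨t.proj, j t.proj t.snd⟩ : TotalSpace Unit Fib'))
    (hr : Continuous fun t : TotalSpace Unit Fib' =>
      (⟨t.proj, r t.proj t.snd⟩ : TotalSpace Unit Fib))
    (hrj : ∀ b v, r b (j b v) = v) : IsLocallyTrivial Fib := fun b => by
  obtain ⟨n, c, hb⟩ := h b
  have comparison_eq_one := rangeComparison_self (c.isIdempotentElem_projection hrj hb)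
  exact (c.retract hj hr hrj hb).isLocallyTrivial_at
    ⟨hb, (congrArg IsUnit comparison_eq_one).mpr isUnit_one⟩

end Retract

section Pi

variable {ι : Type*} {C : ι → Type*} [∀ i, TopologicalSpace (C i)]
  {D : ∀ i, C i → Type*} [∀ i c, AddCommGroup (D i c)] [∀ i c, Module ℂ (D i c)]
  [∀ i, TopologicalSpace (TotalSpace Unit (D i))]

/-- The product of charts `c i` of families `D i`, as a chart of a family `Fib` with fibres
`∀ i, D i (m i b)`. -/
def Chart.pi [Fintype ι] {V : ι → Type*} [∀ i, NormedAddCommGroup (V i)]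
    [∀ i, NormedSpace ℂ (V i)] (c : ∀ i, Chart (D i) (V i)) {m : ∀ i, B → C i}
    (hm : ∀ i, Continuous (m i))
    (e : ∀ b, Fib b ≃ₗ[ℂ] ∀ i, D i (m i b))
    (he : IsInducing fun t : TotalSpace Unit Fib =>
      (t.proj, fun i => (⟨m i t.proj, e t.proj t.snd i⟩ : TotalSpace Unit (D i)))) :
    Chart Fib (∀ i, V i) where
  source := ⋂ i, m i ⁻¹' (c i).source
  coord b := LinearMap.piMap (fun i => (c i).coord (m i b)) ∘ₗ (e b).toLinearMap
  frame b := (e b).symm.toLinearMap ∘ₗ LinearMap.piMap fun i => (c i).frame (m i b)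
  isOpen_source := isOpen_iInter_of_finite fun i => (c i).isOpen_source.preimage (hm i)
  frame_coord b hb v := (e b).symm_apply_eq.2 <| funext fun i =>
    (c i).frame_coord _ (Set.mem_iInter.1 hb i) _
  coord_frame b hb w := funext fun i => by
    simpa using (c i).coord_frame _ (Set.mem_iInter.1 hb i) (w i)
  continuousAt_coord t ht := by
    refine he.continuous.fst.continuousAt.prodMk (continuousAt_pi.2 fun i => ?_)
    exact (((c i).continuousAt_mk_iff (p := fun s : TotalSpace Unit Fib => m i s.proj)
      (Set.mem_iInter.1 ht i)).1 (continuous_pi_iff.1 he.continuous.snd i).continuousAt).2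
  continuousAt_frame p hp := by
    refine he.continuousAt_iff.2 (continuousAt_fst.prodMk (continuousAt_pi.2 fun i => ?_))
    simp only [LinearMap.comp_apply, LinearEquiv.coe_coe,
      LinearEquiv.apply_symm_apply]
    exact ((c i).continuousAt_frame (m i p.1, p.2 i) (Set.mem_iInter.1 hp i)).comp_of_eq
      (((hm i).continuousAt.comp continuousAt_fst).prodMk
        ((continuous_apply i).continuousAt.comp continuousAt_snd)) rfl

/-- The topology on the total space of the sum of the families `m i^* (D i)`, for `Fib b` identified
with the product of the fibres by `e b`. -/
abbrev sumTopology {Fib : B → Type*} {ι : Type*} {C : ι → Type*} {D : ∀ i, C i → Type*}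
    [∀ i, TopologicalSpace (TotalSpace Unit (D i))] (m : ∀ i, B → C i)
    (e : ∀ b, Fib b → ∀ i, D i (m i b)) : TopologicalSpace (TotalSpace Unit Fib) :=
  .induced (fun t => (t.proj, fun i => (⟨m i t.proj, e t.proj t.snd i⟩ :
    TotalSpace Unit (D i)))) inferInstance

theorem IsLocallyTrivial.pi [Finite ι] (h : ∀ i, IsLocallyTrivial (D i)) {m : ∀ i, B → C i}
    (hm : ∀ i, Continuous (m i)) (e : ∀ b, Fib b ≃ₗ[ℂ] ∀ i, D i (m i b))
    (he : IsInducing fun t : TotalSpace Unit Fib =>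
      (t.proj, fun i => (⟨m i t.proj, e t.proj t.snd i⟩ : TotalSpace Unit (D i)))) :
    IsLocallyTrivial Fib := fun b => by
  have := Fintype.ofFinite ι
  choose n c hc using fun i => h i (m i b)
  exact (Chart.pi c hm e he).isLocallyTrivial_at (Set.mem_iInter.2 hc)

end Pi

end Charts

section Bundles

variable {H : Type v} [Group H] [TopologicalSpace H] {X : GSpace.{u, v} H} {E F F' : EqFamily X}

namespace EqFamily

theorem IsBundle.isLocallyTrivial (hE : E.IsBundle) : IsLocallyTrivial E.Fib := by
  classical
  intro x₀
  obtain ⟨U, n, φ, hU, hx, hφ⟩ := hE.locally_trivial x₀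
  have isOpen_preimage := hU.preimage hE.continuous_proj
  refine ⟨n,
    { source := U
      coord := fun x => if h : x ∈ U then (φ ⟨x, h⟩).toLinearMap else 0
      frame := fun x => if h : x ∈ U then (φ ⟨x, h⟩).symm.toLinearMap else 0
      isOpen_source := hU
      frame_coord := fun x hx v => by simp [hx]
      coord_frame := fun x hx w => by simp [hx]
      continuousAt_coord := fun t ht => ?_
      continuousAt_frame := fun p hp => ?_ }, hx⟩
  · refine ContinuousOn.continuousAt ?_ (isOpen_preimage.mem_nhds ht)
    refine continuousOn_iff_continuous_domRestrict.2 ?_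
    refine ((continuous_subtype_val.prodMap continuous_id).comp hφ.continuous).congr fun s => ?_
    have hs : s.1.proj ∈ U := s.2
    simp [hs]
  · refine ContinuousOn.continuousAt ?_ ((hU.prod isOpen_univ).mem_nhds ⟨hp, trivial⟩)
    refine continuousOn_iff_continuous_domRestrict.2 ?_
    let e := hφ.homeomorph
    have symm_eq (x : U) (w) : (e.symm (x, w)).1 = ⟨x, (φ x).symm w⟩ := by
      let t : {t : E.Tot // t.proj ∈ U} := ⟨⟨x, (φ x).symm w⟩, x.2⟩
      have e_t : e t = (x, w) := Prod.ext rfl ((φ x).apply_symm_apply w)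
      exact congrArg Subtype.val (e.symm_apply_eq.2 e_t.symm)
    let pair (q : (U ×ˢ Set.univ : Set (X × (Fin n → ℂ)))) : U × (Fin n → ℂ) :=
      (⟨q.1.1, q.2.1⟩, q.1.2)
    have continuous_pair : Continuous pair :=
      (continuous_subtype_val.fst.subtype_mk _).prodMk continuous_subtype_val.snd
    refine (continuous_subtype_val.comp (e.symm.continuous.comp continuous_pair)).congr
      fun q => (symm_eq _ _).trans ?_
    have hq : q.1.1 ∈ U := q.2.1
    simp [hq]

theorem isBundle_of_isLocallyTrivial (h : IsLocallyTrivial E.Fib)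
    (hact : Continuous fun p : H × E.Tot => (⟨p.1 • p.2.proj, E.act p.1 rfl p.2.snd⟩ : E.Tot)) :
    E.IsBundle where
  continuous_proj := h.continuous_proj
  continuous_act := hact
  locally_trivial x₀ := by
    obtain ⟨n, c, hx⟩ := h x₀
    let φ (x : c.source) : E.Fib x ≃ₗ[ℂ] (Fin n → ℂ) :=
      .ofLinearMap (c.coord x) (c.frame x) (LinearMap.ext (c.coord_frame x x.2))
        (LinearMap.ext (c.frame_coord x x.2))
    exact ⟨c.source, n, φ, c.isOpen_source, hx, c.homeomorph.isHomeomorph⟩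

theorem IsBundle.continuous_act_apply (hE : E.IsBundle) {Z : Type*} [TopologicalSpace Z]
    (h : H) {p q : Z → X} (e : ∀ z, h • p z = q z) {s : ∀ z, E.Fib (p z)}
    (hs : Continuous fun z => (⟨p z, s z⟩ : E.Tot)) :
    Continuous fun z => (⟨q z, E.act h (e z) (s z)⟩ : E.Tot) :=
  (hE.continuous_act.comp (continuous_const.prodMk hs)).congr fun z =>
    E.act_heq h rfl (e z) (s z)

theorem act_act_eq (E : EqFamily X) {g h g' h' : H} (hgh : g * h = g' * h') {x y y' z : X}
    (hxy : h • x = y) (hyz : g • y = z) (hxy' : h' • x = y') (hyz' : g' • y' = z) (v : E.Fib x) :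
    E.act g hyz (E.act h hxy v) = E.act g' hyz' (E.act h' hxy' v) := by
  have hxz : (g * h) • x = z := by rw [mul_smul, hxy, hyz]
  rw [← E.act_mul _ _ _ _ hxz, ← E.act_mul _ _ _ _ (hgh ▸ hxz)]
  exact E.act_congr hgh _ _ _

theorem act_act_of_mul_eq_one (E : EqFamily X) {g h : H} (hgh : g * h = 1) {x y : X}
    (hxy : h • x = y) (hyx : g • y = x) (v : E.Fib x) : E.act g hyx (E.act h hxy v) = v := by
  rw [← E.act_mul _ _ _ _ (by rw [hgh, one_smul]), E.act_congr hgh _ (one_smul H x), E.act_one]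

/-- Morphisms of families: continuous equivariant fibrewise linear maps. -/
structure Hom (E F : EqFamily X) where
  toFun : ∀ x, E.Fib x →ₗ[ℂ] F.Fib x
  comm : ∀ (h : H) {x y : X} (e : h • x = y) (v : E.Fib x),
    toFun y (E.act h e v) = F.act h e (toFun x v)
  continuous : Continuous fun t : E.Tot => (⟨t.proj, toFun t.proj t.snd⟩ : F.Tot)

/-- Composition of morphisms of families. -/
def Hom.comp (ψ : F.Hom F') (φ : E.Hom F) : E.Hom F' where
  toFun x := ψ.toFun x ∘ₗ φ.toFun x
  comm h _ _ e v := (congrArg (ψ.toFun _) (φ.comm h e v)).trans (ψ.comm h e _)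
  continuous := ψ.continuous.comp φ.continuous

/-- The morphism underlying an isomorphism of families. -/
def Iso.hom (i : E.Iso F) : E.Hom F where
  toFun x := i.toEquiv x
  comm h _ _ e v := i.comm h e v
  continuous := i.continuous_toFun

/-- A fibrewise bijective morphism of bundles, as an isomorphism. -/
def IsBundle.isoOfBijective (hE : E.IsBundle) (hF : F.IsBundle) (φ : E.Hom F)
    (hφ : ∀ x, Function.Bijective (φ.toFun x)) : E.Iso F where
  toEquiv x := LinearEquiv.ofBijective (φ.toFun x) (hφ x)
  comm h _ _ e v := φ.comm h e v
  continuous_toFun := φ.continuous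
  continuous_invFun := hE.isLocallyTrivial.continuous_symm hF.isLocallyTrivial
    (fun x => LinearEquiv.ofBijective (φ.toFun x) (hφ x)) φ.continuous

end EqFamily

end Bundles

/-! ### The functor `Hom_A(V_τ, -)` -/

section HomBundles

variable {G : Type v} [Group G] [TopologicalSpace G] {A : Subgroup G} {X Y : GSpace.{u, v} G}
  (hX : X.TrivialOn A)

/-- The representation of `A` on the fibre `E_x`, for `A` acting trivially on the base. -/
def fibRep (E : EqFamily X) (x : X) : Representation ℂ A (E.Fib x) where
  toFun a := E.act (a : G) (hX a x)
  map_one' := LinearMap.ext fun v => E.act_one (hX 1 x) v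
  map_mul' a b := LinearMap.ext fun v =>
    E.act_mul (a : G) (b : G) (hX b x) (hX a x) (hX (a * b) x) v

section Average

variable (τ : IrrRep A) [Fintype A] [Invertible (Fintype.card A : ℂ)]

/-- The projection of `Hom(V_τ, E_x)` onto `Hom_A(V_τ, E_x)` given by averaging over `A`. -/
def homAverage (E : EqFamily X) (x : X) :
    ((Fin τ.d → ℂ) →ₗ[ℂ] E.Fib x) →ₗ[ℂ] homAFib hX τ E x :=
  let hom := (unitaryRep τ.ρ).linHom (fibRep hX E x)
  hom.averageMap.codRestrict (homAFib hX τ E x) fun f =>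
    ((Representation.mem_linHom_invariants_iff_isIntertwining (hom.averageMap f)).1
      (hom.averageMap_invariant f)).isIntertwining

theorem homAverage_apply (E : EqFamily X) (x : X) (f : (Fin τ.d → ℂ) →ₗ[ℂ] E.Fib x)
    (v : Fin τ.d → ℂ) : (homAverage hX τ E x f).1 v =
      ⅟(Fintype.card A : ℂ) • ∑ a : A, E.act (a : G) (hX a x) (f (unitaryRep τ.ρ a⁻¹ v)) := by
  change Representation.averageMap _ f v = _
  simp only [Representation.averageMap, GroupAlgebra.average, map_smul, map_sum,
    Representation.asAlgebraHom_of, LinearMap.smul_apply, LinearMap.sum_apply]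
  rfl

theorem homAverage_coe (E : EqFamily X) (x : X) (f : homAFib hX τ E x) :
    homAverage hX τ E x f = f :=
  Subtype.ext <| Representation.averageMap_id _ _ <|
    (Representation.mem_linHom_invariants_iff_isIntertwining _).2 ⟨f.2⟩

end Average

section Families

variable [DiscreteTopology G] [A.Normal] {τ : IrrRep A} (c : TwistChoice τ)

theorem isInducing_homA (E : EqFamily X) : IsInducing fun t : (homA c hX E).Tot =>
    ((t.proj : X), fun v : Fin τ.d → ℂ => (⟨t.proj, t.snd.1 v⟩ : E.Tot)) := ⟨rfl⟩

theorem continuous_homA_proj (E : EqFamily X) :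
    Continuous fun t : (homA c hX E).Tot => (t.proj : X) :=
  (isInducing_homA hX c E).continuous.fst

theorem continuous_homA_eval (E : EqFamily X) (v : Fin τ.d → ℂ) :
    Continuous fun t : (homA c hX E).Tot => (⟨t.proj, t.snd.1 v⟩ : E.Tot) :=
  (continuous_apply v).comp (isInducing_homA hX c E).continuous.snd

theorem continuous_homA_mk {Z : Type*} [TopologicalSpace Z] {E : EqFamily X}
    {g : Z → (homA c hX E).Tot} (hp : Continuous fun z => ((g z).proj : X))
    (hv : ∀ v : Fin τ.d → ℂ, Continuous fun z => (⟨(g z).proj, (g z).snd.1 v⟩ : E.Tot)) :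
    Continuous g :=
  (isInducing_homA hX c E).continuous_iff.2 (hp.prodMk (continuous_pi hv))

theorem isLocallyTrivial_homA [Finite A] {E : EqFamily X} (hE : E.IsBundle) :
    IsLocallyTrivial (homA c hX E).Fib := by
  have := Fintype.ofFinite A
  have : Invertible (Fintype.card A : ℂ) := invertibleOfNonzero (by simp)
  -- `Hom_A(V_τ, E)` is a retract of `E^d ≅ Hom(V_τ, E)`, by averaging.
  let Power (x : X) : Type u := Fin τ.d → E.Fib x
  let : TopologicalSpace (Bundle.TotalSpace Unit Power) :=
    sumTopology (fun _ => id) fun _ => id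
  have isInducing : IsInducing fun t : Bundle.TotalSpace Unit Power =>
      (t.proj, fun i => (⟨t.proj, t.snd i⟩ : E.Tot)) := ⟨rfl⟩
  have power : IsLocallyTrivial Power :=
    .pi (fun _ => hE.isLocallyTrivial) (fun _ => continuous_id) (fun _ => .refl ℂ _) isInducing
  let toPower (x : X) := ((Pi.basisFun ℂ (Fin τ.d)).constr ℂ (M' := E.Fib x)).symm.toLinearMap ∘ₗ
    (homAFib hX τ E x).subtype
  let ofPower (x : X) := homAverage hX τ E x ∘ₗ
    ((Pi.basisFun ℂ (Fin τ.d)).constr ℂ (M' := E.Fib x)).toLinearMap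
  let : TopologicalSpace (Bundle.TotalSpace Unit fun x : X => homAFib hX τ E x) :=
    (homA c hX E).top
  refine power.of_retract (Fib := fun x : X => homAFib hX τ E x) (j := toPower) (r := ofPower)
    ?_ ?_ fun x f => ?_
  · exact isInducing.continuous_iff.2 ((continuous_homA_proj hX c E).prodMk
      (continuous_pi fun i => continuous_homA_eval hX c E _))
  · have continuous_proj := isInducing.continuous.fst
    refine continuous_homA_mk hX c continuous_proj fun v => ?_
    simp only [ofPower, LinearMap.comp_apply, homAverage_apply, LinearEquiv.coe_coe,
      Module.Basis.constr_apply_fintype]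
    refine hE.isLocallyTrivial.continuous_smul continuous_const ?_
    refine hE.isLocallyTrivial.continuous_sum continuous_proj _ fun a => ?_
    refine hE.continuous_act_apply (a : G) (fun t : Bundle.TotalSpace Unit Power => hX a t.proj) ?_
    refine hE.isLocallyTrivial.continuous_sum continuous_proj _ fun i => ?_
    exact hE.isLocallyTrivial.continuous_smul continuous_const
      ((continuous_apply i).comp isInducing.continuous.snd)
  · simp [ofPower, toPower, homAverage_coe]

theorem continuous_homA_act {E : EqFamily X} (hE : E.IsBundle) :
    Continuous fun p : Ext c.cocycle × (homA c hX E).Tot =>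
      (⟨p.1 • p.2.proj, (homA c hX E).act p.1 rfl p.2.snd⟩ : (homA c hX E).Tot) := by
  refine continuous_homA_mk hX c ?_ fun v => ?_
  · exact continuous_fst.smul ((continuous_homA_proj hX c E).comp continuous_snd)
  · have continuous_act : Continuous fun p : τ.isotropy × (Circle × (homA c hX E).Tot) =>
        (⟨c.σ p.1 • (show X from p.2.2.proj), (p.2.1 : ℂ) • E.act (c.σ p.1) rfl
          (p.2.2.snd.1 (Matrix.toLin' ((c.M p.1)⁻¹).1 v))⟩ : E.Tot) :=
      continuous_prod_of_discrete_left.2 fun q =>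
        hE.isLocallyTrivial.continuous_smul (continuous_subtype_val.comp continuous_fst)
          (hE.continuous_act_apply (c.σ q) (fun _ => rfl)
            (p := fun p : Circle × (homA c hX E).Tot => (p.2.proj : X))
            ((continuous_homA_eval hX c E (Matrix.toLin' ((c.M q)⁻¹).1 v)).comp continuous_snd))
    have reassociate : Continuous fun p : Ext c.cocycle × (homA c hX E).Tot =>
        ((p.1.1, (p.1.2, p.2)) : τ.isotropy × (Circle × (homA c hX E).Tot)) :=
      (continuous_fst.comp continuous_fst).prodMk
        ((continuous_snd.comp continuous_fst).prodMk continuous_snd)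
    have mk_act_eq {x y : X} (u : E.Fib x) (p : Ext c.cocycle) (e : c.σ p.1 • x = y) :
        (⟨c.σ p.1 • x, (p.2 : ℂ) • E.act (c.σ p.1) rfl u⟩ : E.Tot) =
          ⟨y, (p.2 : ℂ) • E.act (c.σ p.1) e u⟩ := by
      subst e
      rfl
    exact (continuous_act.comp reassociate).congr fun p => mk_act_eq _ p.1 (c.σ_smul hX rfl)

theorem isBundle_homA [Finite A] {E : EqFamily X} (hE : E.IsBundle) : (homA c hX E).IsBundle :=
  EqFamily.isBundle_of_isLocallyTrivial (isLocallyTrivial_homA hX c hE)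
    (continuous_homA_act hX c hE)

/-- The map `Hom_A(V_τ, E_x) → Hom_A(V_τ, F_x)` induced by a morphism of families. -/
def homAFibMap {E F : EqFamily X} (φ : E.Hom F) (x : X) :
    homAFib hX τ E x →ₗ[ℂ] homAFib hX τ F x :=
  ((φ.toFun x).compRight ℂ).restrict fun f hf a v =>
    (congrArg (φ.toFun x) (hf a v)).trans (φ.comm (a : G) (hX a x) (f v))

/-- The morphism `Hom_A(V_τ, E) → Hom_A(V_τ, F)` induced by a morphism of families. -/
def homAMap {E F : EqFamily X} (φ : E.Hom F) : (homA c hX E).Hom (homA c hX F) where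
  toFun x := homAFibMap hX φ x
  comm p (_ y : X) e _ := Subtype.ext <| LinearMap.ext fun _ =>
    (map_smul (φ.toFun y) (p.2 : ℂ) _).trans
      (congrArg ((p.2 : ℂ) • ·) (φ.comm (c.σ p.1) (c.σ_smul hX e) _))
  continuous := continuous_homA_mk hX c (continuous_homA_proj hX c E) fun v =>
    φ.continuous.comp (continuous_homA_eval hX c E v)

/-- The isomorphism `Hom_A(V_τ, E_x) ≅ Hom_A(V_τ, F_x)` induced by an isomorphism of families. -/
def homAFibCongr {E F : EqFamily X} (i : E.Iso F) (x : X) :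
    homAFib hX τ E x ≃ₗ[ℂ] homAFib hX τ F x :=
  .ofLinearMap (homAFibMap hX i.hom x) (homAFibMap hX i.symm.hom x)
    (LinearMap.ext fun f => Subtype.ext (LinearMap.ext fun v =>
      (i.toEquiv x).apply_symm_apply (f.1 v)))
    (LinearMap.ext fun f => Subtype.ext (LinearMap.ext fun v =>
      (i.toEquiv x).symm_apply_apply (f.1 v)))

/-- The isomorphism `Hom_A(V_τ, E) ≅ Hom_A(V_τ, F)` induced by an isomorphism of families. -/
def homAIso {E F : EqFamily X} (i : E.Iso F) : (homA c hX E).Iso (homA c hX F) where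
  toEquiv x := homAFibCongr hX i x
  comm := (homAMap hX c i.hom).comm
  continuous_toFun := (homAMap hX c i.hom).continuous
  continuous_invFun := (homAMap hX c i.symm.hom).continuous

/-- `Hom_A(V_τ, E_x ⊕ F_x) = Hom_A(V_τ, E_x) ⊕ Hom_A(V_τ, F_x)`. -/
def homAFibSum (E F : EqFamily X) (x : X) :
    homAFib hX τ (E.sum F) x ≃ₗ[ℂ] homAFib hX τ E x × homAFib hX τ F x where
  toFun f := (⟨LinearMap.fst ℂ (E.Fib x) (F.Fib x) ∘ₗ f.1,
      fun a v => congrArg (fun w : E.Fib x × F.Fib x => w.1) (f.2 a v)⟩,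
    ⟨LinearMap.snd ℂ (E.Fib x) (F.Fib x) ∘ₗ f.1,
      fun a v => congrArg (fun w : E.Fib x × F.Fib x => w.2) (f.2 a v)⟩)
  invFun f := ⟨f.1.1.prod f.2.1, fun a v => Prod.ext (f.1.2 a v) (f.2.2 a v)⟩
  map_add' _ _ := rfl
  map_smul' _ _ := rfl
  left_inv _ := rfl
  right_inv _ := rfl

/-- `Hom_A(V_τ, -)` commutes with direct sums. -/
def homASum (E F : EqFamily X) :
    (homA c hX (E.sum F)).Iso ((homA c hX E).sum (homA c hX F)) where
  toEquiv x := homAFibSum hX E F x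
  comm _ _ _ _ _ := rfl
  continuous_toFun := EqFamily.continuous_sum_mk
    (continuous_homA_mk hX c (continuous_homA_proj hX c (E.sum F)) fun v =>
      (EqFamily.continuous_sum_fst E F).comp (continuous_homA_eval hX c (E.sum F) v))
    (continuous_homA_mk hX c (continuous_homA_proj hX c (E.sum F)) fun v =>
      (EqFamily.continuous_sum_snd E F).comp (continuous_homA_eval hX c (E.sum F) v))
  continuous_invFun := continuous_homA_mk hX c
    ((continuous_homA_proj hX c E).comp (EqFamily.continuous_sum_fst _ _)) fun v =>
    EqFamily.continuous_sum_mk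
      ((continuous_homA_eval hX c E v).comp (EqFamily.continuous_sum_fst _ _))
      ((continuous_homA_eval hX c F v).comp (EqFamily.continuous_sum_snd _ _))

/-- `Hom_A(V_τ, 0) = 0`. -/
def homAZero : (homA c hX (EqFamily.zero X)).Iso (EqFamily.zero _) where
  toEquiv _ :=
    { toFun := fun _ => PUnit.unit
      invFun := fun _ => 0
      map_add' := fun _ _ => rfl
      map_smul' := fun _ _ => rfl
      left_inv := fun _ => rfl
      right_inv := fun _ => rfl }
  comm _ _ _ _ _ := rfl
  continuous_toFun := continuous_induced_rng.2 (continuous_homA_proj hX c (EqFamily.zero X))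
  continuous_invFun := continuous_homA_mk hX c continuous_induced_dom fun _ =>
    continuous_induced_rng.2 continuous_induced_dom

/-- `Hom_A(V_τ, -)` commutes with pullbacks. -/
def homAPullback (hY : Y.TrivialOn A) (f : GMap X Y) (E : EqFamily Y) :
    (homA c hX (E.pullback f)).Iso ((homA c hY E).pullback
      ((f.res hX hY τ).comap (Ext.proj c.cocycle) (Ext.continuous_proj c.cocycle))) where
  toEquiv x := LinearEquiv.refl ℂ (homAFib hY τ E (f.toFun x))
  comm _ _ _ _ _ := rfl
  continuous_toFun := EqFamily.continuous_pullback_mk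
    (continuous_homA_proj hX c (E.pullback f))
    (continuous_homA_mk hY c (f.continuous.comp (continuous_homA_proj hX c (E.pullback f)))
      fun v => (EqFamily.continuous_pullback_lift f E).comp
        (continuous_homA_eval hX c (E.pullback f) v))
  continuous_invFun := continuous_homA_mk hX c (EqFamily.continuous_pullback_proj _ _) fun v =>
    EqFamily.continuous_pullback_mk (EqFamily.continuous_pullback_proj _ _)
      ((continuous_homA_eval hY c E v).comp (EqFamily.continuous_pullback_lift _ _))

/-- The map `[E] ↦ [Hom_A(V_τ, E)]` on isomorphism classes of bundles. -/
def homVec [Finite A] : Vec X →+ TwVec c.cocycle (X.res hX τ) where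
  toFun := Quotient.lift (fun E : EqBundle X => (⟨Vec.mk ⟨homA c hX E.fam,
      isBundle_homA hX c E.isBundle⟩, _, homA_isScalar c hX E.fam, rfl⟩ :
        TwVec c.cocycle (X.res hX τ)))
    (by rintro E F ⟨i⟩; exact Subtype.ext (Quotient.sound ⟨homAIso hX c i⟩))
  map_zero' := Subtype.ext (Quotient.sound ⟨homAZero hX c⟩)
  map_add' := by
    rintro ⟨E⟩ ⟨F⟩
    exact Subtype.ext (Quotient.sound ⟨homASum hX c E.fam F.fam⟩)

theorem homVec_map [Finite A] (hY : Y.TrivialOn A) (f : GMap X Y) (k : Vec Y) :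
    homVec hX c (Vec.map f k) = TwVec.map c.cocycle (f.res hX hY τ) (homVec hY c k) := by
  rcases k with ⟨E⟩
  exact Subtype.ext (Quotient.sound ⟨homAPullback hX c hY f E.fam⟩)

end Families

end HomBundles

/-! ### Schur's lemma -/

section Schur

open scoped TensorProduct

variable {A : Type v} [Group A] {F : Type*} [AddCommGroup F] [Module ℂ F]

/-- The map `F ⊗ V → V` given by contraction with a linear form on `F`. -/
def contraction (ℓ : Module.Dual ℂ F) (V : Type*) [AddCommGroup V] [Module ℂ V] :
    F ⊗[ℂ] V →ₗ[ℂ] V :=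
  (TensorProduct.lid ℂ V).toLinearMap ∘ₗ ℓ.rTensor V

theorem contraction_tmul (ℓ : Module.Dual ℂ F) {V : Type*} [AddCommGroup V] [Module ℂ V] (u : F)
    (v : V) : contraction ℓ V (u ⊗ₜ v) = ℓ u • v := by
  simp [contraction]

theorem contraction_apply {d : ℕ} (ℓ : Module.Dual ℂ F) (t : F ⊗[ℂ] (Fin d → ℂ)) (i : Fin d) :
    contraction ℓ (Fin d → ℂ) t i = ℓ (TensorProduct.piScalarRight ℂ ℂ F (Fin d) t i) := by
  induction t with
  | zero => simp
  | add s t hs ht => simp only [map_add, Pi.add_apply, hs, ht]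
  | tmul u v => simp [contraction_tmul, mul_comm]

theorem eq_of_contraction_eq {d : ℕ} {s t : F ⊗[ℂ] (Fin d → ℂ)}
    (h : ∀ ℓ, contraction ℓ (Fin d → ℂ) s = contraction ℓ (Fin d → ℂ) t) : s = t := by
  refine (TensorProduct.piScalarRight ℂ ℂ F (Fin d)).injective (funext fun i => ?_)
  refine sub_eq_zero.1 ((Module.forall_dual_apply_eq_zero_iff ℂ _).1 fun ℓ => ?_)
  rw [map_sub, ← contraction_apply, ← contraction_apply, h, sub_self]

variable {π τ : IrrRep A}

/-- The composition of an intertwining map `V_π → F ⊗ V_τ` with the contraction with a linear form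
on `F`. -/
def contract (f : (unitaryRep π.ρ).IntertwiningMap
    ((Representation.trivial ℂ A F).tprod (unitaryRep τ.ρ))) (ℓ : Module.Dual ℂ F) :
    (unitaryRep π.ρ).IntertwiningMap (unitaryRep τ.ρ) where
  toLinearMap := contraction ℓ (Fin τ.d → ℂ) ∘ₗ f.toLinearMap
  isIntertwining' a := by
    have contraction_map (t : F ⊗[ℂ] (Fin τ.d → ℂ)) :
        contraction ℓ _ ((Representation.trivial ℂ A F).tprod (unitaryRep τ.ρ) a t) =
          unitaryRep τ.ρ a (contraction ℓ _ t) := by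
      induction t with
      | zero => simp
      | add s t hs ht => simp only [map_add, hs, ht]
      | tmul u v => simp [contraction_tmul]
    exact LinearMap.ext fun v =>
      (congrArg _ congr($(f.isIntertwining' a) v)).trans (contraction_map _)

theorem irr_mk_eq_of_ne_zero {f : (unitaryRep π.ρ).IntertwiningMap
    ((Representation.trivial ℂ A F).tprod (unitaryRep τ.ρ))} (hf : f ≠ 0) :
    Irr.mk π = Irr.mk τ := by
  obtain ⟨ℓ, hℓ⟩ : ∃ ℓ, contract f ℓ ≠ 0 := by
    contrapose! hf
    exact DFunLike.ext _ _ fun v => eq_of_contraction_eq fun ℓ =>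
      congr($(hf ℓ) v).trans (map_zero _).symm
  have := π.irr
  have := τ.irr
  exact Quotient.sound ⟨(contract f ℓ).ofBijective
    ((Representation.IsIrreducible.bijective_or_eq_zero _).resolve_right hℓ)⟩

theorem exists_eq_tmul (f : (unitaryRep τ.ρ).IntertwiningMap
    ((Representation.trivial ℂ A F).tprod (unitaryRep τ.ρ))) :
    ∃ u : F, ∀ v, f v = u ⊗ₜ[ℂ] v := by
  let i₀ : Fin τ.d := ⟨0, τ.d_pos⟩
  let e₀ : Fin τ.d → ℂ := Pi.single i₀ 1
  refine ⟨TensorProduct.piScalarRight ℂ ℂ F (Fin τ.d) (f e₀) i₀, fun v =>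
    eq_of_contraction_eq fun ℓ => ?_⟩
  have := τ.irr
  obtain ⟨z, hz⟩ :=
    (Representation.IsIrreducible.algebraMap_intertwiningMap_bijective_of_isAlgClosed
      (ρ := unitaryRep τ.ρ)).2 (contract f ℓ)
  have contraction_eq (w : Fin τ.d → ℂ) : contraction ℓ _ (f w) = z • w := congr($hz.symm w)
  rw [contraction_tmul, ← contraction_apply, contraction_eq, contraction_eq]
  simp [e₀]

end Schur

/-! ### The projective extension of `τ` to `G_[τ]` -/

section Inertia

variable {G : Type v} [Group G] {A : Subgroup G} [A.Normal]

/-- The isotropy group `G_[τ]` of the class of `τ`, which contains `A`. -/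
abbrev IrrRep.inertia (τ : IrrRep A) : Subgroup G := MulAction.stabilizer G (Irr.mk τ)

theorem le_inertia (τ : IrrRep A) : A ≤ τ.inertia := by
  intro a ha
  let b : A := ⟨a, ha⟩
  -- `τ(b)` intertwines `τ.conj b` with `τ`.
  refine Quotient.sound ⟨.mk (LinearEquiv.ofLinearMap (unitaryRep τ.ρ b) (unitaryRep τ.ρ b⁻¹)
    ?_ ?_) fun x => ?_⟩
  · exact (map_mul (unitaryRep τ.ρ) b b⁻¹).symm.trans (by rw [mul_inv_cancel, map_one]; rfl)
  · exact (map_mul (unitaryRep τ.ρ) b⁻¹ b).symm.trans (by rw [inv_mul_cancel, map_one]; rfl)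
  · change unitaryRep τ.ρ b * unitaryRep τ.ρ (MulAut.conjNormal a⁻¹ x) =
      unitaryRep τ.ρ x * unitaryRep τ.ρ b
    rw [← map_mul, ← map_mul]
    congr 1
    ext
    simp [b, mul_assoc]

theorem exists_equiv_of_irr_mk_eq {π τ : IrrRep A} {g : G} (h : Irr.mk π = g • Irr.mk τ) :
    ∃ ε : (Fin π.d → ℂ) ≃ₗ[ℂ] (Fin τ.d → ℂ), ∀ a v,
      ε (unitaryRep π.ρ a v) = unitaryRep τ.ρ (MulAut.conjNormal g⁻¹ a) (ε v) := by
  obtain ⟨i⟩ : Nonempty ((unitaryRep π.ρ).Equiv (unitaryRep (τ.conj g).ρ)) := Quotient.exact h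
  exact ⟨i.toLinearEquiv, fun a v => congr($(i.isIntertwining' a) v)⟩

namespace TwistChoice

variable {τ : IrrRep A} (c : TwistChoice τ)

/-- The projection `G_[τ] → Q_[τ]`. -/
def cls (τ : IrrRep A) : τ.inertia →* τ.isotropy where
  toFun k := ⟨((k : G) : G ⧸ A), k, k.2, rfl⟩
  map_one' := rfl
  map_mul' _ _ := rfl

theorem cls_of_mem {k : τ.inertia} (hk : (k : G) ∈ A) : cls τ k = 1 :=
  Subtype.ext ((QuotientGroup.eq_one_iff _).2 hk)

theorem σ_mem (q : τ.isotropy) : c.σ q ∈ τ.inertia := by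
  obtain ⟨g, hg, h⟩ := q.2
  have mem : g⁻¹ * c.σ q ∈ A := QuotientGroup.eq.1 (h.trans (c.mk_σ q).symm)
  simpa only [mul_inv_cancel_left] using mul_mem hg (le_inertia τ mem)

/-- The element `σ(q)` of `G_[τ]`. -/
def rep (q : τ.isotropy) : τ.inertia := ⟨c.σ q, c.σ_mem q⟩

theorem cls_rep (q : τ.isotropy) : cls τ (c.rep q) = q := Subtype.ext (c.mk_σ q)

/-- The element `σ(q)⁻¹ k` of `A`, where `q` is the class of `k`. -/
def rem (k : τ.inertia) : A :=
  ⟨(c.σ (cls τ k))⁻¹ * k, QuotientGroup.eq.1 (c.mk_σ (cls τ k))⟩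

/-- The unitary matrix `M_q τ(σ(q)⁻¹ k)`, where `q` is the class of `k`: a projective extension of
`τ` to `G_[τ]`, with cocycle inverse to `α_τ`. -/
def R (k : τ.inertia) : Matrix.unitaryGroup (Fin τ.d) ℂ :=
  c.M (cls τ k) * τ.ρ (c.rem k)

theorem R_mul (k l : τ.inertia) :
    (c.α (cls τ k) (cls τ l) : ℂ) • ((c.R k).1 * (c.R l).1) = (c.R (k * l)).1 := by
  have rem_mul : c.rem (k * l) = c.χ (cls τ k) (cls τ l) *
      ((MulAut.conjNormal (c.σ (cls τ l))⁻¹ : MulAut A) (c.rem k) * c.rem l) := by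
    ext
    simp [χ, rem, mul_assoc]
  have R_mul_R : c.R k * c.R l = c.M (cls τ k) * c.M (cls τ l) *
      (τ.ρ (MulAut.conjNormal (c.σ (cls τ l))⁻¹ (c.rem k)) * τ.ρ (c.rem l)) := by
    simp only [R, mul_assoc]
    rw [← mul_assoc (τ.ρ (c.rem k)), c.ρ_mul_M, mul_assoc]
  have coe_R_mul_R := congrArg Subtype.val R_mul_R
  simp only [Submonoid.coe_mul] at coe_R_mul_R
  rw [coe_R_mul_R, ← smul_mul_assoc, c.α_mul, R, rem_mul]
  simp only [map_mul, Submonoid.coe_mul, mul_assoc]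

theorem R_of_mem {k : τ.inertia} (hk : (k : G) ∈ A) : c.R k = τ.ρ ⟨k, hk⟩ := by
  have rem_eq : c.rem k = ⟨k, hk⟩ := by
    ext
    simp [rem, cls_of_mem hk, c.σ_one]
  rw [R, cls_of_mem hk, rem_eq, c.M_one, one_mul]

theorem R_rep (q : τ.isotropy) : c.R (c.rep q) = c.M q := by
  have rem_eq : c.rem (c.rep q) = 1 := by
    ext
    change (c.σ (cls τ (c.rep q)))⁻¹ * c.σ q = 1
    rw [cls_rep, inv_mul_cancel]
  rw [R, cls_rep, rem_eq, map_one, mul_one]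

/-- The element `(q, 1)` of the central extension, where `q` is the class of `k`. -/
def lift (k : τ.inertia) : Ext c.cocycle := (cls τ k, 1)

theorem lift_of_mem {k : τ.inertia} (hk : (k : G) ∈ A) : c.lift k = 1 :=
  Prod.ext (cls_of_mem hk) rfl

theorem lift_mul_lift (k l : τ.inertia) :
    c.lift k * c.lift l = Ext.central c.cocycle (c.α (cls τ k) (cls τ l)) * c.lift (k * l) := by
  refine Prod.ext ((map_mul (cls τ) k l).symm.trans (one_mul _).symm) ?_
  change c.α (cls τ k) (cls τ l) * 1 * 1 =
    c.cocycle.toFun 1 (cls τ (k * l)) * c.α (cls τ k) (cls τ l) * 1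
  rw [c.cocycle.one_left, one_mul, mul_one]

theorem central_mul_lift_rep (p : Ext c.cocycle) :
    Ext.central c.cocycle p.2 * c.lift (c.rep p.1) = p := by
  refine Prod.ext ?_ ?_
  · change 1 * cls τ (c.rep p.1) = p.1
    rw [c.cls_rep, one_mul]
  · change c.cocycle.toFun 1 _ * p.2 * 1 = p.2
    rw [c.cocycle.one_left, one_mul, mul_one]

end TwistChoice

end Inertia

/-! ### The functor `F ↦ F ⊗ V_τ` -/

section Restriction

variable {G : Type v} [Group G] [TopologicalSpace G] {X : GSpace.{u, v} G}

/-- A `G`-space as an `S`-space, for a subgroup `S` of `G`. -/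
abbrev GSpace.restrict (X : GSpace.{u, v} G) (S : Subgroup G) : GSpace.{u, v} S :=
  X.comap S.subtype continuous_subtype_val

/-- A `G`-equivariant family as an `S`-equivariant family, for a subgroup `S` of `G`. -/
def EqFamily.restrict (E : EqFamily X) (S : Subgroup G) : EqFamily (X.restrict S) where
  Fib x := E.Fib x
  acg := E.acg
  mod := E.mod
  top := E.top
  act k _ _ e := E.act (k : G) e
  act_one e v := E.act_one e v
  act_mul k l _ _ _ exy eyz exz v := E.act_mul (k : G) (l : G) exy eyz exz v

end Restriction

section Tensor

open scoped TensorProduct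

variable {G : Type v} [Group G] [TopologicalSpace G] [DiscreteTopology G] {A : Subgroup G}
  [A.Normal] {τ : IrrRep A} (c : TwistChoice τ) {X : GSpace.{u, v} G} (hX : X.TrivialOn A)

namespace TwistChoice

/-- A point of `X` as a point of the space on which the central extension acts. -/
def pt (x : X) : (X.res hX τ).ext c.cocycle := x

theorem continuous_pt : Continuous (c.pt hX) := continuous_id

theorem central_smul (z : Circle) (x : X) :
    Ext.central c.cocycle z • c.pt hX x = c.pt hX x :=
  one_smul τ.isotropy (show X.res hX τ from x)

theorem lift_smul (k : τ.inertia) {x y : X} (e : (k : G) • x = y) :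
    c.lift k • c.pt hX x = c.pt hX y :=
  (GSpace.quot_smul hX (k : G) x).trans e

end TwistChoice

variable {F : EqFamily ((X.res hX τ).ext c.cocycle)}

variable (F) in
/-- The action of `k ∈ G_[τ]` on `F ⊗ V_τ`: by the element `(q, 1)` of the central extension on `F`,
where `q` is the class of `k`, and by `R(k)` on `V_τ`. -/
def tensorAct (k : τ.inertia) {x y : X} (e : (k : G) • x = y) :
    F.Fib (c.pt hX x) ⊗[ℂ] (Fin τ.d → ℂ) →ₗ[ℂ] F.Fib (c.pt hX y) ⊗[ℂ] (Fin τ.d → ℂ) :=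
  TensorProduct.map (F.act (c.lift k) (c.lift_smul hX k e)) (Matrix.toLin' (c.R k).1)

theorem tensorAct_tmul (k : τ.inertia) {x y : X} (e : (k : G) • x = y) (u : F.Fib (c.pt hX x))
    (v : Fin τ.d → ℂ) : tensorAct c hX F k e (u ⊗ₜ v) =
      F.act (c.lift k) (c.lift_smul hX k e) u ⊗ₜ Matrix.toLin' (c.R k).1 v :=
  TensorProduct.map_tmul _ _ u v

theorem tensorAct_of_mem {k : τ.inertia} (hk : (k : G) ∈ A) {x : X} (e : (k : G) • x = x) :
    tensorAct c hX F k e = (Representation.trivial ℂ A (F.Fib (c.pt hX x))).tprod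
      (unitaryRep τ.ρ) ⟨k, hk⟩ := by
  refine TensorProduct.ext' fun u v => ?_
  rw [tensorAct_tmul, c.R_of_mem hk, F.act_congr (c.lift_of_mem hk) _ (one_smul _ _), F.act_one]
  rfl

theorem tensorAct_one {x : X} (e : ((1 : τ.inertia) : G) • x = x)
    (t : F.Fib (c.pt hX x) ⊗[ℂ] (Fin τ.d → ℂ)) : tensorAct c hX F 1 e t = t := by
  rw [tensorAct_of_mem c hX A.one_mem]
  exact LinearMap.congr_fun (map_one ((Representation.trivial ℂ A (F.Fib (c.pt hX x))).tprod
    (unitaryRep τ.ρ))) t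

variable (hF : F.IsScalar)

include hF in
theorem act_central_mul_lift (z : Circle) (k : τ.inertia) {x y : X} (e : (k : G) • x = y)
    (e' : (Ext.central c.cocycle z * c.lift k) • c.pt hX x = c.pt hX y) (u : F.Fib (c.pt hX x)) :
    F.act (Ext.central c.cocycle z * c.lift k) e' u =
      (z : ℂ) • F.act (c.lift k) (c.lift_smul hX k e) u := by
  rw [F.act_mul _ _ (c.lift_smul hX k e) (c.central_smul hX z y) e', hF]

include hF in
theorem act_lift_lift (k l : τ.inertia) {x y z : X} (e : (l : G) • x = y) (e' : (k : G) • y = z)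
    (e'' : ((k * l : τ.inertia) : G) • x = z) (u : F.Fib (c.pt hX x)) :
    F.act (c.lift k) (c.lift_smul hX k e') (F.act (c.lift l) (c.lift_smul hX l e) u) =
      (c.α (TwistChoice.cls τ k) (TwistChoice.cls τ l) : ℂ) •
        F.act (c.lift (k * l)) (c.lift_smul hX (k * l) e'') u := by
  have e₁ : (c.lift k * c.lift l) • c.pt hX x = c.pt hX z := by
    rw [mul_smul, c.lift_smul hX l e, c.lift_smul hX k e']
  have e₂ := e₁
  rw [c.lift_mul_lift] at e₂
  rw [← F.act_mul _ _ _ _ e₁, F.act_congr (c.lift_mul_lift k l) e₁ e₂,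
    act_central_mul_lift c hX hF _ (k * l) e'']

include hF in
theorem act_tmul_eq (z : Circle) (q : τ.isotropy) {x y : X} (e : (c.rep q : G) • x = y)
    (e' : (Ext.central c.cocycle z * c.lift (c.rep q)) • c.pt hX x = c.pt hX y)
    (u : F.Fib (c.pt hX x)) (v : Fin τ.d → ℂ) :
    F.act (Ext.central c.cocycle z * c.lift (c.rep q)) e' u ⊗ₜ v =
      (z : ℂ) • tensorAct c hX F (c.rep q) e (u ⊗ₜ Matrix.toLin' (c.M q)⁻¹.1 v) := by
  have toLin'_R : Matrix.toLin' (c.R (c.rep q)).1 (Matrix.toLin' (c.M q)⁻¹.1 v) = v := by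
    rw [c.R_rep, ← LinearMap.comp_apply, ← Matrix.toLin'_mul, ← Submonoid.coe_mul, mul_inv_cancel]
    exact congr($Matrix.toLin'_one v)
  rw [tensorAct_tmul, toLin'_R, TensorProduct.smul_tmul', act_central_mul_lift c hX hF z _ e]

include hF in
theorem tensorAct_mul (k l : τ.inertia) {x y z : X} (e : (l : G) • x = y) (e' : (k : G) • y = z)
    (e'' : ((k * l : τ.inertia) : G) • x = z) (t : F.Fib (c.pt hX x) ⊗[ℂ] (Fin τ.d → ℂ)) :
    tensorAct c hX F (k * l) e'' t = tensorAct c hX F k e' (tensorAct c hX F l e t) := by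
  induction t with
  | zero => simp only [map_zero]
  | add s t hs ht => simp only [map_add, hs, ht]
  | tmul u v =>
    simp only [tensorAct_tmul, act_lift_lift c hX hF k l e e' e'', ← c.R_mul, map_smul,
      LinearMap.smul_apply, Matrix.toLin'_mul, LinearMap.comp_apply, TensorProduct.tmul_smul,
      TensorProduct.smul_tmul']

/-- The `G_[τ]`-equivariant family `F ⊗ V_τ`, where `k` acts by the element `(q, 1)` of the central
extension on `F` and by `R(k)` on `V_τ`. The projective factors `α_τ` and `α_τ⁻¹` cancel. -/
def tensor : EqFamily (X.restrict τ.inertia) where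
  Fib x := F.Fib (c.pt hX x) ⊗[ℂ] (Fin τ.d → ℂ)
  top := sumTopology (fun _ : Fin τ.d => c.pt hX)
    fun x => TensorProduct.piScalarRight ℂ ℂ (F.Fib (c.pt hX x)) (Fin τ.d)
  act k _ _ e := tensorAct c hX F k e
  act_one e t := tensorAct_one c hX e t
  act_mul k l _ _ _ e e' e'' t := tensorAct_mul c hX hF k l e e' e'' t

/-- The component of `t` at the `i`-th basis vector of `V_τ`. -/
def tensorCoord (i : Fin τ.d) {x : X} :
    F.Fib (c.pt hX x) ⊗[ℂ] (Fin τ.d → ℂ) →ₗ[ℂ] F.Fib (c.pt hX x) :=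
  LinearMap.proj i ∘ₗ
    (TensorProduct.piScalarRight ℂ ℂ (F.Fib (c.pt hX x)) (Fin τ.d)).toLinearMap

theorem tensorCoord_tmul (i : Fin τ.d) {x : X} (u : F.Fib (c.pt hX x)) (v : Fin τ.d → ℂ) :
    tensorCoord c hX i (u ⊗ₜ v) = v i • u := by
  simp [tensorCoord]

theorem sum_tensorCoord {x : X} (t : F.Fib (c.pt hX x) ⊗[ℂ] (Fin τ.d → ℂ)) :
    ∑ i, tensorCoord c hX i t ⊗ₜ Pi.single i 1 = t := by
  induction t with
  | zero => simp
  | add s t hs ht => simp only [map_add, TensorProduct.add_tmul, Finset.sum_add_distrib, hs, ht]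
  | tmul u v =>
    simp only [tensorCoord_tmul, TensorProduct.smul_tmul, ← TensorProduct.tmul_sum]
    congr 1
    exact (pi_eq_sum_univ' v).symm

theorem isInducing_tensor : IsInducing fun t : (tensor c hX hF).Tot =>
    ((t.proj : X), fun i : Fin τ.d =>
      (⟨c.pt hX t.proj, tensorCoord c hX i t.snd⟩ : F.Tot)) := ⟨rfl⟩

theorem continuous_tensor_proj : Continuous fun t : (tensor c hX hF).Tot => (t.proj : X) :=
  (isInducing_tensor c hX hF).continuous.fst

theorem continuous_tensorCoord (i : Fin τ.d) : Continuous fun t : (tensor c hX hF).Tot =>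
    (⟨c.pt hX t.proj, tensorCoord c hX i t.snd⟩ : F.Tot) :=
  (continuous_apply i).comp (isInducing_tensor c hX hF).continuous.snd

theorem continuous_tensor_mk {Z : Type*} [TopologicalSpace Z] {g : Z → (tensor c hX hF).Tot}
    (hp : Continuous fun z => ((g z).proj : X)) (hc : ∀ i : Fin τ.d, Continuous fun z =>
      (⟨c.pt hX (g z).proj, tensorCoord c hX i (g z).snd⟩ : F.Tot)) : Continuous g :=
  (isInducing_tensor c hX hF).continuous_iff.2 (hp.prodMk (continuous_pi hc))

theorem tensorCoord_tensorAct (k : τ.inertia) {x y : X} (e : (k : G) • x = y) (i : Fin τ.d)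
    (t : F.Fib (c.pt hX x) ⊗[ℂ] (Fin τ.d → ℂ)) : tensorCoord c hX i (tensorAct c hX F k e t) =
      ∑ l, (c.R k).1 i l •
        F.act (c.lift k) (c.lift_smul hX k e) (tensorCoord c hX l t) := by
  conv_lhs => rw [← sum_tensorCoord c hX t]
  simp [tensorAct_tmul, tensorCoord_tmul]

theorem continuous_act_tensor (hB : F.IsBundle) (k : τ.inertia) :
    Continuous fun t : (tensor c hX hF).Tot =>
      (⟨k • t.proj, (tensor c hX hF).act k rfl t.snd⟩ : (tensor c hX hF).Tot) := by
  have continuous_smul :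
      Continuous fun t : (tensor c hX hF).Tot => (k : G) • (show X from t.proj) :=
    (continuous_const_smul (k : G)).comp (continuous_tensor_proj c hX hF)
  refine continuous_tensor_mk c hX hF continuous_smul fun i => ?_
  have continuous_summand (l : Fin τ.d) := hB.isLocallyTrivial.continuous_smul
    (continuous_const (y := (c.R k).1 i l)) (hB.continuous_act_apply (c.lift k)
      (fun t => c.lift_smul hX k rfl) (continuous_tensorCoord c hX hF l))
  refine (hB.isLocallyTrivial.continuous_sum ((c.continuous_pt hX).comp continuous_smul)
    Finset.univ continuous_summand).congr fun t => ?_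
  exact congrArg (Bundle.TotalSpace.mk _) (tensorCoord_tensorAct c hX k rfl i t.snd).symm

theorem isBundle_tensor (hB : F.IsBundle) : (tensor c hX hF).IsBundle :=
  EqFamily.isBundle_of_isLocallyTrivial (.pi (fun _ => hB.isLocallyTrivial)
    (fun _ => c.continuous_pt hX) (fun x => TensorProduct.piScalarRight ℂ ℂ (F.Fib (c.pt hX x)) _)
    ⟨rfl⟩) (continuous_prod_of_discrete_left.2 (continuous_act_tensor c hX hF hB))

variable {E : EqFamily X}

/-- The linear map `F_x ⊗ V_τ → E_x`, `u ⊗ v ↦ ψ(u)(v)`. -/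
def tensorLiftFib (ψ : F.Hom (homA c hX E)) (x : X) :
    F.Fib (c.pt hX x) ⊗[ℂ] (Fin τ.d → ℂ) →ₗ[ℂ] E.Fib x :=
  TensorProduct.lift ((homAFib hX τ E x).subtype ∘ₗ ψ.toFun (c.pt hX x))

theorem tensorLiftFib_tmul (ψ : F.Hom (homA c hX E)) (x : X) (u : F.Fib (c.pt hX x))
    (v : Fin τ.d → ℂ) : tensorLiftFib c hX ψ x (u ⊗ₜ v) = (ψ.toFun (c.pt hX x) u).1 v :=
  TensorProduct.lift.tmul u v

theorem tensorLiftFib_eq_sum (ψ : F.Hom (homA c hX E)) (x : X)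
    (t : F.Fib (c.pt hX x) ⊗[ℂ] (Fin τ.d → ℂ)) : tensorLiftFib c hX ψ x t =
      (∑ i, (ψ.toFun (c.pt hX x) (tensorCoord c hX i t)).1 (Pi.single i 1) : E.Fib x) := by
  conv_lhs => rw [← sum_tensorCoord c hX t]
  exact (map_sum (tensorLiftFib c hX ψ x) _ _).trans
    (Finset.sum_congr rfl fun i _ => tensorLiftFib_tmul c hX ψ x _ _)

theorem tensorLiftFib_tensorAct (ψ : F.Hom (homA c hX E)) (k : τ.inertia) {x y : X}
    (e : (k : G) • x = y) (t : F.Fib (c.pt hX x) ⊗[ℂ] (Fin τ.d → ℂ)) :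
    tensorLiftFib c hX ψ y (tensorAct c hX F k e t) =
      E.act (k : G) e (tensorLiftFib c hX ψ x t) := by
  induction t with
  | zero => simp only [map_zero]
  | add s t hs ht => simp only [map_add, hs, ht]
  | tmul u v =>
    have toLin'_R : Matrix.toLin' (c.M (TwistChoice.cls τ k))⁻¹.1 (Matrix.toLin' (c.R k).1 v) =
        unitaryRep τ.ρ (c.rem k) v := by
      rw [← LinearMap.comp_apply, ← Matrix.toLin'_mul, ← Submonoid.coe_mul, TwistChoice.R,
        inv_mul_cancel_left]
      rfl
    let f : homAFib hX τ E x := ψ.toFun (c.pt hX x) u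
    have σ_smul : c.σ (TwistChoice.cls τ k) • x = y := c.σ_smul hX (c.lift_smul hX k e)
    have σ_mul_rem : c.σ (TwistChoice.cls τ k) * c.rem k = (k : G) := mul_inv_cancel_left _ _
    calc tensorLiftFib c hX ψ y (tensorAct c hX F k e (u ⊗ₜ v))
        = (homAAct c hX E (TwistChoice.cls τ k) 1 σ_smul f).1 (Matrix.toLin' (c.R k).1 v) := by
          rw [tensorAct_tmul, tensorLiftFib_tmul, ψ.comm]
          rfl
      _ = E.act (c.σ (TwistChoice.cls τ k)) σ_smul (f.1 (unitaryRep τ.ρ (c.rem k) v)) := by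
          rw [← toLin'_R]
          exact one_smul ℂ (E.act (c.σ (TwistChoice.cls τ k)) σ_smul _)
      _ = E.act (k : G) e (f.1 v) := by
          rw [f.2, ← E.act_mul _ _ (hX _ x) σ_smul (by rw [σ_mul_rem, e]),
            E.act_congr σ_mul_rem _ e]
      _ = E.act (k : G) e (tensorLiftFib c hX ψ x (u ⊗ₜ v)) :=
          congrArg (E.act (k : G) e) (tensorLiftFib_tmul c hX ψ x u v).symm

/-- The morphism `F ⊗ V_τ → E`, `u ⊗ v ↦ ψ(u)(v)`, adjoint to a morphism
`ψ : F → Hom_A(V_τ, E)`. -/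
def tensorLift (hE : E.IsBundle) (ψ : F.Hom (homA c hX E)) :
    (tensor c hX hF).Hom (E.restrict τ.inertia) where
  toFun x := tensorLiftFib c hX ψ x
  comm k _ _ e t := tensorLiftFib_tensorAct c hX ψ k e t
  continuous := by
    refine (hE.isLocallyTrivial.continuous_sum (continuous_tensor_proj c hX hF) Finset.univ
      fun i => (continuous_homA_eval hX c E (Pi.single i 1)).comp
        (ψ.continuous.comp (continuous_tensorCoord c hX hF i))).congr fun t => ?_
    exact congrArg (Bundle.TotalSpace.mk _) (tensorLiftFib_eq_sum c hX ψ t.proj t.snd).symm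

/-- The linear map `F_x → Hom_A(V_τ, E_x)`, `u ↦ θ(u ⊗ ·)`. -/
def tensorCurryFib (θ : (tensor c hX hF).Hom (E.restrict τ.inertia)) (x : X) :
    F.Fib (c.pt hX x) →ₗ[ℂ] homAFib hX τ E x :=
  let θ_x : F.Fib (c.pt hX x) ⊗[ℂ] (Fin τ.d → ℂ) →ₗ[ℂ] E.Fib x := θ.toFun x
  (TensorProduct.curry θ_x).codRestrict (homAFib hX τ E x) fun u a v => by
    let k : τ.inertia := ⟨a, le_inertia τ a.2⟩
    have act_tmul : tensorAct c hX F k (hX a x) (u ⊗ₜ v) = u ⊗ₜ unitaryRep τ.ρ a v := by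
      rw [tensorAct_of_mem c hX (k := k) a.2]
      rfl
    exact (congrArg θ_x act_tmul.symm).trans (θ.comm k (hX a x) (u ⊗ₜ v))

/-- The morphism `F → Hom_A(V_τ, E)`, `u ↦ θ(u ⊗ ·)`, adjoint to a morphism `θ : F ⊗ V_τ → E`. -/
def tensorCurry (hB : F.IsBundle) (θ : (tensor c hX hF).Hom (E.restrict τ.inertia)) :
    F.Hom (homA c hX E) where
  toFun x := tensorCurryFib c hX hF θ x
  comm p (x : X) (y : X) e u := by
    have σ_smul : c.σ p.1 • x = y := c.σ_smul hX e
    refine Subtype.ext (LinearMap.ext fun v => ?_)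
    let θ_y : F.Fib (c.pt hX y) ⊗[ℂ] (Fin τ.d → ℂ) →ₗ[ℂ] E.Fib y := θ.toFun y
    let w : F.Fib (c.pt hX x) ⊗[ℂ] (Fin τ.d → ℂ) := u ⊗ₜ Matrix.toLin' (c.M p.1)⁻¹.1 v
    let u_y : F.Fib (c.pt hX y) := F.act p e u
    have p_eq : p = Ext.central c.cocycle p.2 * c.lift (c.rep p.1) :=
      (c.central_mul_lift_rep p).symm
    have act_tmul : u_y ⊗ₜ v = (p.2 : ℂ) • tensorAct c hX F (c.rep p.1) σ_smul w :=
      (congrArg (fun s : F.Fib (c.pt hX y) => s ⊗ₜ[ℂ] v) (F.act_congr p_eq e (p_eq ▸ e) u)).trans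
        (act_tmul_eq c hX hF p.2 p.1 σ_smul _ u v)
    calc (tensorCurryFib c hX hF θ y u_y).1 v
        = θ_y ((p.2 : ℂ) • tensorAct c hX F (c.rep p.1) σ_smul w) := congrArg θ_y act_tmul
      _ = (p.2 : ℂ) • θ_y (tensorAct c hX F (c.rep p.1) σ_smul w) := map_smul θ_y (p.2 : ℂ) _
      _ = ((homA c hX E).act p e (tensorCurryFib c hX hF θ x u)).1 v :=
          congrArg ((p.2 : ℂ) • ·) (θ.comm (c.rep p.1) σ_smul w)
  continuous := by
    refine continuous_homA_mk hX c hB.continuous_proj fun v => ?_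
    have continuous_tmul : Continuous fun t : F.Tot =>
        (⟨t.proj, t.snd ⊗ₜ v⟩ : (tensor c hX hF).Tot) := by
      refine continuous_tensor_mk c hX hF hB.continuous_proj fun i => ?_
      refine (hB.isLocallyTrivial.continuous_smul (continuous_const (y := v i))
        continuous_id).congr fun t => ?_
      exact congrArg (Bundle.TotalSpace.mk _) (tensorCoord_tmul c hX i t.snd v).symm
    exact θ.continuous.comp continuous_tmul

end Tensor

/-! ### Induction -/

section CosetIndex

variable {G : Type v} [Group G]

/-- A finite transitive `G`-set with a base point of stabiliser `S`, together with elements `t j`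
moving the base point to `j`. The index set lies in `Type`, so that finite products over it stay in
the universe of the fibres. -/
structure CosetIndex (S : Subgroup G) where
  J : Type
  [fintype : Fintype J]
  [decEq : DecidableEq J]
  [act : MulAction G J]
  base : J
  t : J → G
  t_smul : ∀ j, t j • base = j
  stab : ∀ g : G, g • base = base ↔ g ∈ S

attribute [instance] CosetIndex.fintype CosetIndex.decEq CosetIndex.act

theorem nonempty_cosetIndex (S : Subgroup G) [S.FiniteIndex] : Nonempty (CosetIndex S) := by
  let e : Fin (Nat.card (G ⧸ S)) ≃ G ⧸ S := (Finite.equivFin _).symm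
  let act : MulAction G (Fin (Nat.card (G ⧸ S))) := e.mulAction G
  have smul_base (g : G) : g • e.symm ((1 : G) : G ⧸ S) = e.symm (g : G ⧸ S) := by
    change e.symm (g • e (e.symm _)) = _
    rw [e.apply_symm_apply, MulAction.Quotient.smul_coe, smul_eq_mul, mul_one]
  refine ⟨{ J := Fin (Nat.card (G ⧸ S)), base := e.symm ((1 : G) : G ⧸ S),
            t := fun j => (e j).out, t_smul := fun j => ?_, stab := fun g => ?_ }⟩
  · rw [smul_base, QuotientGroup.out_eq', e.symm_apply_apply]
  · rw [smul_base, e.symm.injective.eq_iff, eq_comm, QuotientGroup.eq, inv_one, one_mul]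

namespace CosetIndex

variable {S : Subgroup G} (I : CosetIndex S)

theorem t_mem_iff (j : I.J) : I.t j ∈ S ↔ j = I.base := by
  rw [← I.stab, I.t_smul]

/-- The element `t(base)` of `S`. -/
def tBase : S := ⟨I.t I.base, (I.t_mem_iff _).2 rfl⟩

/-- The element `t(j)⁻¹ g t(g⁻¹ j)` of `S`. -/
def k (g : G) (j : I.J) : S :=
  ⟨(I.t j)⁻¹ * g * I.t (g⁻¹ • j), by
    rw [← I.stab, mul_smul, mul_smul, I.t_smul, smul_inv_smul, inv_smul_eq_iff, I.t_smul]⟩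

theorem t_mul_k (g : G) (j : I.J) : I.t j * I.k g j = g * I.t (g⁻¹ • j) := by
  simp [k, mul_assoc]

theorem t_base_mul_tBase_inv : I.t I.base * (I.tBase⁻¹ : S) = 1 := mul_inv_cancel (I.t I.base)

theorem t_base_mul_conj (k : S) :
    I.t I.base * (I.tBase⁻¹ * k * I.tBase : S) = k * I.t I.base := by
  simp [tBase, mul_assoc]

end CosetIndex

end CosetIndex

section Induction

variable {G : Type v} [Group G] [TopologicalSpace G] {S : Subgroup G} (I : CosetIndex S)
  {X : GSpace.{u, v} G} (D : EqFamily (X.restrict S))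

namespace CosetIndex

variable (X) in
/-- The point `t(j)⁻¹ x`, as a point of `X` with the action of `S`. -/
def pt (j : I.J) (x : X) : X.restrict S := (I.t j)⁻¹ • x

theorem continuous_pt (j : I.J) : Continuous (I.pt X j) := continuous_const_smul (I.t j)⁻¹

theorem t_smul_pt (j : I.J) (x : X) : I.t j • (show X from I.pt X j x) = x :=
  smul_inv_smul (I.t j) x

theorem smul_pt {k : S} {g : G} {j j' : I.J} (hk : I.t j * k = g * I.t j') {x y : X}
    (e : g • x = y) : k • I.pt X j' x = I.pt X j y := by
  change (k : G) • (I.t j')⁻¹ • x = (I.t j)⁻¹ • y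
  rw [eq_inv_smul_iff, ← mul_smul, hk, mul_smul, smul_inv_smul, e]

end CosetIndex

/-- The action of `g` on the induced family: the component of `g s` at `j` comes from the
component of `s` at `g⁻¹ j`. -/
def indAct (g : G) {x y : X} (e : g • x = y) :
    (∀ j, D.Fib (I.pt X j x)) →ₗ[ℂ] ∀ j, D.Fib (I.pt X j y) :=
  LinearMap.pi fun j => D.act (I.k g j) (I.smul_pt (I.t_mul_k g j) e) ∘ₗ LinearMap.proj (g⁻¹ • j)

theorem indAct_apply {k : S} {g : G} {j j' : I.J} (hk : I.t j * k = g * I.t j') {x y : X}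
    (e : g • x = y) (s : ∀ j, D.Fib (I.pt X j x)) :
    indAct I D g e s j = D.act k (I.smul_pt hk e) (s j') := by
  obtain rfl : j' = g⁻¹ • j := by
    rw [eq_inv_smul_iff, ← I.t_smul j', ← mul_smul, ← hk, mul_smul, (I.stab k).2 k.2, I.t_smul]
  exact D.act_congr (Subtype.ext (mul_left_cancel ((I.t_mul_k g j).trans hk.symm))) _ _ _

/-- The `G`-equivariant family induced from the `S`-equivariant family `D`. -/
def ind : EqFamily X where
  Fib x := ∀ j, D.Fib (I.pt X j x)
  top := sumTopology (I.pt X) fun _ s => s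
  act g _ _ e := indAct I D g e
  act_one e s := funext fun j =>
    (indAct_apply I D (k := 1) (by simp) e s).trans (D.act_one _ (s j))
  act_mul g h x y z hxy hyz hxz s := funext fun j => by
    have t_mul : I.t j * (I.k g j * I.k h (g⁻¹ • j) : S) = g * h * I.t (h⁻¹ • g⁻¹ • j) := by
      rw [Subgroup.coe_mul, ← mul_assoc, I.t_mul_k, mul_assoc, I.t_mul_k, mul_assoc]
    rw [indAct_apply I D t_mul hxz s]
    exact D.act_mul _ _ _ _ _ _

theorem isInducing_ind : IsInducing fun t : (ind I D).Tot =>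
    (t.proj, fun j => (⟨I.pt X j t.proj, t.snd j⟩ : D.Tot)) := ⟨rfl⟩

theorem continuous_ind_proj : Continuous fun t : (ind I D).Tot => t.proj :=
  (isInducing_ind I D).continuous.fst

theorem continuous_ind_apply (j : I.J) :
    Continuous fun t : (ind I D).Tot => (⟨I.pt X j t.proj, t.snd j⟩ : D.Tot) :=
  (continuous_apply j).comp (isInducing_ind I D).continuous.snd

theorem continuous_ind_mk {Z : Type*} [TopologicalSpace Z] {g : Z → (ind I D).Tot}
    (hp : Continuous fun z => (g z).proj)
    (hc : ∀ j, Continuous fun z => (⟨I.pt X j (g z).proj, (g z).snd j⟩ : D.Tot)) : Continuous g :=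
  (isInducing_ind I D).continuous_iff.2 (hp.prodMk (continuous_pi hc))

variable {D}

theorem isBundle_ind [DiscreteTopology G] (hD : D.IsBundle) : (ind I D).IsBundle := by
  refine EqFamily.isBundle_of_isLocallyTrivial (.pi (fun _ => hD.isLocallyTrivial)
    I.continuous_pt (fun x => LinearEquiv.refl ℂ (∀ j, D.Fib (I.pt X j x))) ⟨rfl⟩)
    (continuous_prod_of_discrete_left.2 fun g => ?_)
  exact continuous_ind_mk I D ((continuous_ind_proj I D).const_smul g) fun j =>
    hD.continuous_act_apply (I.k g j) (fun t => I.smul_pt (I.t_mul_k g j) rfl)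
      (continuous_ind_apply I D (g⁻¹ • j))

theorem tBase_inv_smul (x : X.restrict S) : I.tBase⁻¹ • x = I.pt X I.base x := rfl

variable (D) in
/-- The inclusion of the fibre of `D` at `x` into the fibre at `x` of the induced family, with image
the component at the base point. -/
def indUnitFib (x : X.restrict S) : D.Fib x →ₗ[ℂ] ∀ j, D.Fib (I.pt X j x) :=
  LinearMap.single ℂ (fun j => D.Fib (I.pt X j x)) I.base ∘ₗ D.act I.tBase⁻¹ (tBase_inv_smul I x)

theorem indUnitFib_base (x : X.restrict S) (v : D.Fib x) :
    indUnitFib I D x v I.base = D.act I.tBase⁻¹ (tBase_inv_smul I x) v :=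
  Pi.single_eq_same _ _

theorem indUnitFib_of_ne (x : X.restrict S) (v : D.Fib x) {j : I.J} (hj : j ≠ I.base) :
    indUnitFib I D x v j = 0 :=
  Pi.single_eq_of_ne hj _

theorem tBase_smul (x : X.restrict S) : I.tBase • I.pt X I.base x = x := smul_inv_smul I.tBase x

variable (D) in
/-- The projection of the fibre at `x` of the induced family onto the component at the base point,
identified with the fibre of `D` at `x`. -/
def indEvalFib (x : X.restrict S) : (∀ j, D.Fib (I.pt X j x)) →ₗ[ℂ] D.Fib x :=
  D.act I.tBase (tBase_smul I x) ∘ₗ LinearMap.proj I.base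

theorem indEvalFib_indUnitFib (x : X.restrict S) (v : D.Fib x) :
    indEvalFib I D x (indUnitFib I D x v) = v :=
  (congrArg (D.act _ _) (indUnitFib_base I x v)).trans
    (D.act_act_of_mul_eq_one (mul_inv_cancel I.tBase) _ _ v)

theorem indEvalFib_indAct (k : S) {x y : X.restrict S} (e : k • x = y)
    (s : ∀ j, D.Fib (I.pt X j x)) :
    indEvalFib I D y (indAct I D (k : G) e s) = D.act k e (indEvalFib I D x s) :=
  (congrArg (D.act _ _) (indAct_apply I D (I.t_base_mul_conj k) e s)).trans
    (D.act_act_eq (by group) _ _ _ _ _)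

theorem eq_indUnitFib {x : X.restrict S} {s : ∀ j, D.Fib (I.pt X j x)}
    (hs : ∀ j ≠ I.base, s j = 0) : s = indUnitFib I D x (indEvalFib I D x s) := by
  funext j
  obtain rfl | hj := eq_or_ne j I.base
  · exact ((indUnitFib_base I x _).trans
      (D.act_act_of_mul_eq_one (inv_mul_cancel I.tBase) _ _ _)).symm
  · exact (hs j hj).trans (indUnitFib_of_ne I x _ hj).symm

/-- The morphism from `D` to the family induced from it. -/
def indUnit (hD : D.IsBundle) : D.Hom ((ind I D).restrict S) where
  toFun x := indUnitFib I D x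
  comm k x y e v := by
    change indUnitFib I D y (D.act k e v) = indAct I D (k : G) e (indUnitFib I D x v)
    funext j
    obtain rfl | hj := eq_or_ne j I.base
    · refine (indUnitFib_base I y (D.act k e v)).trans (Eq.symm ?_)
      refine (indAct_apply I D (I.t_base_mul_conj k) e _).trans ?_
      refine (congrArg (D.act _ _) (indUnitFib_base I x v)).trans ?_
      exact D.act_act_eq (by group) _ _ _ _ _
    · have hkj : (k : G)⁻¹ • j ≠ I.base := fun h => hj <| by
        rw [← (I.stab k).2 k.2, ← h, smul_inv_smul]
      refine (indUnitFib_of_ne I y (D.act k e v) hj).trans (Eq.symm ?_)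
      exact (congrArg (D.act _ _) (indUnitFib_of_ne I x v hkj)).trans (map_zero _)
  continuous := continuous_ind_mk I D hD.continuous_proj fun j => by
    obtain rfl | hj := eq_or_ne j I.base
    · have h : Continuous fun t : D.Tot => (⟨_, D.act I.tBase⁻¹ rfl t.snd⟩ : D.Tot) :=
        hD.continuous_act_apply _ (fun _ => rfl) continuous_id
      exact h.congr fun t => congrArg (Bundle.TotalSpace.mk _) (indUnitFib_base I t.proj t.snd).symm
    · exact (hD.isLocallyTrivial.continuous_zero ((I.continuous_pt j).comp
        hD.continuous_proj)).congr fun t =>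
          congrArg (Bundle.TotalSpace.mk _) (indUnitFib_of_ne I t.proj t.snd hj).symm

variable {E : EqFamily X}

/-- The map `D → E_x`, `s ↦ t(j) φ(s)`, on the fibre of `D` at `t(j)⁻¹ x`. -/
def transport (φ : D.Hom (E.restrict S)) (x : X) (j : I.J) : D.Fib (I.pt X j x) →ₗ[ℂ] E.Fib x :=
  E.act (I.t j) (I.t_smul_pt j x) ∘ₗ φ.toFun (I.pt X j x)

theorem transport_act (φ : D.Hom (E.restrict S)) {k : S} {g : G} {j j' : I.J}
    (hk : I.t j * k = g * I.t j') {x y : X} (e : g • x = y) (s : D.Fib (I.pt X j' x)) :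
    transport I φ y j (D.act k (I.smul_pt hk e) s) = E.act g e (transport I φ x j' s) :=
  (congrArg (E.act _ _) (φ.comm k (I.smul_pt hk e) s)).trans (E.act_act_eq hk _ _ _ _ _)

theorem transport_tBase_inv (φ : D.Hom (E.restrict S)) (x : X) (v : D.Fib x) :
    transport I φ x I.base (D.act I.tBase⁻¹ (tBase_inv_smul I x) v) = φ.toFun x v :=
  (congrArg (E.act _ _) (φ.comm I.tBase⁻¹ (tBase_inv_smul I x) v)).trans
    (E.act_act_of_mul_eq_one I.t_base_mul_tBase_inv _ _ _)

/-- The linear map `(ind D)_x → E_x` with components `t(j) ∘ φ`. -/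
def indLiftFib (φ : D.Hom (E.restrict S)) (x : X) : (∀ j, D.Fib (I.pt X j x)) →ₗ[ℂ] E.Fib x :=
  ∑ j, transport I φ x j ∘ₗ LinearMap.proj j

theorem indLiftFib_apply (φ : D.Hom (E.restrict S)) (x : X) (s : ∀ j, D.Fib (I.pt X j x)) :
    indLiftFib I φ x s = ∑ j, transport I φ x j (s j) :=
  LinearMap.sum_apply _ _ _

theorem indLiftFib_indUnitFib (φ : D.Hom (E.restrict S)) (x : X) (v : D.Fib x) :
    indLiftFib I φ x (indUnitFib I D x v) = φ.toFun x v := by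
  rw [indLiftFib_apply, Finset.sum_eq_single I.base]
  · exact (congrArg _ (indUnitFib_base I x v)).trans (transport_tBase_inv I φ x v)
  · exact fun j _ hj => (congrArg _ (indUnitFib_of_ne I x v hj)).trans (map_zero _)
  · exact fun h => absurd (Finset.mem_univ _) h

theorem indLiftFib_indAct (φ : D.Hom (E.restrict S)) (g : G) {x y : X} (e : g • x = y)
    (s : ∀ j, D.Fib (I.pt X j x)) :
    indLiftFib I φ y (indAct I D g e s) = E.act g e (indLiftFib I φ x s) := by
  rw [indLiftFib_apply, indLiftFib_apply, map_sum, ← Equiv.sum_comp (MulAction.toPerm g)]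
  refine Finset.sum_congr rfl fun j _ => ?_
  have t_mul : I.t (g • j) * I.k g (g • j) = g * I.t j := by
    rw [I.t_mul_k, inv_smul_smul]
  exact (congrArg _ (indAct_apply I D t_mul e s)).trans (transport_act I φ t_mul e (s j))

/-- The morphism `ind D → E` adjoint to a morphism `D → E` of `S`-equivariant families. -/
def indLift (hE : E.IsBundle) (φ : D.Hom (E.restrict S)) : (ind I D).Hom E where
  toFun x := indLiftFib I φ x
  comm g _ _ e s := indLiftFib_indAct I φ g e s
  continuous := by
    have continuous_transport (j : I.J) :
        Continuous fun t : (ind I D).Tot => (⟨t.proj, transport I φ t.proj j (t.snd j)⟩ : E.Tot) :=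
      hE.continuous_act_apply (I.t j) (fun t : (ind I D).Tot => I.t_smul_pt j t.proj)
        (φ.continuous.comp (continuous_ind_apply I D j))
    refine (hE.isLocallyTrivial.continuous_sum (continuous_ind_proj I D) Finset.univ
      continuous_transport).congr fun t => ?_
    exact congrArg (Bundle.TotalSpace.mk _) (indLiftFib_apply I φ t.proj t.snd).symm

end Induction

/-! ### Detecting isomorphisms -/

section Detection

variable {G : Type v} [Group G] [TopologicalSpace G] {A : Subgroup G} [A.Normal]
  {X : GSpace.{u, v} G} (hX : X.TrivialOn A)

/-- For an isomorphism `V_π ≅ gV_τ`, the bijection of `Hom_A(V_τ, E_y)` with `Hom_A(V_π, E_{gy})`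
given by the action of `g` on `E`. -/
def homTranslate {π τ : IrrRep A} {g : G} (ε : (Fin π.d → ℂ) ≃ₗ[ℂ] (Fin τ.d → ℂ))
    (hε : ∀ a v, ε (unitaryRep π.ρ a v) = unitaryRep τ.ρ (MulAut.conjNormal g⁻¹ a) (ε v))
    (E : EqFamily X) {x y : X} (e : g • y = x) :
    homAFib hX τ E y ≃ (unitaryRep π.ρ).IntertwiningMap (fibRep hX E x) where
  toFun f :=
    { toLinearMap := E.act g e ∘ₗ f.1 ∘ₗ ε
      isIntertwining' := fun a => LinearMap.ext fun v => by
        change E.act g e (f.1 (ε (unitaryRep π.ρ a v))) = E.act a (hX a x) (E.act g e (f.1 (ε v)))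
        rw [hε, f.2]
        exact E.act_act_eq (by simp [mul_assoc]) _ _ _ _ _ }
  invFun f := ⟨E.act g⁻¹ (inv_smul_eq_iff.2 e.symm) ∘ₗ f.toLinearMap ∘ₗ ε.symm, fun a v => by
    have conj_conj : (MulAut.conjNormal g⁻¹ : MulAut A) (MulAut.conjNormal g a) = a := by
      ext; simp
    have symm_smul : ε.symm (unitaryRep τ.ρ a v) =
        unitaryRep π.ρ (MulAut.conjNormal g a) (ε.symm v) := by
      rw [LinearEquiv.symm_apply_eq, hε, conj_conj, LinearEquiv.apply_symm_apply]
    change E.act g⁻¹ _ (f (ε.symm (unitaryRep τ.ρ a v))) =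
      E.act a (hX a y) (E.act g⁻¹ _ (f (ε.symm v)))
    rw [symm_smul]
    refine (congrArg (E.act g⁻¹ _)
      congr($(f.isIntertwining' (MulAut.conjNormal g a)) (ε.symm v))).trans ?_
    exact E.act_act_eq (by simp [mul_assoc]) _ _ _ _ _⟩
  left_inv f := Subtype.ext <| LinearMap.ext fun v =>
    (E.act_act_of_mul_eq_one (inv_mul_cancel g) _ _ _).trans
      (congrArg f.1 (ε.apply_symm_apply v))
  right_inv f := DFunLike.ext _ _ fun v =>
    (E.act_act_of_mul_eq_one (mul_inv_cancel g) _ _ _).trans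
      (congrArg f (ε.symm_apply_apply v))

/-- Every irreducible representation of `A` is conjugate to one of the `τ_o`. -/
def MeetsAllOrbits {O : Type*} (τ : O → IrrRep A) : Prop :=
  ∀ π : IrrRep A, ∃ (o : O) (g : G), Irr.mk π = g • Irr.mk (τ o)

theorem bijective_of_homAFibMap [Finite A] {O : Type*} {τ : O → IrrRep A}
    (hτ : MeetsAllOrbits τ) {E E' : EqFamily X} (hE : E.IsBundle) (hE' : E'.IsBundle)
    (φ : E.Hom E') (hφ : ∀ o x, Function.Bijective (homAFibMap hX (τ := τ o) φ x)) (x : X) :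
    Function.Bijective (φ.toFun x) := by
  have := hE.isLocallyTrivial.finiteDimensional x
  have := hE'.isLocallyTrivial.finiteDimensional x
  let Φ : (fibRep hX E x).IntertwiningMap (fibRep hX E' x) :=
    { toLinearMap := φ.toFun x
      isIntertwining' := fun a => LinearMap.ext fun v => φ.comm (a : G) (hX a x) v }
  refine bijective_of_bijective_comp Φ fun π => ?_
  obtain ⟨o, g, hg⟩ := hτ π
  obtain ⟨ε, hε⟩ := exists_equiv_of_irr_mk_eq hg
  have e : g • g⁻¹ • x = x := smul_inv_smul g x
  have naturality : (fun f : (unitaryRep π.ρ).IntertwiningMap (fibRep hX E x) => Φ.comp f) ∘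
      homTranslate hX ε hε E e = homTranslate hX ε hε E' e ∘ homAFibMap hX φ (g⁻¹ • x) :=
    funext fun f => DFunLike.ext _ _ fun v => φ.comm g e _
  refine ((homTranslate hX ε hε E e).bijective.of_comp_iff _).1 ?_
  rw [naturality]
  exact (homTranslate hX ε hε E' e).bijective.comp (hφ o _)

end Detection

/-! ### The inverse construction -/

section Sums

variable {H : Type v} [Group H] [TopologicalSpace H] {X : GSpace.{u, v} H} {O : Type}

namespace EqFamily

/-- The direct sum of finitely many equivariant families. -/
def pi (E : O → EqFamily X) : EqFamily X where
  Fib x := ∀ o, (E o).Fib x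
  top := sumTopology (fun _ => id) fun _ s => s
  act h _ _ e := LinearMap.piMap fun o => (E o).act h e
  act_one e s := funext fun o => (E o).act_one e (s o)
  act_mul g h _ _ _ hxy hyz hxz s := funext fun o => (E o).act_mul g h hxy hyz hxz (s o)

variable (E : O → EqFamily X)

theorem isInducing_pi : IsInducing fun t : (pi E).Tot =>
    (t.proj, fun o => (⟨t.proj, t.snd o⟩ : (E o).Tot)) := ⟨rfl⟩

theorem continuous_pi_proj : Continuous fun t : (pi E).Tot => t.proj :=
  (isInducing_pi E).continuous.fst

theorem continuous_pi_apply (o : O) :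
    Continuous fun t : (pi E).Tot => (⟨t.proj, t.snd o⟩ : (E o).Tot) :=
  (continuous_apply o).comp (isInducing_pi E).continuous.snd

theorem continuous_pi_mk {Z : Type*} [TopologicalSpace Z] {g : Z → (pi E).Tot}
    (hp : Continuous fun z => (g z).proj)
    (hc : ∀ o, Continuous fun z => (⟨(g z).proj, (g z).snd o⟩ : (E o).Tot)) : Continuous g :=
  (isInducing_pi E).continuous_iff.2 (hp.prodMk (continuous_pi hc))

variable {E}

theorem isBundle_pi [Finite O] (hE : ∀ o, (E o).IsBundle) : (pi E).IsBundle :=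
  isBundle_of_isLocallyTrivial (.pi (fun o => (hE o).isLocallyTrivial) (fun _ => continuous_id)
    (fun x => LinearEquiv.refl ℂ (∀ o, (E o).Fib x)) ⟨rfl⟩) <|
    continuous_pi_mk E (continuous_fst.smul ((continuous_pi_proj E).comp continuous_snd))
      fun o => (hE o).continuous_act.comp
        (continuous_fst.prodMk ((continuous_pi_apply E o).comp continuous_snd))

variable (E) in
/-- The projection of a direct sum onto a summand. -/
def piProj (o : O) : (pi E).Hom (E o) where
  toFun _ := LinearMap.proj o
  comm _ _ _ _ _ := rfl
  continuous := continuous_pi_apply E o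

/-- The inclusion of a summand into a direct sum. -/
def piSingle [DecidableEq O] (hE : ∀ o, (E o).IsBundle) (o : O) : (E o).Hom (pi E) where
  toFun x := LinearMap.single ℂ (fun o => (E o).Fib x) o
  comm h x y e v := Eq.symm <| funext fun o' =>
    Pi.apply_single (fun o => (E o).act h e) (fun _ => map_zero _) o v o'
  continuous := continuous_pi_mk E (hE o).continuous_proj fun o' => by
    obtain rfl | ho := eq_or_ne o' o
    · exact continuous_id.congr fun t => congrArg (Bundle.TotalSpace.mk _)
        (Pi.single_eq_same (M := fun o => (E o).Fib t.proj) _ _).symm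
    · exact ((hE o').isLocallyTrivial.continuous_zero (hE o).continuous_proj).congr fun t =>
        congrArg (Bundle.TotalSpace.mk _)
          (Pi.single_eq_of_ne (M := fun o => (E o).Fib t.proj) ho _).symm

variable {F : EqFamily X}

/-- The morphism out of a direct sum with given restrictions to the summands. -/
def piLift [Fintype O] (hF : F.IsBundle) (φ : ∀ o, (E o).Hom F) : (pi E).Hom F where
  toFun x := ∑ o, (φ o).toFun x ∘ₗ LinearMap.proj o
  comm h x y e s := by
    simp only [LinearMap.sum_apply, map_sum]
    exact Finset.sum_congr rfl fun o _ => (φ o).comm h e (s o)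
  continuous := by
    simp only [LinearMap.sum_apply]
    exact hF.isLocallyTrivial.continuous_sum (continuous_pi_proj E) Finset.univ fun o =>
      (φ o).continuous.comp (continuous_pi_apply E o)

theorem piLift_piSingle [Fintype O] [DecidableEq O] (hE : ∀ o, (E o).IsBundle) (hF : F.IsBundle)
    (φ : ∀ o, (E o).Hom F) (o : O) (x : X) (v : (E o).Fib x) :
    (piLift hF φ).toFun x ((piSingle hE o).toFun x v) = (φ o).toFun x v := by
  refine (LinearMap.sum_apply _ _ _).trans ((Finset.sum_eq_single o (fun o' _ ho => ?_)
    fun h => absurd (Finset.mem_univ o) h).trans ?_)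
  · exact (congrArg ((φ o').toFun x)
      (Pi.single_eq_of_ne (M := fun o => (E o).Fib x) ho v)).trans (map_zero _)
  · exact congrArg ((φ o).toFun x) (Pi.single_eq_same (M := fun o => (E o).Fib x) o v)

/-- A morphism of `G`-equivariant families as a morphism of `S`-equivariant families, for a subgroup
`S` of `G`. -/
def Hom.restrict {E F : EqFamily X} (φ : E.Hom F) (S : Subgroup H) :
    (E.restrict S).Hom (F.restrict S) where
  toFun x := φ.toFun x
  comm k _ _ e v := φ.comm (k : H) e v
  continuous := φ.continuous

end EqFamily

end Sums

section Clifford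

open scoped TensorProduct

variable {G : Type v} [Group G] [TopologicalSpace G] [DiscreteTopology G] {A : Subgroup G}
  [A.Normal] {τ π : IrrRep A} (c : TwistChoice τ) {X : GSpace.{u, v} G} (hX : X.TrivialOn A)
  {F : EqFamily ((X.res hX τ).ext c.cocycle)} (hF : F.IsScalar) (I : CosetIndex τ.inertia)

/-- The `A`-equivariant projection of the fibre of `Ind(F ⊗ V_τ)` at `x` onto `F_x ⊗ V_τ`. -/
def indEval (x : X) : (fibRep hX (ind I (tensor c hX hF)) x).IntertwiningMap
    ((Representation.trivial ℂ A (F.Fib (c.pt hX x))).tprod (unitaryRep τ.ρ)) where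
  toLinearMap := indEvalFib I (tensor c hX hF) x
  isIntertwining' a := LinearMap.ext fun s => by
    let k : τ.inertia := ⟨a, le_inertia τ a.2⟩
    have tensorAct_k := tensorAct_of_mem c hX (F := F) (k := k) a.2 (hX a x)
    exact (indEvalFib_indAct I k (x := x) (y := x) (hX a x) s).trans
      (LinearMap.congr_fun tensorAct_k (indEvalFib I (tensor c hX hF) x s))

/-- An element of `Hom_A(V_τ, E_x)` as an intertwining map. -/
def homAFib.toIntertwiningMap {E : EqFamily X} {x : X} (f : homAFib hX τ E x) :
    (unitaryRep τ.ρ).IntertwiningMap (fibRep hX E x) where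
  toLinearMap := f.1
  isIntertwining' a := LinearMap.ext (f.2 a)

/-- The component at `j` of an element of `Hom_A(V_π, Ind(F ⊗ V_τ))`, as an intertwining map
`V_π → F ⊗ t(j)V_τ`. -/
def homAComponent {x : X} (f : homAFib hX π (ind I (tensor c hX hF)) x) (j : I.J) :
    (unitaryRep π.ρ).IntertwiningMap ((Representation.trivial ℂ A
      (F.Fib (c.pt hX (I.pt X j x)))).tprod (unitaryRep (τ.conj (I.t j)).ρ)) where
  toLinearMap := LinearMap.proj j ∘ₗ f.1
  isIntertwining' a := LinearMap.ext fun v => by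
    let b : A := MulAut.conjNormal (I.t j)⁻¹ a
    let k : τ.inertia := ⟨b, le_inertia τ b.2⟩
    have t_mul : I.t j * k = a * I.t j := by simp [k, b, mul_assoc]
    have tensorAct_k := tensorAct_of_mem c hX (F := F) (k := k) b.2 (hX b (I.pt X j x))
    let s : ∀ j, (tensor c hX hF).Fib (I.pt X j x) := f.1 v
    exact (congrFun (f.2 a v) j).trans <| (indAct_apply I _ t_mul (hX a x) s).trans <|
      LinearMap.congr_fun tensorAct_k (s j)

theorem irr_mk_eq_of_component_ne_zero {x : X} (f : homAFib hX π (ind I (tensor c hX hF)) x)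
    {v : Fin π.d → ℂ} {j : I.J} (h : f.1 v j ≠ 0) : Irr.mk π = I.t j • Irr.mk τ := by
  have ne_zero : homAComponent c hX hF I f j ≠ 0 := fun h0 => h congr(($h0).toLinearMap v)
  exact irr_mk_eq_of_ne_zero ne_zero

theorem exists_eq_indUnitFib_tmul {x : X} (f : homAFib hX τ (ind I (tensor c hX hF)) x) :
    ∃ u : F.Fib (c.pt hX x), ∀ v, f.1 v = indUnitFib I (tensor c hX hF) x (u ⊗ₜ[ℂ] v) := by
  obtain ⟨u, hu⟩ := exists_eq_tmul ((indEval c hX hF I x).comp (homAFib.toIntertwiningMap hX f))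
  refine ⟨u, fun v => (eq_indUnitFib I fun j hj => ?_).trans (congrArg _ (hu v))⟩
  by_contra h
  exact hj ((I.t_mem_iff j).1 (irr_mk_eq_of_component_ne_zero c hX hF I f h).symm)

end Clifford

section CliffordSum

open scoped TensorProduct

variable {G : Type v} [Group G] [TopologicalSpace G] [DiscreteTopology G] {A : Subgroup G}
  [A.Normal] {X : GSpace.{u, v} G} (hX : X.TrivialOn A) {O : Type} {τ : O → IrrRep A}
  (c : ∀ o, TwistChoice (τ o)) (I : ∀ o, CosetIndex (τ o).inertia)
  {F : ∀ o, EqFamily ((X.res hX (τ o)).ext (c o).cocycle)} (hF : ∀ o, (F o).IsScalar)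

/-- The representations `τ_o` represent distinct orbits of `G`. -/
def DistinctOrbits {O : Type*} (τ : O → IrrRep A) : Prop :=
  ∀ (o o' : O) (g : G), Irr.mk (τ o) = g • Irr.mk (τ o') → o = o'

/-- The family `⨁_o Ind(F_o ⊗ V_{τ_o})`. -/
def indSum : EqFamily X :=
  EqFamily.pi fun o => ind (I o) (tensor (c o) hX (hF o))

variable (hB : ∀ o, (F o).IsBundle)

include hB in
theorem isBundle_ind_tensor (o : O) : (ind (I o) (tensor (c o) hX (hF o))).IsBundle :=
  isBundle_ind (I o) (isBundle_tensor (c o) hX (hF o) (hB o))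

include hB in
theorem isBundle_indSum [Finite O] : (indSum hX c I hF).IsBundle :=
  EqFamily.isBundle_pi (isBundle_ind_tensor hX c I hF hB)

/-- The morphism `F_o → Hom_A(V_{τ_o}, ⨁_o Ind(F_o ⊗ V_{τ_o}))`. -/
def indSumUnit [DecidableEq O] (o : O) : (F o).Hom (homA (c o) hX (indSum hX c I hF)) :=
  tensorCurry (c o) hX (hF o) (hB o)
    (((EqFamily.piSingle (isBundle_ind_tensor hX c I hF hB) o).restrict (τ o).inertia).comp
      (indUnit (I o) (isBundle_tensor (c o) hX (hF o) (hB o))))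

theorem indSumUnit_apply_self [DecidableEq O] (o : O) (x : X) (u : (F o).Fib ((c o).pt hX x))
    (v : Fin (τ o).d → ℂ) : ((indSumUnit hX c I hF hB o).toFun x u).1 v o =
      indUnitFib (I o) (tensor (c o) hX (hF o)) x (u ⊗ₜ[ℂ] v) :=
  Pi.single_eq_same _ _

theorem indSumUnit_apply_of_ne [DecidableEq O] {o o' : O} (ho : o' ≠ o) (x : X)
    (u : (F o).Fib ((c o).pt hX x)) (v : Fin (τ o).d → ℂ) :
    ((indSumUnit hX c I hF hB o).toFun x u).1 v o' = 0 :=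
  Pi.single_eq_of_ne ho _

theorem injective_indSumUnit [DecidableEq O] (o : O) (x : X) :
    Function.Injective ((indSumUnit hX c I hF hB o).toFun x) := by
  intro u u' h
  let i₀ : Fin (τ o).d := ⟨0, (τ o).d_pos⟩
  let e₀ : Fin (τ o).d → ℂ := Pi.single i₀ 1
  have recover (u : (F o).Fib ((c o).pt hX x)) :
      tensorCoord (c o) hX i₀ (indEvalFib (I o) (tensor (c o) hX (hF o)) x
        (((indSumUnit hX c I hF hB o).toFun x u).1 e₀ o)) = u := by
    refine (congrArg (tensorCoord (c o) hX i₀) ((congrArg (indEvalFib (I o) _ x)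
      (indSumUnit_apply_self hX c I hF hB o x u e₀)).trans (indEvalFib_indUnitFib
        (D := tensor (c o) hX (hF o)) (I o) x (u ⊗ₜ[ℂ] e₀)))).trans ?_
    rw [tensorCoord_tmul]
    simp [e₀]
  exact (recover u).symm.trans ((congrArg _ (congrArg _
    (congrArg (fun f : homAFib hX (τ o) (indSum hX c I hF) x => f.1 e₀ o) h))).trans (recover u'))

theorem surjective_indSumUnit [DecidableEq O] (hτ : DistinctOrbits τ) (o : O) (x : X) :
    Function.Surjective ((indSumUnit hX c I hF hB o).toFun x) := by
  intro (f : homAFib hX (τ o) (indSum hX c I hF) x)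
  let D (o' : O) := ind (I o') (tensor (c o') hX (hF o'))
  let component (o' : O) : homAFib hX (τ o) (D o') x := homAFibMap hX (EqFamily.piProj D o') x f
  obtain ⟨u, hu⟩ := exists_eq_indUnitFib_tmul (c o) hX (hF o) (I o) (component o)
  refine ⟨u, Subtype.ext (LinearMap.ext fun v => funext fun o' => ?_)⟩
  obtain rfl | ho := eq_or_ne o' o
  · exact (indSumUnit_apply_self hX c I hF hB o' x u v).trans (hu v).symm
  · refine (indSumUnit_apply_of_ne hX c I hF hB ho x u v).trans (Eq.symm (funext fun j => ?_))
    by_contra h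
    exact ho.symm
      (hτ _ _ _ (irr_mk_eq_of_component_ne_zero (c o') hX (hF o') (I o') (component o') h))

theorem bijective_indSumUnit [DecidableEq O] (hτ : DistinctOrbits τ) (o : O) (x : X) :
    Function.Bijective ((indSumUnit hX c I hF hB o).toFun x) :=
  ⟨injective_indSumUnit hX c I hF hB o x, surjective_indSumUnit hX c I hF hB hτ o x⟩

/-- The isomorphism `F_o ≅ Hom_A(V_{τ_o}, ⨁_o Ind(F_o ⊗ V_{τ_o}))`. -/
def indSumUnitIso [Finite A] [Fintype O] [DecidableEq O] (hτ : DistinctOrbits τ) (o : O) :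
    (F o).Iso (homA (c o) hX (indSum hX c I hF)) :=
  (hB o).isoOfBijective (isBundle_homA hX (c o) (isBundle_indSum hX c I hF hB))
    (indSumUnit hX c I hF hB o) (bijective_indSumUnit hX c I hF hB hτ o)

variable {E : EqFamily X} (hE : E.IsBundle) (ψ : ∀ o, (F o).Hom (homA (c o) hX E))

/-- The morphism `⨁_o Ind(F_o ⊗ V_{τ_o}) → E` adjoint to morphisms
`ψ_o : F_o → Hom_A(V_{τ_o}, E)`. -/
def indSumLift [Fintype O] : (indSum hX c I hF).Hom E :=
  EqFamily.piLift hE fun o => indLift (I o) hE (tensorLift (c o) hX (hF o) hE (ψ o))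

theorem homAFibMap_indSumLift_indSumUnit [Fintype O] [DecidableEq O] (o : O) (x : X)
    (u : (F o).Fib ((c o).pt hX x)) : homAFibMap hX (indSumLift hX c I hF hE ψ) x
      ((indSumUnit hX c I hF hB o).toFun x u) = (ψ o).toFun x u := by
  refine Subtype.ext (LinearMap.ext fun v => ?_)
  let φ := tensorLift (c o) hX (hF o) hE (ψ o)
  exact (EqFamily.piLift_piSingle (isBundle_ind_tensor hX c I hF hB) hE _ o x _).trans <|
    (indLiftFib_indUnitFib (I o) φ x (u ⊗ₜ[ℂ] v)).trans (tensorLiftFib_tmul (c o) hX (ψ o) x u v)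

variable (hψ : ∀ o x, Function.Bijective ((ψ o).toFun x))

/-- A bundle `E` is isomorphic to `⨁_o Ind(F_o ⊗ V_{τ_o})` when `F_o` is isomorphic to
`Hom_A(V_{τ_o}, E)`. -/
def indSumLiftIso [Finite A] [Fintype O] [DecidableEq O] (hτ : DistinctOrbits τ)
    (hτ' : MeetsAllOrbits τ) : (indSum hX c I hF).Iso E :=
  have bijective_homA (o : O) (x : X) :
      Function.Bijective (homAFibMap hX (τ := τ o) (indSumLift hX c I hF hE ψ) x) := by
    have comp_eq : homAFibMap hX (τ := τ o) (indSumLift hX c I hF hE ψ) x ∘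
        (indSumUnit hX c I hF hB o).toFun x = (ψ o).toFun x :=
      funext fun u => homAFibMap_indSumLift_indSumUnit hX c I hF hB hE ψ o x u
    refine ((bijective_indSumUnit hX c I hF hB hτ o x).of_comp_iff _).1 ?_
    exact (congrArg Function.Bijective comp_eq).mpr (hψ o x)
  (isBundle_indSum hX c I hF hB).isoOfBijective hE (indSumLift hX c I hF hE ψ)
    (bijective_of_homAFibMap hX hτ' (isBundle_indSum hX c I hF hB) hE _ bijective_homA)

end CliffordSum

section Classification

variable {G : Type v} [Group G] [TopologicalSpace G] [DiscreteTopology G] {A : Subgroup G}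
  [A.Normal] [Finite A] {X : GSpace.{u, v} G} (hX : X.TrivialOn A)

instance finiteIndex_inertia (τ : IrrRep A) : τ.inertia.FiniteIndex := by
  have := finite_irr (A := A)
  have := Finite.of_equiv _ (MulAction.orbitEquivQuotientStabilizer G (Irr.mk τ))
  exact Subgroup.finiteIndex_of_finite_quotient

/- Indexing by `Fin n` keeps `⨁_o` in the universe of the fibres. -/
theorem bijective_homVec_fin {n : ℕ} {τ : Fin n → IrrRep A} (c : ∀ o, TwistChoice (τ o))
    (hτ : DistinctOrbits τ) (hτ' : MeetsAllOrbits τ) :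
    Function.Bijective fun (k : Vec X) (o : Fin n) => homVec hX (c o) k := by
  let I (o : Fin n) : CosetIndex (τ o).inertia := (nonempty_cosetIndex _).some
  constructor
  · rintro ⟨E⟩ ⟨E'⟩ h
    let F (o : Fin n) := homA (c o) hX E.fam
    have i (o : Fin n) : (F o).Iso (homA (c o) hX E'.fam) :=
      (Quotient.exact (congrArg Subtype.val (congrFun h o))).some
    have hF (o : Fin n) : (F o).IsScalar := homA_isScalar (c o) hX E.fam
    have hB (o : Fin n) : (F o).IsBundle := isBundle_homA hX (c o) E.isBundle
    let iso := indSumLiftIso hX c I hF hB E.isBundle (fun o => (EqFamily.Iso.refl (F o)).hom)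
      (fun o x => Function.bijective_id) hτ hτ'
    let iso' := indSumLiftIso hX c I hF hB E'.isBundle (fun o => (i o).hom)
      (fun o x => ((i o).toEquiv x).bijective) hτ hτ'
    exact Quotient.sound ⟨iso.symm.trans iso'⟩
  · intro k
    choose F hF hk using fun o => (k o).2
    have hB (o : Fin n) : (F o).fam.IsBundle := (F o).isBundle
    refine ⟨Vec.mk ⟨indSum hX c I hF, isBundle_indSum hX c I hF hB⟩,
      funext fun o => Subtype.ext ?_⟩
    rw [← hk o]
    exact Quotient.sound ⟨(indSumUnitIso hX c I hF hB hτ o).symm⟩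

theorem bijective_homVec {O : Type*} [Finite O] {τ : O → IrrRep A}
    (c : ∀ o, TwistChoice (τ o)) (hτ : DistinctOrbits τ) (hτ' : MeetsAllOrbits τ) :
    Function.Bijective fun (k : Vec X) (o : O) => homVec hX (c o) k := by
  let e := Finite.equivFin O
  have distinct : DistinctOrbits (τ ∘ e.symm) := fun i j g h =>
    e.symm.injective (hτ _ _ g h)
  have meets : MeetsAllOrbits (τ ∘ e.symm) := fun π => by
    obtain ⟨o, g, h⟩ := hτ' π
    exact ⟨e o, g, by rwa [Function.comp_apply, e.symm_apply_apply]⟩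
  have bijective := bijective_homVec_fin hX (fun i => c (e.symm i)) distinct meets
  exact ((Equiv.piCongrLeft' _ e).bijective.of_comp_iff' _).1 bijective

end Classification

/-! ### Passage to K-theory -/

section Grothendieck

open Algebra

/-- The homomorphism of Grothendieck groups induced by a homomorphism of monoids. -/
def grothendieckMap {M N : Type*} [AddCommMonoid M] [AddCommMonoid N] (f : M →+ N) :
    GrothendieckAddGroup M →+ GrothendieckAddGroup N :=
  GrothendieckAddGroup.lift (GrothendieckAddGroup.of.comp f)

theorem grothendieckMap_of {M N : Type*} [AddCommMonoid M] [AddCommMonoid N] (f : M →+ N) (m : M) :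
    grothendieckMap f (GrothendieckAddGroup.of m) = GrothendieckAddGroup.of (f m) :=
  DFunLike.congr_fun (GrothendieckAddGroup.lift.symm_apply_apply (GrothendieckAddGroup.of.comp f)) m

theorem exists_eq_of_sub_of {M : Type*} [AddCommMonoid M] (k : GrothendieckAddGroup M) :
    ∃ m n : M, k = GrothendieckAddGroup.of m - GrothendieckAddGroup.of n := by
  obtain ⟨⟨m, n⟩, h⟩ := (AddLocalization.addMonoidOf (⊤ : AddSubmonoid M)).surj k
  exact ⟨m, n, eq_sub_of_add_eq h⟩

theorem grothendieckAddGroup_of_eq_of_iff {M : Type*} [AddCommMonoid M] {m n : M} :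
    GrothendieckAddGroup.of m = GrothendieckAddGroup.of n ↔ ∃ c, c + m = c + n :=
  (AddLocalization.addMonoidOf (⊤ : AddSubmonoid M)).eq_iff_exists.trans (by simp)

variable {O M : Type*} [AddCommMonoid M] {N : O → Type*} [∀ o, AddCommMonoid (N o)]

theorem bijective_grothendieckMap (θ : ∀ o, M →+ N o)
    (hθ : Function.Bijective fun (m : M) (o : O) => θ o m) :
    Function.Bijective fun (k : GrothendieckAddGroup M) (o : O) => grothendieckMap (θ o) k := by
  constructor
  · refine (injective_iff_map_eq_zero (AddMonoidHom.pi fun o => grothendieckMap (θ o))).2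
      fun k hk => ?_
    obtain ⟨m, n, rfl⟩ := exists_eq_of_sub_of k
    have stably_eq (o : O) : ∃ d, d + θ o m = d + θ o n := by
      have h := congrFun hk o
      rwa [AddMonoidHom.pi_apply, map_sub, grothendieckMap_of, grothendieckMap_of, Pi.zero_apply,
        sub_eq_zero, grothendieckAddGroup_of_eq_of_iff] at h
    choose d hd using stably_eq
    obtain ⟨c, rfl⟩ := hθ.2 d
    refine sub_eq_zero.2 (grothendieckAddGroup_of_eq_of_iff.2 ⟨c, hθ.1 (funext fun o => ?_)⟩)
    exact (map_add _ _ _).trans ((hd o).trans (map_add _ _ _).symm)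
  · intro l
    choose p q hpq using fun o => exists_eq_of_sub_of (l o)
    obtain ⟨m, rfl⟩ := hθ.2 p
    obtain ⟨n, rfl⟩ := hθ.2 q
    refine ⟨GrothendieckAddGroup.of m - GrothendieckAddGroup.of n, funext fun o => ?_⟩
    rw [hpq]
    exact (map_sub _ _ _).trans (congrArg₂ _ (grothendieckMap_of _ m) (grothendieckMap_of _ n))

/-- Homomorphisms `f_o` from `K` which together identify `K` with the product of the `L_o`
identify it with the direct sum. -/
def directSumEquiv [Finite O] {K : Type*} [AddCommGroup K] {L : O → Type*}
    [∀ o, AddCommGroup (L o)] (f : ∀ o, K →+ L o)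
    (hf : Function.Bijective fun (k : K) (o : O) => f o k) : K ≃+ ⨁ o, L o :=
  have := Fintype.ofFinite O
  (AddEquiv.ofBijective (AddMonoidHom.pi f) hf).trans (DirectSum.addEquivProd L).symm

end Grothendieck

section KTheory

variable {G : Type v} [Group G] [TopologicalSpace G] {A : Subgroup G}

theorem GSpace.trivialOn_point : (GSpace.point.{u, v} G).TrivialOn A := fun _ _ => rfl

variable [DiscreteTopology G] [A.Normal] [Finite A]

instance finite_irrOrbits : Finite (IrrOrbits A) :=
  have : Finite (Irr A) := finite_irr
  inferInstance

/-- The homomorphism `K_G^0(X) → ^{α_τ}K^0_{Q_[τ]}(X)` with `[E] ↦ [Hom_A(V_τ, E)]`. -/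
def homK0 {X : GSpace.{u, v} G} (hX : X.TrivialOn A) {τ : IrrRep A} (c : TwistChoice τ) :
    K0 X →+ TwK0 c.cocycle (X.res hX τ) := grothendieckMap (homVec hX c)

theorem homK0_map {X Y : GSpace.{u, v} G} (hX : X.TrivialOn A) (hY : Y.TrivialOn A)
    {τ : IrrRep A} (c : TwistChoice τ) (f : GMap X Y) (k : K0 Y) :
    homK0 hX c (K0.map f k) = TwK0.map c.cocycle (f.res hX hY τ) (homK0 hY c k) := by
  obtain ⟨m, n, rfl⟩ := exists_eq_of_sub_of k
  simp only [homK0, map_sub, K0.map_of, grothendieckMap_of, TwK0.map_of, homVec_map hX c hY]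

/-- The homomorphism `K_G^n(X) → ^{α_τ}K^n_{Q_[τ]}(X)`, the restriction of `homK0` for
`Σⁿ(X₊)`. -/
def homKn (n : ℕ) {X : GSpace.{u, v} G} (hX : X.TrivialOn A) {τ : IrrRep A}
    (c : TwistChoice τ) : Kn n X →+ TwKn c.cocycle n (X.res hX τ) :=
  AddMonoidHom.codRestrict ((homK0 (hX.susp n) c).comp (Kn n X).subtype)
    (TwKn c.cocycle n (X.res hX τ)) fun k =>
      (homK0_map GSpace.trivialOn_point (hX.susp n) c (X.base n) k).symm.trans
        ((congrArg (homK0 GSpace.trivialOn_point c) k.2).trans (map_zero _))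

variable {X : GSpace.{u, v} G} (hX : X.TrivialOn A) {O : Type*} [Finite O] {τ : O → IrrRep A}
  (c : ∀ o, TwistChoice (τ o))

theorem bijective_homK0 (hτ : DistinctOrbits τ) (hτ' : MeetsAllOrbits τ) :
    Function.Bijective fun (k : K0 X) (o : O) => homK0 hX (c o) k :=
  bijective_grothendieckMap (fun o => homVec hX (c o)) (bijective_homVec hX c hτ hτ')

/- A class over `Σⁿ(X₊)` is reduced as soon as all its images are, by naturality of the bijection
in degree `0` for the inclusion of the base point. -/
theorem bijective_homKn (n : ℕ) (hτ : DistinctOrbits τ) (hτ' : MeetsAllOrbits τ) :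
    Function.Bijective fun (k : Kn n X) (o : O) => homKn n hX (c o) k := by
  constructor
  · intro k k' h
    exact Subtype.ext ((bijective_homK0 (hX.susp n) c hτ hτ').1
      (funext fun o => congrArg Subtype.val (congrFun h o)))
  · intro l
    obtain ⟨k, hk⟩ := (bijective_homK0 (hX.susp n) c hτ hτ').2 fun o => (l o).1
    have reduced : k ∈ Kn n X := by
      refine (bijective_homK0 GSpace.trivialOn_point c hτ hτ').1 (funext fun o => ?_)
      refine (homK0_map GSpace.trivialOn_point (hX.susp n) (c o) (X.base n) k).trans ?_
      refine (congrArg _ (congrFun hk o)).trans ?_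
      exact (l o).2.trans (map_zero (homK0 GSpace.trivialOn_point (c o))).symm
    exact ⟨⟨k, reduced⟩, funext fun o => Subtype.ext (congrFun hk o)⟩

end KTheory

end EqK

end

theorem theorem3p4_general {G : Type v} [Group G] [TopologicalSpace G] [DiscreteTopology G]
    (A : Subgroup G) [A.Normal] [Finite A]
    (τ : EqK.IrrOrbits A → EqK.IrrRep A)
    (hτ : ∀ o, Quotient.mk (MulAction.orbitRel G (EqK.Irr A)) (EqK.Irr.mk (τ o)) = o)
    (c : ∀ o, EqK.TwistChoice (τ o)) :
    ∃ (Ψ₀ : ∀ (X : EqK.GSpace.{u, v} G) (hX : X.TrivialOn A),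
        EqK.K0 X ≃+ ⨁ o, EqK.TwK0 (c o).cocycle (X.res hX (τ o)))
      (Ψ : ∀ (n : ℕ) (X : EqK.GSpace.{u, v} G) (hX : X.TrivialOn A),
        EqK.Kn n X ≃+ ⨁ o, EqK.TwKn (c o).cocycle n (X.res hX (τ o))),
      (∀ X hX (E : EqK.EqBundle X) o, ∃ h : (EqK.homA (c o) hX E.fam).IsBundle,
        Ψ₀ X hX (EqK.K0.mk E) o =
          EqK.TwK0.mk (c o).cocycle ⟨EqK.homA (c o) hX E.fam, h⟩
            (EqK.homA_isScalar (c o) hX E.fam)) ∧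
      (∀ n X (hX : X.TrivialOn A) (k : EqK.Kn n X) o,
        ((Ψ n X hX k o : EqK.TwKn (c o).cocycle n (X.res hX (τ o))) :
          EqK.TwK0 (c o).cocycle ((X.res hX (τ o)).susp n)) =
          Ψ₀ (X.susp n) (hX.susp n) k o) ∧
      (∀ X Y (hX : X.TrivialOn A) (hY : Y.TrivialOn A) (f : EqK.GMap X Y) (k : EqK.K0 Y) o,
        Ψ₀ X hX (EqK.K0.map f k) o =
          EqK.TwK0.map (c o).cocycle (f.res hX hY (τ o)) (Ψ₀ Y hY k o)) ∧
      (∀ n X Y (hX : X.TrivialOn A) (hY : Y.TrivialOn A) (f : EqK.GMap X Y) (k : EqK.Kn n Y) o,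
        Ψ n X hX (EqK.Kn.map n f k) o =
          EqK.TwKn.map (c o).cocycle n (f.res hX hY (τ o)) (Ψ n Y hY k o)) := by
  have distinct : EqK.DistinctOrbits τ := fun o o' g h => by
    rw [← hτ o, ← hτ o']
    exact Quotient.sound ⟨g, h.symm⟩
  have meets : EqK.MeetsAllOrbits τ := fun π => by
    obtain ⟨g, hg⟩ := Quotient.exact (hτ (Quotient.mk _ (EqK.Irr.mk π)))
    exact ⟨_, g⁻¹, eq_inv_smul_iff.2 hg⟩
  refine ⟨fun X hX => EqK.directSumEquiv (fun o => EqK.homK0 hX (c o))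
      (EqK.bijective_homK0 hX c distinct meets),
    fun n X hX => EqK.directSumEquiv (fun o => EqK.homKn n hX (c o))
      (EqK.bijective_homKn hX c n distinct meets), ?_, ?_, ?_, ?_⟩
  · exact fun X hX E o => ⟨EqK.isBundle_homA hX (c o) E.isBundle,
      EqK.grothendieckMap_of (EqK.homVec hX (c o)) (EqK.Vec.mk E)⟩
  · exact fun n X hX k o => rfl
  · exact fun X Y hX hY f k o => EqK.homK0_map hX hY (c o) f k
  · exact fun n X Y hX hY f k o =>
      Subtype.ext (EqK.homK0_map (hX.susp n) (hY.susp n) (c o) (f.susp n) k)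

theorem theorem3p4 {G : Type v} [Group G] [Finite G] [TopologicalSpace G] [DiscreteTopology G]
    (A : Subgroup G) [A.Normal]
    -- a representative `τ o` of each orbit `o` of `G` on `Irr(A)`
    (τ : EqK.IrrOrbits A → EqK.IrrRep A)
    (hτ : ∀ o, Quotient.mk (MulAction.orbitRel G (EqK.Irr A)) (EqK.Irr.mk (τ o)) = o)
    -- the choices in the construction of the cocycles `α_τ`
    (c : ∀ o, EqK.TwistChoice (τ o)) :
    ∃ (Ψ₀ : ∀ (X : EqK.GSpace.{u, v} G) (hX : X.TrivialOn A),
        EqK.K0 X ≃+ ⨁ o, EqK.TwK0 (c o).cocycle (X.res hX (τ o)))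
      (Ψ : ∀ (n : ℕ) (X : EqK.GSpace.{u, v} G) (hX : X.TrivialOn A),
        EqK.Kn n X ≃+ ⨁ o, EqK.TwKn (c o).cocycle n (X.res hX (τ o))),
      -- in degree `0`, the component at `τ` of the image of `[E]` is `[Hom_A(V_τ, E)]`
      (∀ X hX (E : EqK.EqBundle X) o, ∃ h : (EqK.homA (c o) hX E.fam).IsBundle,
        Ψ₀ X hX (EqK.K0.mk E) o =
          EqK.TwK0.mk (c o).cocycle ⟨EqK.homA (c o) hX E.fam, h⟩
            (EqK.homA_isScalar (c o) hX E.fam)) ∧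
      -- in degree `n`, the map is the restriction of the map for `Σⁿ(X₊)`
      (∀ n X (hX : X.TrivialOn A) (k : EqK.Kn n X) o,
        ((Ψ n X hX k o : EqK.TwKn (c o).cocycle n (X.res hX (τ o))) :
          EqK.TwK0 (c o).cocycle ((X.res hX (τ o)).susp n)) =
          Ψ₀ (X.susp n) (hX.susp n) k o) ∧
      -- functoriality
      (∀ X Y (hX : X.TrivialOn A) (hY : Y.TrivialOn A) (f : EqK.GMap X Y) (k : EqK.K0 Y) o,
        Ψ₀ X hX (EqK.K0.map f k) o =
          EqK.TwK0.map (c o).cocycle (f.res hX hY (τ o)) (Ψ₀ Y hY k o)) ∧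
      (∀ n X Y (hX : X.TrivialOn A) (hY : Y.TrivialOn A) (f : EqK.GMap X Y) (k : EqK.Kn n Y) o,
        Ψ n X hX (EqK.Kn.map n f k) o =
          EqK.TwKn.map (c o).cocycle n (f.res hX hY (τ o)) (Ψ n Y hY k o)) :=
  theorem3p4_general A τ hτ c
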